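/- All manifolds are smooth, finite-dimensional, Hausdorff, second countable and without boundary; vector bundles are smooth, real and of finite rank. **Quasi-Jacobi bialgebroids.** A Jacobi algebroid $(A,\phi)$ is a Lie algebroid $(A,[\,,],\rho_A)$ over $M$ with a 1-cocycle $\phi\in\Gamma(A^*)$. Put $d^\phi\omega=d\omega+\phi\wedge\omega$ for $\omega\in\Gamma(\wedge^\bullet A^*)$, and $$[P,Q]^\phi=[P,Q]+(p-1)\,P\wedge i_\phi Q-(-1)^{p-1}(q-1)\,i_\phi P\wedge Q,\qquad P\in\Gamma(\wedge^pA),\ Q\in\Gamma(\wedge^qA),\ p,q\ge 0,$$ where $[P,Q]$ is the Schouten bracket. A quasi-Jacobi bialgebroid $(A,\phi,\tilde d_*,X_A)$ is a Jacobi algebroid with a section $W\in\Gamma(A)$, a linear operator $\tilde d_*:\Gamma(\wedge^\bullet A)\to\Gamma(\wedge^{\bullet+1}A)$ with $$\tilde d_*(P\wedge Q)=\tilde d_*P\wedge Q+(-1)^pP\wedge\tilde d_*Q-W\wedge P\wedge Q,\qquad \tilde d_*[P,Q]^\phi=[\tilde d_*P,Q]^\phi+(-1)^{p+1}[P,\tilde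 d_*Q]^\phi,$$ and a 3-section $X_A\in\Gamma(\wedge^3A)$ with $\tilde d_*X_A=0$ and $\tilde d_*^2=[X_A,\cdot]^\phi$. (Then $W=\tilde d_*1$.) Put $d_*P=\tilde d_*P-W\wedge P$, $\rho_{A^*}(\alpha)f=\alpha(d_*f)$ and $[\alpha,\beta]_{A^*}(X)=\rho_{A^*}(\alpha)(\beta(X))-\rho_{A^*}(\beta)(\alpha(X))-(d_*X)(\alpha,\beta)$. **Doubles.** The double $E=A\oplus A^*$ carries the pairing $\langle X+\alpha,Y+\beta\rangle=\tfrac12(\alpha(Y)+\beta(X))$, the anchor $E\to TM\times\mathbb R$, $X+\alpha\mapsto(\rho_A(X)+\rho_{A^*}(\alpha),\ \phi(X)+\alpha(W))$, and the bracket $$(X+\alpha)\circ(Y+\beta)=\big([X,Y]+\tilde{\mathcal L}_{*\alpha}Y-i_\beta\tilde d_*X+X_A(\alpha,\beta,\cdot)\big)+\big([\alpha,\beta]_{A^*}+\mathcal L^\phi_X\beta-i_Yd^\phi\alpha\big),$$ where $\mathcal L^\phi_X=i_Xd^\phi+d^\phi i_X$ and $\tilde{\mathcal L}_{*\alpha}=i_\alpha\tilde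 d_*+\tilde d_*i_\alpha$. **Morphisms.** Let $(A,\phi_A,\tilde d_{*A},X_A)$ over $M$ and $(B,\phi_B,\tilde d_{*B},X_B)$ over $N$ be quasi-Jacobi bialgebroids with sections $W_A,W_B$. A vector bundle map $\Phi:A\to B$ over a smooth map $\varphi:M\to N$ is a quasi-Jacobi bialgebroid morphism if (1) $\Phi^*\circ d^{\phi_B}_B=d^{\phi_A}_A\circ\Phi^*$ on $\Gamma(\wedge^\bullet B^*)$; (2) $[\Phi^*\alpha,\Phi^*\beta]_{A^*}=\Phi^*[\alpha,\beta]_{B^*}$; (3) $T\varphi\cdot\rho_{A^*}(\Phi^*\alpha)=\rho_{B^*}(\alpha)\circ\varphi$; (4) $\Phi X_A=X_B\circ\varphi$; (5) $\Phi W_A=W_B\circ\varphi$, for all $\alpha,\beta\in\Gamma(B^*)$. **Product and Dirac structures.** Let $E_1=A\oplus A^*$, $E_2=B\oplus B^*$ be the doubles. $E_1\times\overline{E_2}\to M\times N$ carries the pairing $\langle\,,\rangle_{E_1}-\langle\,,\rangle_{E_2}$, as anchor to $T(M\times N)\times\mathbb R$ the sum of the two anchors, and one of the following two brackets. (a) The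 product bracket: on sections pulled back from the factors it is the bracket of each factor (and zero between different factors), and it is extended to all sections by $e\circ(fe')=f(e\circ e')+(\rho(e)f)e'$ and $(fe)\circ e'=f(e\circ e')-(\rho(e')f)e+\langle e,e'\rangle Df$, where $\rho$ is the $T(M\times N)$-part of the anchor and $\langle c,Df\rangle=\rho(c)f$. (b) The bracket given by the formula for the double of $A\times B$ with cocycle $\phi_A+\phi_B$, section $W_A-W_B$, $B^*$ carrying minus its bracket and anchor, and 3-section $X_A+X_B$, transported by $b+b^*\mapsto b-b^*$. It differs from (a) only by terms of order zero: writing $e=(X+\alpha,\,X'+\alpha')$ and $e'=(Y+\beta,\,Y'+\beta')$, one adds $$\alpha'(W_B)Y-\beta'(W_B)X-\beta'(X')W_A+\phi_B(X')\beta-\phi_B(Y')\alpha-\alpha'(Y')\phi_A$$ to the component in $E_1$ and $$\alpha(W_A)Y'-\beta(W_A)X'-\beta(X)W_B+\phi_A(X)\beta'-\phi_A(Y)\alpha'-\alpha(Y)\phi_B$$ to the component in $E_2$. A Dirac structure supported on a submanifold $S$ is a vector subbundle $F$ of the restriction to $S$ such that (D1) each fibre is maximal isotropic; (D2) the anchor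 maps $F$ into $TS\times\mathbb R$; (D3) if two sections defined on the whole base restrict to sections of $F$ over $S$, then the restriction of their bracket to $S$ takes values in $F$. **Theorem.** Let $(\Phi,\varphi):A\to B$ be a quasi-Jacobi bialgebroid morphism. Then $$F=\{(a+\Phi^*b^*,\ \Phi a+b^*)\mid x\in M,\ a\in A_x,\ b^*\in B^*_{\varphi(x)}\}\subset E_1\times\overline{E_2}$$ is a Dirac structure supported on $\operatorname{graph}\varphi$, for the bracket (a) as well as for the bracket (b); in other words, $F$ is a Courant–Jacobi algebroid morphism from $E_1$ to $E_2$. -/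

import Mathlib

open Bundle Manifold ContDiff Module

set_option linter.unusedSectionVars false
set_option linter.style.haveILetI false

noncomputable section
namespace JacobiGeometry

section Algebra

variable {R L : Type*} [CommRing R] [Algebra ℝ R] [AddCommGroup L] [Module ℝ L] [Module R L]
  [IsScalarTower ℝ R L]

/-- A Lie–Rinehart algebra `(R, L)` over `ℝ`. -/
structure LieRinehart (R L : Type*) [CommRing R] [Algebra ℝ R] [AddCommGroup L] [Module ℝ L]
    [Module R L] where
  bracket : L →ₗ[ℝ] L →ₗ[ℝ] L
  anchor : L →ₗ[R] Derivation ℝ R R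
  bracket_self : ∀ X, bracket X X = 0
  jacobi : ∀ X Y Z, bracket X (bracket Y Z) = bracket (bracket X Y) Z + bracket Y (bracket X Z)
  leibniz : ∀ X (f : R) Y, bracket X (f • Y) = f • bracket X Y + anchor X f • Y

/-- The interior product `i_α P` of a multisection with a 1-form. -/
def contract (α : Dual R L) (P : ExteriorAlgebra R L) : ExteriorAlgebra R L :=
  CliffordAlgebra.contractLeft α P

/-- The grading involution `P ↦ (-1)^p P`. -/
def parity : ExteriorAlgebra R L →ₐ[R] ExteriorAlgebra R L := CliffordAlgebra.involute

theorem parity_ι (X : L) : parity (ExteriorAlgebra.ι R X) = -ExteriorAlgebra.ι R X :=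
  CliffordAlgebra.involute_ι X

theorem parity_parity (P : ExteriorAlgebra R L) : parity (parity P) = P :=
  CliffordAlgebra.involute_involute P

theorem ι_mul_eq (X : L) (P : ExteriorAlgebra R L) :
    ExteriorAlgebra.ι R X * P = parity P * ExteriorAlgebra.ι R X := by
  induction P using ExteriorAlgebra.induction with
  | algebraMap r => simp [Algebra.commutes]
  | ι Y =>
    rw [parity_ι, neg_mul, eq_neg_iff_add_eq_zero]
    exact ExteriorAlgebra.ι_add_mul_swap X Y
  | mul a b ha hb => rw [← mul_assoc, ha, mul_assoc, hb, map_mul, mul_assoc]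
  | add a b ha hb => rw [mul_add, ha, hb, map_add, add_mul]

theorem parity_contract (α : Dual R L) (P : ExteriorAlgebra R L) :
    parity (contract α P) = -contract α (parity P) := by
  induction P using CliffordAlgebra.left_induction with
  | algebraMap r => simp [contract]
  | add a b ha hb =>
    simp only [contract, map_add] at ha hb ⊢
    rw [ha, hb]; abel
  | ι_mul x m hx =>
    simp only [contract] at hx ⊢
    have h1 : (parity (CliffordAlgebra.ι 0 m * x) : ExteriorAlgebra R L)
      = -(CliffordAlgebra.ι 0 m * parity x) := by
      rw [map_mul, ← neg_mul]; congr 1; exact parity_ι m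
    rw [CliffordAlgebra.contractLeft_ι_mul, map_sub, map_smul, map_mul, h1, map_neg,
      CliffordAlgebra.contractLeft_ι_mul, hx]
    have h2 : (parity (CliffordAlgebra.ι 0 m) : ExteriorAlgebra R L) = -CliffordAlgebra.ι 0 m :=
      parity_ι m
    rw [h2]
    simp

/-! The unique graded derivation of the exterior algebra with given values on generators: the
upper right entry of an algebra map into upper triangular `2 × 2` matrices. -/

/-- The conditions on `δ` and `D` under which there is a map `T` of the exterior algebra with
`T (P ∧ Q) = σ P ∧ T Q + T P ∧ Q`, `T f = δ f` and `T X = D X`. -/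
structure SuperDer (σ : ExteriorAlgebra R L →ₐ[R] ExteriorAlgebra R L)
    (δ : Derivation ℝ R (ExteriorAlgebra R L)) (D : L →ₗ[ℝ] ExteriorAlgebra R L) : Prop where
  comm : ∀ f X, σ (ExteriorAlgebra.ι R X) * δ f = δ f * ExteriorAlgebra.ι R X
  smul : ∀ (f : R) X, D (f • X) = δ f * ExteriorAlgebra.ι R X + f • D X
  sq : ∀ X, σ (ExteriorAlgebra.ι R X) * D X + D X * ExteriorAlgebra.ι R X = 0

variable {σ : ExteriorAlgebra R L →ₐ[R] ExteriorAlgebra R L}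
    {δ : Derivation ℝ R (ExteriorAlgebra R L)} {D : L →ₗ[ℝ] ExteriorAlgebra R L}

variable (δ) in
/-- The matrix `(f, δ f; 0, f)`. -/
def scalarMatrix : R →+* Matrix (Fin 2) (Fin 2) (ExteriorAlgebra R L) where
  toFun f := !![algebraMap R _ f, δ f; 0, algebraMap R _ f]
  map_one' := by ext i j; fin_cases i <;> fin_cases j <;> simp
  map_zero' := by ext i j; fin_cases i <;> fin_cases j <;> simp
  map_add' f g := by ext i j; fin_cases i <;> fin_cases j <;> simp
  map_mul' f g := by
    ext i j
    have h : algebraMap R (ExteriorAlgebra R L) g * δ f = δ f * algebraMap R _ g :=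
      Algebra.commutes _ _
    fin_cases i <;> fin_cases j <;>
      simp [Matrix.mul_apply, Fin.sum_univ_two, Algebra.smul_def, h]

variable (δ) in
/-- The matrices that commute with all scalars `(f, δ f; 0, f)`. -/
abbrev TriAlg : Subring (Matrix (Fin 2) (Fin 2) (ExteriorAlgebra R L)) :=
  Subring.centralizer (Set.range (scalarMatrix δ))

variable (δ) in
def scalarTri : R →+* TriAlg δ :=
  (scalarMatrix δ).codRestrict _ (by
    rintro f _ ⟨g, rfl⟩
    rw [← map_mul, ← map_mul, mul_comm])

variable (δ) in
@[reducible] def triAlgebra : Algebra R (TriAlg δ) :=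
  (scalarTri δ).toAlgebra' (by
    intro f a
    exact Subtype.ext (a.2 _ ⟨f, rfl⟩))

/-- The matrix `(σ X, D X; 0, X)` of a generator `X`. -/
def SuperDer.gen (h : SuperDer σ δ D) :
    letI := triAlgebra δ
    L →ₗ[R] TriAlg δ :=
  letI := triAlgebra δ
  { toFun X := ⟨!![σ (ExteriorAlgebra.ι R X), D X; 0, ExteriorAlgebra.ι R X], by
      rintro _ ⟨f, rfl⟩
      ext i j
      fin_cases i <;> fin_cases j <;>
        simp [scalarMatrix, Matrix.mul_apply, Fin.sum_univ_two, Algebra.commutes, h.comm, add_comm]⟩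
    map_add' X Y := by
      ext i j
      fin_cases i <;> fin_cases j <;> simp
    map_smul' f X := by
      apply Subtype.ext
      change _ = scalarMatrix δ f * _
      ext i j
      fin_cases i <;> fin_cases j <;>
        simp [scalarMatrix, Matrix.mul_apply, Fin.sum_univ_two, h.smul, Algebra.smul_def, add_comm] }

theorem SuperDer.gen_sq (h : SuperDer σ δ D) (X : L) : h.gen X * h.gen X = 0 := by
  apply Subtype.ext
  change (_ : Matrix _ _ _) * _ = 0
  ext i j
  have h1 : σ (ExteriorAlgebra.ι R X) * σ (ExteriorAlgebra.ι R X) = 0 := by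
    rw [← map_mul, ExteriorAlgebra.ι_sq_zero, map_zero]
  fin_cases i <;> fin_cases j <;>
    simp [SuperDer.gen, Matrix.mul_apply, Fin.sum_univ_two, h1, h.sq]

/-- The algebra map `P ↦ (σ P, T P; 0, P)`. -/
def SuperDer.hom (h : SuperDer σ δ D) : ExteriorAlgebra R L →+* TriAlg δ :=
  letI := triAlgebra δ
  (ExteriorAlgebra.lift R ⟨h.gen, h.gen_sq⟩ : ExteriorAlgebra R L →ₐ[R] TriAlg δ).toRingHom

theorem SuperDer.hom_algebraMap (h : SuperDer σ δ D) (f : R) :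
    (h.hom (algebraMap R _ f)).1 = !![algebraMap R _ f, δ f; 0, algebraMap R _ f] := by
  letI := triAlgebra δ
  have := AlgHom.commutes
    (ExteriorAlgebra.lift R ⟨h.gen, h.gen_sq⟩ : ExteriorAlgebra R L →ₐ[R] TriAlg δ) f
  exact congrArg Subtype.val this

theorem SuperDer.hom_ι (h : SuperDer σ δ D) (X : L) :
    (h.hom (ExteriorAlgebra.ι R X)).1 =
      !![σ (ExteriorAlgebra.ι R X), D X; 0, ExteriorAlgebra.ι R X] := by
  letI := triAlgebra δ
  have := ExteriorAlgebra.lift_ι_apply R h.gen h.gen_sq X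
  exact congrArg Subtype.val this

/-- The graded derivation `T`. -/
def SuperDer.der (h : SuperDer σ δ D) (P : ExteriorAlgebra R L) : ExteriorAlgebra R L :=
  (h.hom P).1 0 1

theorem SuperDer.hom_eq (h : SuperDer σ δ D) (P : ExteriorAlgebra R L) :
    (h.hom P).1 = !![σ P, h.der P; 0, P] := by
  suffices H : (h.hom P).1 0 0 = σ P ∧ (h.hom P).1 1 0 = 0 ∧ (h.hom P).1 1 1 = P by
    ext i j
    fin_cases i <;> fin_cases j <;> simp [H, SuperDer.der]
  induction P using ExteriorAlgebra.induction with
  | algebraMap r => simp [h.hom_algebraMap]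
  | ι X => simp [h.hom_ι]
  | mul a b ha hb =>
    simp [Matrix.mul_apply, Fin.sum_univ_two, ha, hb]
  | add a b ha hb => simp [ha, hb]

theorem SuperDer.der_mul (h : SuperDer σ δ D) (P Q : ExteriorAlgebra R L) :
    h.der (P * Q) = σ P * h.der Q + h.der P * Q := by
  have := congrFun (congrFun (congrArg Subtype.val (h.hom.map_mul P Q)) 0) 1
  rw [Subring.coe_mul, h.hom_eq, h.hom_eq P, h.hom_eq Q] at this
  simpa only [Matrix.mul_apply, Fin.sum_univ_two, Matrix.of_apply, Matrix.cons_val',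
    Matrix.cons_val_zero, Matrix.cons_val_one, Matrix.cons_val_fin_one] using this

theorem SuperDer.der_add (h : SuperDer σ δ D) (P Q : ExteriorAlgebra R L) :
    h.der (P + Q) = h.der P + h.der Q := by
  simp [SuperDer.der]

theorem SuperDer.der_algebraMap (h : SuperDer σ δ D) (f : R) :
    h.der (algebraMap R _ f) = δ f := by simp [SuperDer.der, h.hom_algebraMap]

theorem SuperDer.der_ι (h : SuperDer σ δ D) (X : L) :
    h.der (ExteriorAlgebra.ι R X) = D X := by simp [SuperDer.der, h.hom_ι]

namespace LieRinehart

variable (g : LieRinehart R L)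

/-- The differential `df ∈ L*` of `f ∈ R`, i.e. `df(X) = ρ(X) f`. -/
def dfun (f : R) : Dual R L where
  toFun X := g.anchor X f
  map_add' X Y := by simp
  map_smul' a X := by simp

/-- The differential `f ↦ df` contracted into a multisection, as a derivation of `R`. -/
def contractD (P : ExteriorAlgebra R L) : Derivation ℝ R (ExteriorAlgebra R L) :=
  Derivation.mk'
    { toFun f := parity (contract (g.dfun f) P)
      map_add' f f' := by
        have : g.dfun (f + f') = g.dfun f + g.dfun f' := by ext X; simp [dfun]
        simp [this, contract]
      map_smul' c f := by
        have : g.dfun (c • f) = (algebraMap ℝ R c) • g.dfun f := by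
          ext X; simp [dfun, Algebra.smul_def]
        rw [this]
        simp only [contract, map_smul, LinearMap.smul_apply]
        rw [algebraMap_smul]; rfl }
    (by
      intro f f'
      have : g.dfun (f * f') = f • g.dfun f' + f' • g.dfun f := by ext X; simp [dfun]
      simp [this, contract])

theorem lieSuperDer (Y : L) : SuperDer (AlgHom.id R _)
    (((Algebra.linearMap R (ExteriorAlgebra R L)).compDer (g.anchor Y)))
    ((ExteriorAlgebra.ι R : L →ₗ[R] ExteriorAlgebra R L).restrictScalars ℝ ∘ₗ g.bracket Y) where
  comm f X := by simp [Algebra.commutes]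
  smul f X := by
    simp [g.leibniz, Algebra.smul_def, add_comm]
  sq X := by
    simp

/-- The Lie derivative `L_Y` on multisections: the derivation with `L_Y f = ρ(Y) f` and
`L_Y X = [Y, X]`. -/
def lieDer (Y : L) (P : ExteriorAlgebra R L) : ExteriorAlgebra R L := (g.lieSuperDer Y).der P

theorem lieDer_mul (Y : L) (P Q : ExteriorAlgebra R L) :
    g.lieDer Y (P * Q) = P * g.lieDer Y Q + g.lieDer Y P * Q := (g.lieSuperDer Y).der_mul P Q

theorem lieDer_add (Y : L) (P Q : ExteriorAlgebra R L) :
    g.lieDer Y (P + Q) = g.lieDer Y P + g.lieDer Y Q := (g.lieSuperDer Y).der_add P Q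

theorem lieDer_algebraMap (Y : L) (f : R) :
    g.lieDer Y (algebraMap R _ f) = algebraMap R _ (g.anchor Y f) :=
  (g.lieSuperDer Y).der_algebraMap f

theorem lieDer_ι (Y X : L) :
    g.lieDer Y (ExteriorAlgebra.ι R X) = ExteriorAlgebra.ι R (g.bracket Y X) :=
  (g.lieSuperDer Y).der_ι X

theorem bracket_swap (X Y : L) : g.bracket X Y = -g.bracket Y X := by
  have := g.bracket_self (X + Y)
  simp only [map_add, LinearMap.add_apply, g.bracket_self, zero_add, add_zero] at this
  exact eq_neg_of_add_eq_zero_right this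

theorem contract_mul (α : Dual R L) (P Q : ExteriorAlgebra R L) :
    contract α (P * Q) = contract α P * Q + parity P * contract α Q := by
  induction P using CliffordAlgebra.left_induction with
  | algebraMap r =>
    simp [contract, CliffordAlgebra.contractLeft_algebraMap_mul]
  | add a b ha hb =>
    simp only [contract, map_add, add_mul] at ha hb ⊢
    rw [ha, hb]; abel
  | ι_mul x m hx =>
    have h2 : (parity (CliffordAlgebra.ι 0 m) : ExteriorAlgebra R L) = -CliffordAlgebra.ι 0 m :=
      parity_ι m
    simp only [contract] at hx ⊢
    rw [mul_assoc, CliffordAlgebra.contractLeft_ι_mul, hx, CliffordAlgebra.contractLeft_ι_mul,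
      map_mul, h2, mul_add, sub_mul, smul_mul_assoc, neg_mul, neg_mul, mul_assoc, mul_assoc]
    abel

theorem lieDer_smul (f : R) (Y : L) (P : ExteriorAlgebra R L) :
    g.lieDer (f • Y) P = f • g.lieDer Y P - ExteriorAlgebra.ι R Y * contract (g.dfun f) P := by
  induction P using ExteriorAlgebra.induction with
  | algebraMap r => simp [lieDer_algebraMap, contract, Algebra.smul_def]
  | ι X =>
    have : g.bracket (f • Y) X = f • g.bracket Y X - g.anchor X f • Y := by
      rw [bracket_swap, g.leibniz, g.bracket_swap X Y]; simp; abel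
    have h2 : contract (g.dfun f) (ExteriorAlgebra.ι R X) = algebraMap R _ (g.anchor X f) :=
      CliffordAlgebra.contractLeft_ι (Q := (0 : QuadraticForm R L)) _ _
    rw [lieDer_ι, lieDer_ι, this, h2]
    simp [Algebra.smul_def, Algebra.commutes]
  | mul a b ha hb =>
    rw [lieDer_mul, lieDer_mul, ha, hb, contract_mul, mul_add, ← mul_assoc _ (parity a),
      ι_mul_eq Y (parity a), parity_parity]
    simp only [mul_sub, sub_mul, smul_add, Algebra.mul_smul_comm, Algebra.smul_mul_assoc, mul_assoc]
    abel
  | add a b ha hb =>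
    rw [lieDer_add, lieDer_add, ha, hb]
    simp [contract, mul_add]; abel

theorem parity_lieDer (Y : L) (P : ExteriorAlgebra R L) :
    parity (g.lieDer Y P) = g.lieDer Y (parity P) := by
  induction P using ExteriorAlgebra.induction with
  | algebraMap r => simp [lieDer_algebraMap]
  | ι X =>
    have h : g.lieDer Y (-ExteriorAlgebra.ι R X) = -g.lieDer Y (ExteriorAlgebra.ι R X) := by
      have := g.lieDer_add Y (-ExteriorAlgebra.ι R X) (ExteriorAlgebra.ι R X)
      rw [neg_add_cancel] at this
      have h0 := g.lieDer_algebraMap Y 0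
      rw [map_zero, map_zero, map_zero] at h0
      rw [h0] at this
      exact eq_neg_of_add_eq_zero_left this.symm
    rw [parity_ι, h, lieDer_ι, parity_ι]
  | mul a b ha hb => simp [lieDer_mul, ha, hb]
  | add a b ha hb => simp [lieDer_add, ha, hb]

theorem lieDer_add_left (X Y : L) (P : ExteriorAlgebra R L) :
    g.lieDer (X + Y) P = g.lieDer X P + g.lieDer Y P := by
  induction P using ExteriorAlgebra.induction with
  | algebraMap r => simp [lieDer_algebraMap]
  | ι X => simp [lieDer_ι]
  | mul a b ha hb => rw [lieDer_mul, lieDer_mul, lieDer_mul, ha, hb, mul_add, add_mul]; abel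
  | add a b ha hb => rw [lieDer_add, lieDer_add, lieDer_add, ha, hb]; abel

/-- `Y ↦ [P, Y] = -L_Y P`. -/
def negLieDer (P : ExteriorAlgebra R L) : L →ₗ[ℝ] ExteriorAlgebra R L where
  toFun Y := -g.lieDer Y P
  map_add' X Y := by rw [lieDer_add_left]; abel
  map_smul' c Y := by
    have h : g.dfun (algebraMap ℝ R c) = 0 := by ext X; simp [dfun]
    rw [← algebraMap_smul R c Y, lieDer_smul, h]
    simp [contract]

/-- For `P` of even degree, `[P, ·]` is an odd derivation. -/
theorem adSuperDer_even {P : ExteriorAlgebra R L} (hP : parity P = P) :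
    SuperDer parity (g.contractD P) (g.negLieDer P) where
  comm f X := by
    have h : parity (contract (g.dfun f) P) = -contract (g.dfun f) P := by
      rw [parity_contract, hP]
    change _ * parity _ = parity _ * _
    rw [← ι_mul_eq, parity_ι, h, neg_mul_neg]
  smul f X := by
    change -_ = parity _ * _ + _ • -_
    rw [← ι_mul_eq, lieDer_smul, smul_neg]; abel
  sq X := by
    change _ * -_ + -_ * _ = _
    rw [parity_ι, neg_mul_neg, ι_mul_eq, parity_lieDer, hP, neg_mul, add_neg_cancel]

/-- For `P` of odd degree, `[P, ·]` is an even derivation. -/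
theorem adSuperDer_odd {P : ExteriorAlgebra R L} (hP : parity P = -P) :
    SuperDer (AlgHom.id R _) (g.contractD P) (g.negLieDer P) where
  comm f X := by
    have h : parity (contract (g.dfun f) P) = contract (g.dfun f) P := by
      rw [parity_contract, hP]; simp [contract]
    change _ * parity _ = parity _ * _
    rw [← ι_mul_eq, h]; rfl
  smul f X := by
    change -_ = parity _ * _ + _ • -_
    rw [← ι_mul_eq, lieDer_smul, smul_neg]; abel
  sq X := by
    have h : g.lieDer X (-P) = -g.lieDer X P := by
      have := g.lieDer_add X (-P) P
      have h0 := g.lieDer_algebraMap X 0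
      simp only [map_zero] at h0
      rw [neg_add_cancel, h0] at this
      exact eq_neg_of_add_eq_zero_left this.symm
    change _ * -_ + -_ * _ = _
    simp only [AlgHom.id_apply]
    rw [mul_neg, ι_mul_eq, parity_lieDer, hP, h]; simp

theorem parity_evenPart (P : ExteriorAlgebra R L) :
    parity ((2⁻¹ : ℝ) • (P + parity P)) = (2⁻¹ : ℝ) • (P + parity P) := by
  rw [← algebraMap_smul R, map_smul, map_add, parity_parity, add_comm]

theorem parity_oddPart (P : ExteriorAlgebra R L) :
    parity ((2⁻¹ : ℝ) • (P - parity P)) = -((2⁻¹ : ℝ) • (P - parity P)) := by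
  rw [← algebraMap_smul R, map_smul, map_sub, parity_parity, ← smul_neg, neg_sub]

/-- The Schouten bracket `[P, Q]` of multisections. For homogeneous `P`, the map `[P, ·]` is the
graded derivation of degree `p - 1` with `[P, f] = (-1)^(p-1) i_{df} P` and `[P, Y] = -L_Y P`;
the even and the odd part of `P` are treated separately. -/
def schouten (P Q : ExteriorAlgebra R L) : ExteriorAlgebra R L :=
  (g.adSuperDer_even (parity_evenPart P)).der Q + (g.adSuperDer_odd (parity_oddPart P)).der Q

/-- The Schouten–Jacobi bracket `[P, Q]^φ` of multisections of degrees `p` and `q`: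
`[P, Q] + (p - 1) P ∧ i_φ Q - (-1)^(p-1) (q - 1) i_φ P ∧ Q`. -/
def schoutenJacobi (φ : Dual R L) (p q : ℕ) (P Q : ExteriorAlgebra R L) : ExteriorAlgebra R L :=
  g.schouten P Q + ((p : ℝ) - 1) • (P * contract φ Q)
    - ((-1 : ℝ) ^ (p + 1) * ((q : ℝ) - 1)) • (contract φ P * Q)

/-- `φ` is a 1-cocycle: `dφ = 0`. -/
def IsCocycle (φ : Dual R L) : Prop :=
  ∀ X Y, g.anchor X (φ Y) - g.anchor Y (φ X) - φ (g.bracket X Y) = 0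

/-- `d^φ f = df + f φ` for functions. -/
def dTwist₀ (φ : Dual R L) (f : R) : Dual R L := g.dfun f + f • φ

/-- `i_X (d^φ α)` for a 1-form `α`, where `d^φ α = dα + φ ∧ α`, that is
`(d^φ α)(X, Y) = ρ(X)(α Y) - ρ(Y)(α X) - α [X, Y] + φ(X) α(Y) - φ(Y) α(X)`. -/
def contractDTwist₁ (φ : Dual R L) (X : L) (α : Dual R L) : Dual R L where
  toFun Y := g.anchor X (α Y) - g.anchor Y (α X) - α (g.bracket X Y) + φ X * α Y - φ Y * α X
  map_add' Y Z := by simp; ring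
  map_smul' f Y := by simp [g.leibniz]; ring

/-- The Lie derivative `L^φ_X α = i_X d^φ α + d^φ (i_X α)`. -/
def lieTwist (φ : Dual R L) (X : L) (α : Dual R L) : Dual R L :=
  g.contractDTwist₁ φ X α + g.dTwist₀ φ (α X)

end LieRinehart

/-- The structure of a quasi-Jacobi bialgebroid on the Lie–Rinehart algebra `g`: a 1-cocycle `φ`,
a `W`-quasi-differential `d̃` on multisections and a 3-section `χ` with `d̃ χ = 0` and
`d̃² = [χ, ·]^φ`. -/
structure QuasiJacobiStructure (g : LieRinehart R L) where
  φ : Dual R L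
  cocycle : g.IsCocycle φ
  W : L
  /-- The operator `d̃`. -/
  d : ExteriorAlgebra R L →ₗ[ℝ] ExteriorAlgebra R L
  d_mem : ∀ p, ∀ P ∈ ⋀[R]^p L, d P ∈ ⋀[R]^(p + 1) L
  d_wedge : ∀ p, ∀ P ∈ ⋀[R]^p L, ∀ Q,
    d (P * Q) = d P * Q + (-1 : ℝ) ^ p • (P * d Q) - ExteriorAlgebra.ι R W * P * Q
  d_schouten : ∀ p q, ∀ P ∈ ⋀[R]^p L, ∀ Q ∈ ⋀[R]^q L,
    d (g.schoutenJacobi φ p q P Q) = g.schoutenJacobi φ (p + 1) q (d P) Q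
      + (-1 : ℝ) ^ (p + 1) • g.schoutenJacobi φ p (q + 1) P (d Q)
  χ : ExteriorAlgebra R L
  χ_mem : χ ∈ ⋀[R]^3 L
  d_χ : d χ = 0
  d_d : ∀ q, ∀ Q ∈ ⋀[R]^q L, d (d Q) = g.schoutenJacobi φ 3 q χ Q

namespace QuasiJacobiStructure

variable {g : LieRinehart R L} (S : QuasiJacobiStructure g)

/-- The derivation `d_* P = d̃ P - W ∧ P`. -/
def dStar (P : ExteriorAlgebra R L) : ExteriorAlgebra R L :=
  S.d P - ExteriorAlgebra.ι R S.W * P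

/-- The section `d_* f` of degree one. -/
def dStarFun (f : R) : L := ExteriorAlgebra.ιInv (S.dStar (algebraMap R _ f))

/-- `ρ_{A*}(α) f = α (d_* f)`. -/
def anchorStar (α : Dual R L) (f : R) : R := α (S.dStarFun f)

/-- The value `P(α, β)` of a 2-section. -/
def eval₂ (P : ExteriorAlgebra R L) (α β : Dual R L) : R :=
  ExteriorAlgebra.algebraMapInv (contract β (contract α P))

/-- The value `P(α, β, γ)` of a 3-section. -/
def eval₃ (P : ExteriorAlgebra R L) (α β γ : Dual R L) : R :=
  ExteriorAlgebra.algebraMapInv (contract γ (contract β (contract α P)))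

theorem dStar_algebraMap_mul (f : R) (P : ExteriorAlgebra R L) :
    S.dStar (algebraMap R _ f * P) = S.dStar (algebraMap R _ f) * P + f • S.dStar P := by
  have h := S.d_wedge 0 (algebraMap R _ f) (by simp [Submodule.mem_one]) P
  rw [dStar, h, dStar, dStar]
  have h1 : f • (ExteriorAlgebra.ι R S.W * P) =
      ExteriorAlgebra.ι R S.W * (algebraMap R _ f * P) := by
    rw [← Algebra.smul_def, mul_smul_comm]
  rw [pow_zero, one_smul, sub_mul, smul_sub, h1, mul_assoc, Algebra.smul_def]
  abel

theorem dStar_add (P Q : ExteriorAlgebra R L) : S.dStar (P + Q) = S.dStar P + S.dStar Q := by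
  simp only [dStar, map_add, mul_add]; abel

theorem dStar_algebraMap (f : R) :
    S.dStar (algebraMap R _ f) = ExteriorAlgebra.ι R (S.dStarFun f) := by
  have h0 : algebraMap R (ExteriorAlgebra R L) f ∈ ⋀[R]^0 L := by simp [Submodule.mem_one]
  have h : S.dStar (algebraMap R _ f) ∈ ⋀[R]^1 L := by
    apply sub_mem (S.d_mem 0 _ h0)
    have := Submodule.mul_mem_mul (M := ⋀[R]^1 L) (N := ⋀[R]^0 L)
      (m := ExteriorAlgebra.ι R S.W) (by simp) h0
    simpa using this
  simp only [pow_one, LinearMap.mem_range] at h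
  obtain ⟨X, hX⟩ := h
  rw [dStarFun, ← hX, ExteriorAlgebra.ι_leftInverse]

theorem dStarFun_mul (f h : R) :
    S.dStarFun (f * h) = h • S.dStarFun f + f • S.dStarFun h := by
  apply (ExteriorAlgebra.ι_inj R _ _).1
  rw [← dStar_algebraMap, map_mul, dStar_algebraMap_mul, dStar_algebraMap, dStar_algebraMap,
    map_add, map_smul, map_smul, ← Algebra.commutes, ← Algebra.smul_def]

theorem dStarFun_add (f h : R) : S.dStarFun (f + h) = S.dStarFun f + S.dStarFun h := by
  simp [dStarFun, dStar_add]

/-- The bracket on `L*`: `[α, β](X) = ρ_{A*}(α)(β X) - ρ_{A*}(β)(α X) - (d_* X)(α, β)`. -/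
def bracketStar (α β : Dual R L) : Dual R L where
  toFun X := S.anchorStar α (β X) - S.anchorStar β (α X)
    - eval₂ (S.dStar (ExteriorAlgebra.ι R X)) α β
  map_add' X Y := by
    simp only [map_add, anchorStar, dStarFun_add, dStar_add, eval₂, contract]; ring
  map_smul' f X := by
    have h : S.dStar (ExteriorAlgebra.ι R (f • X)) =
        ExteriorAlgebra.ι R (S.dStarFun f) * ExteriorAlgebra.ι R X
          + f • S.dStar (ExteriorAlgebra.ι R X) := by
      rw [map_smul, Algebra.smul_def, dStar_algebraMap_mul, dStar_algebraMap]
    have h2 (α : Dual R L) (X : L) :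
        contract α (ExteriorAlgebra.ι R X) = algebraMap R _ (α X) :=
      CliffordAlgebra.contractLeft_ι (Q := (0 : QuadraticForm R L)) _ _
    have h3 : eval₂ (ExteriorAlgebra.ι R (S.dStarFun f) * ExteriorAlgebra.ι R X) α β =
        α (S.dStarFun f) * β X - α X * β (S.dStarFun f) := by
      rw [eval₂, LieRinehart.contract_mul, h2, h2, parity_ι]
      have : contract β (algebraMap R (ExteriorAlgebra R L) (α (S.dStarFun f)) *
            ExteriorAlgebra.ι R X + -ExteriorAlgebra.ι R (S.dStarFun f) *
            algebraMap R (ExteriorAlgebra R L) (α X)) =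
          algebraMap R _ (α (S.dStarFun f) * β X - α X * β (S.dStarFun f)) := by
        rw [← Algebra.commutes, ← Algebra.smul_def, ← Algebra.smul_def]
        have h2' := h2 β X
        have h2'' := h2 β (S.dStarFun f)
        simp only [contract, map_add, map_smul, map_neg] at h2' h2'' ⊢
        rw [h2', h2'']
        simp [Algebra.smul_def, sub_eq_add_neg]
      rw [this]
      exact ExteriorAlgebra.algebraMap_leftInverse L _
    have h4 : eval₂ (f • S.dStar (ExteriorAlgebra.ι R X)) α β =
        f * eval₂ (S.dStar (ExteriorAlgebra.ι R X)) α β := by simp [eval₂, contract]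
    have h5 (P Q : ExteriorAlgebra R L) : eval₂ (P + Q) α β = eval₂ P α β + eval₂ Q α β := by
      simp [eval₂, contract]
    rw [h, h5, h3, h4]
    simp only [anchorStar, map_smul, smul_eq_mul, dStarFun_mul, map_add, RingHom.id_apply]
    ring

/-- The bracket of the double `L ⊕ L*`. Its two components are
`[X, Y]^φ + L̃_{*α} Y - i_β d̃ X + χ(α, β, ·)`, where `L̃_{*α} Y = i_α d̃ Y + d̃ (i_α Y)`, and
`[α, β]^W + L^φ_X β - i_Y d^φ α`; in degree one the twisted brackets `[X, Y]^φ`, `[α, β]^W` are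
`[X, Y]`, `[α, β]`. -/
def doubleBracket (e e' : L × Dual R L) : L × Dual R L :=
  (g.bracket e.1 e'.1 + ExteriorAlgebra.ιInv
      (contract e.2 (S.d (ExteriorAlgebra.ι R e'.1)) + S.d (algebraMap R _ (e.2 e'.1))
        - contract e'.2 (S.d (ExteriorAlgebra.ι R e.1)) + contract e'.2 (contract e.2 S.χ)),
    S.bracketStar e.2 e'.2 + g.lieTwist S.φ e.1 e'.2 - g.contractDTwist₁ S.φ e'.1 e.2)

end QuasiJacobiStructure
end Algebra

section Sections

/-- Smooth real functions on a manifold modelled on `E`. -/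
abbrev Fn (E M : Type*) [NormedAddCommGroup E] [NormedSpace ℝ E] [TopologicalSpace M]
    [ChartedSpace E M] := C^∞⟮𝓘(ℝ, E), M; 𝓘(ℝ, ℝ), ℝ⟯

/-- Smooth sections of the vector bundle `A` with model fibre `F`. -/
abbrev Sec (E F : Type*) [NormedAddCommGroup E] [NormedSpace ℝ E]
    [NormedAddCommGroup F] [NormedSpace ℝ F] {M : Type*} [TopologicalSpace M] [ChartedSpace E M]
    (A : M → Type*) [TopologicalSpace (TotalSpace F A)] [∀ x, TopologicalSpace (A x)]
    [FiberBundle F A] := Cₛ^∞⟮𝓘(ℝ, E); F, A⟯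

variable {E : Type*} [NormedAddCommGroup E] [NormedSpace ℝ E] [FiniteDimensional ℝ E]
  {M : Type*} [TopologicalSpace M] [ChartedSpace E M] [IsManifold 𝓘(ℝ, E) ∞ M] [T2Space M]
  {F : Type*} [NormedAddCommGroup F] [NormedSpace ℝ F] [FiniteDimensional ℝ F]
  {A : M → Type*} [TopologicalSpace (TotalSpace F A)] [∀ x, TopologicalSpace (A x)]
  [∀ x, AddCommGroup (A x)] [∀ x, Module ℝ (A x)] [FiberBundle F A] [VectorBundle ℝ F A]
  [ContMDiffVectorBundle ∞ F A 𝓘(ℝ, E)]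

instance instSMulSec : SMul (Fn E M) (Sec E F A) :=
  ⟨fun f X => ⟨fun x => f x • X x, f.contMDiff.smul_section X.contMDiff⟩⟩

theorem smul_sec_apply (f : Fn E M) (X : Sec E F A) (x : M) : (f • X) x = f x • X x := rfl

instance instModuleSec : Module (Fn E M) (Sec E F A) where
  one_smul X := by ext x; simp [smul_sec_apply]
  mul_smul f h X := by ext x; simp [smul_sec_apply, mul_smul]
  smul_zero f := by ext x; simp [smul_sec_apply]
  smul_add f X Y := by ext x; simp [smul_sec_apply]
  add_smul f h X := by ext x; simp [smul_sec_apply, add_smul]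
  zero_smul X := by ext x; simp [smul_sec_apply]

instance instTowerSec : IsScalarTower ℝ (Fn E M) (Sec E F A) where
  smul_assoc c f X := by ext x; simp [smul_sec_apply, mul_smul]

variable (E F A) in
/-- Smooth sections of the dual bundle `A*`: the `C^∞(M)`-linear maps `Γ(A) → C^∞(M)`. -/
abbrev DualSec := Dual (Fn E M) (Sec E F A)

/-! ### Values of dual sections at a point -/

variable (F A) in
theorem exists_bump (x : M) : ∃ χ : SmoothBumpFunction 𝓘(ℝ, E) x,
    tsupport χ ⊆ (trivializationAt F A x).baseSet := by
  obtain ⟨χ, -, h⟩ := (SmoothBumpFunction.nhds_basis_tsupport (I := 𝓘(ℝ, E)) x).mem_iff.1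
    ((trivializationAt F A x).open_baseSet.mem_nhds (FiberBundle.mem_baseSet_trivializationAt F A x))
  exact ⟨χ, h⟩

variable (F A) in
/-- A bump function at `x` supported in the domain of the preferred trivialization at `x`. -/
def bump (x : M) : SmoothBumpFunction 𝓘(ℝ, E) x := (exists_bump F A x).choose

variable (E F A) in
/-- Global sections that form a frame of `A` near `x`. -/
def frameSec (x : M) (i : Fin (finrank ℝ F)) : Sec E F A :=
  ⟨((bump F A x : SmoothBumpFunction 𝓘(ℝ, E) x) : M → ℝ) •
      (trivializationAt F A x).localFrame (finBasis ℝ F) i,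
    ContMDiffOn.smul_section_of_tsupport (bump F A x).contMDiff.contMDiffOn
      (trivializationAt F A x).open_baseSet (exists_bump F A x).choose_spec
      ((trivializationAt F A x).contMDiffOn_localFrame_baseSet ∞ (finBasis ℝ F) i)⟩

/-- Coordinates in the fibre over `y` with respect to the preferred trivialization at `x`. -/
def frameCoord (F : Type*) [NormedAddCommGroup F] [NormedSpace ℝ F] [FiniteDimensional ℝ F]
    {A : M → Type*} [TopologicalSpace (TotalSpace F A)] [∀ x, TopologicalSpace (A x)]
    [∀ x, AddCommGroup (A x)] [∀ x, Module ℝ (A x)] [FiberBundle F A] [VectorBundle ℝ F A]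
    (x y : M) (i : Fin (finrank ℝ F)) : A y →ₗ[ℝ] ℝ :=
  (finBasis ℝ F).coord i ∘ₗ (trivializationAt F A x).linearMapAt ℝ y

/-- The value at `x` of a section of `A*`, a linear form on `A x`. It is characterized by
`dualAt α x (X x) = (α X) x` for sections `X` of `A`. -/
def dualAt (α : DualSec E F A) (x : M) : Dual ℝ (A x) :=
  ∑ i, (α (frameSec E F A x i) x) • frameCoord F x x i

theorem sum_frameCoord (x y : M) (hy : y ∈ (trivializationAt F A x).baseSet) (v : A y) :
    ∑ i, frameCoord F x y i v • (trivializationAt F A x).localFrame (finBasis ℝ F) i y = v := by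
  have := ((trivializationAt F A x).basisAt (finBasis ℝ F) hy).sum_repr v
  conv_rhs => rw [← this]
  refine Finset.sum_congr rfl fun i _ => ?_
  rw [Trivialization.localFrame_apply_of_mem_baseSet _ _ hy]
  congr 1
  simp [frameCoord, Trivialization.basisAt, hy]

theorem contMDiffOn_frameCoord (x : M) (i : Fin (finrank ℝ F)) :
    ContMDiffOn (𝓘(ℝ, E).prod 𝓘(ℝ, F)) 𝓘(ℝ, ℝ) ∞
      (fun v : TotalSpace F A => frameCoord F x v.1 i v.2) (trivializationAt F A x).source := by
  have h1 := contMDiff_snd.comp_contMDiffOn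
    ((trivializationAt F A x).contMDiffOn (IB := 𝓘(ℝ, E)) (n := ∞))
  have h2 : ContMDiff 𝓘(ℝ, F) 𝓘(ℝ, ℝ) ∞ ((finBasis ℝ F).coord i) :=
    ((finBasis ℝ F).coord i).toContinuousLinearMap.contMDiff
  refine (h2.comp_contMDiffOn h1).congr fun v hv => ?_
  have hv' : v.1 ∈ (trivializationAt F A x).baseSet := by
    simpa [Trivialization.mem_source] using hv
  simp [frameCoord, hv']

theorem dualAt_apply (α : DualSec E F A) (x : M) (X : Sec E F A) :
    dualAt α x (X x) = α X x := by
  classical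
  set χ : SmoothBumpFunction 𝓘(ℝ, E) x := bump F A x with hχ
  have hsupp : tsupport χ ⊆ (trivializationAt F A x).baseSet := (exists_bump F A x).choose_spec
  let χf : Fn E M := ⟨χ, χ.contMDiff⟩
  have hc (i) : ContMDiff 𝓘(ℝ, E) 𝓘(ℝ, ℝ) ∞ (fun y => χ y • frameCoord F x y i (X y)) := by
    apply contMDiff_of_tsupport
    intro y hy
    have hy' : y ∈ (trivializationAt F A x).baseSet :=
      hsupp (tsupport_smul_subset_left _ _ hy)
    have h1 := (contMDiffOn_frameCoord (E := E) (A := A) x i).contMDiffAt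
      (x := (⟨y, X y⟩ : TotalSpace F A))
      ((trivializationAt F A x).open_source.mem_nhds (by simpa [Trivialization.mem_source] using hy'))
    exact χ.contMDiff.contMDiffAt.smul (h1.comp y X.contMDiff.contMDiffAt)
  let c (i) : Fn E M := ⟨_, hc i⟩
  have key : χf • χf • X = ∑ i, c i • frameSec E F A x i := by
    ext y
    have hs : (∑ i, c i • frameSec E F A x i : Sec E F A) y =
        ∑ i, (χ y • frameCoord F x y i (X y)) •
          (χ y • (trivializationAt F A x).localFrame (finBasis ℝ F) i y) := by
      have := congrFun (map_sum (ContMDiffSection.coeAddHom 𝓘(ℝ, E) F ∞ A)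
        (fun i => c i • frameSec E F A x i) Finset.univ) y
      rw [Finset.sum_apply] at this
      exact this
    rw [hs]
    by_cases hy : y ∈ (trivializationAt F A x).baseSet
    · conv_lhs => rw [smul_sec_apply, smul_sec_apply, ← sum_frameCoord x y hy (X y)]
      rw [Finset.smul_sum, Finset.smul_sum]
      refine Finset.sum_congr rfl fun i _ => ?_
      simp only [smul_smul, smul_eq_mul]
      congr 1
      change χ y * (χ y * _) = _
      ring
    · have h0 : χ y = 0 := by
        by_contra h
        exact hy (hsupp (subset_tsupport _ h))
      have h0' : χf y = 0 := h0
      simp [smul_sec_apply, h0, h0']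
  have h1 := congrArg (fun f : Fn E M => f x) (congrArg α key)
  simp only [map_smul, map_sum] at h1
  have hχx : χf x = 1 := χ.eq_one
  have hs (f : Fin (finrank ℝ F) → Fn E M) : (∑ i, f i : Fn E M) x = ∑ i, f i x := by
    have := congrFun (map_sum (ContMDiffMap.coeFnRingHom (I := 𝓘(ℝ, E)) (I' := 𝓘(ℝ, ℝ))
      (N := M) (R := ℝ) (n := ∞)) f Finset.univ) x
    rw [Finset.sum_apply] at this
    exact this
  rw [hs] at h1
  have h2 : (χf • χf • α X : Fn E M) x = α X x := by
    change χf x * (χf x * α X x) = _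
    rw [hχx]; ring
  rw [h2] at h1
  rw [h1]
  simp only [dualAt, LinearMap.sum_apply, LinearMap.smul_apply]
  refine Finset.sum_congr rfl fun i _ => ?_
  change _ = (χ x • frameCoord F x x i (X x)) * _
  rw [χ.eq_one]
  simp [mul_comm]

/-- A section of `A*` is a smooth function on the total space of `A`. -/
theorem contMDiff_dualAt (α : DualSec E F A) :
    ContMDiff (𝓘(ℝ, E).prod 𝓘(ℝ, F)) 𝓘(ℝ, ℝ) ∞
      (fun v : TotalSpace F A => dualAt α v.1 v.2) := by
  intro v₀
  set x := v₀.1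
  set χ : SmoothBumpFunction 𝓘(ℝ, E) x := bump F A x with hχ
  have hx : v₀ ∈ (trivializationAt F A x).source := by
    simpa [Trivialization.mem_source, x] using FiberBundle.mem_baseSet_trivializationAt F A v₀.1
  have h : ContMDiffAt (𝓘(ℝ, E).prod 𝓘(ℝ, F)) 𝓘(ℝ, ℝ) ∞
      (fun v : TotalSpace F A => ∑ i, frameCoord F x v.1 i v.2 * α (frameSec E F A x i) v.1) v₀ := by
    apply contMDiffAt_finsetSum
    intro i _
    refine ContMDiffAt.mul ?_ ?_
    · exact (contMDiffOn_frameCoord (E := E) (A := A) x i).contMDiffAt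
        ((trivializationAt F A x).open_source.mem_nhds hx)
    · exact ((α (frameSec E F A x i)).contMDiff.comp (contMDiff_proj A)).contMDiffAt
  refine h.congr_of_eventuallyEq ?_
  have hev : ∀ᶠ v : TotalSpace F A in nhds v₀, χ v.1 = 1 :=
    (FiberBundle.continuous_proj F A).continuousAt.eventually χ.eventuallyEq_one
  filter_upwards [hev, (trivializationAt F A x).open_source.mem_nhds hx] with v hv1 hv2
  have hv2' : v.1 ∈ (trivializationAt F A x).baseSet := by
    simpa [Trivialization.mem_source] using hv2
  let Z : Sec E F A := ∑ i, frameCoord F x v.1 i v.2 • frameSec E F A x i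
  have hZ : Z v.1 = v.2 := by
    have := congrFun (map_sum (ContMDiffSection.coeAddHom 𝓘(ℝ, E) F ∞ A)
        (fun i => frameCoord F x v.1 i v.2 • frameSec E F A x i) Finset.univ) v.1
    rw [Finset.sum_apply] at this
    refine this.trans ?_
    conv_rhs => rw [← sum_frameCoord x v.1 hv2' v.2]
    refine Finset.sum_congr rfl fun i _ => ?_
    change frameCoord F x v.1 i v.2 •
      (χ v.1 • (trivializationAt F A x).localFrame (finBasis ℝ F) i v.1) = _
    rw [hv1, one_smul]
  have h3 := dualAt_apply α v.1 Z
  rw [hZ] at h3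
  rw [h3]
  have h4 : α Z = ∑ i, (algebraMap ℝ (Fn E M) (frameCoord F x v.1 i v.2)) •
      α (frameSec E F A x i) := by
    simp only [Z, ← map_smul, ← map_sum, algebraMap_smul]
  rw [h4]
  have := congrFun (map_sum (ContMDiffMap.coeFnRingHom (I := 𝓘(ℝ, E)) (I' := 𝓘(ℝ, ℝ))
      (N := M) (R := ℝ) (n := ∞)) (fun i => (algebraMap ℝ (Fn E M) (frameCoord F x v.1 i v.2)) •
      α (frameSec E F A x i)) Finset.univ) v.1
  rw [Finset.sum_apply] at this
  exact this

/-! ### Lie algebroids -/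

variable (E) in
/-- The derivative `v ↦ v(f)` of a real function along tangent vectors at `x`. -/
def tderiv (f : M → ℝ) (x : M) : TangentSpace 𝓘(ℝ, E) x →ₗ[ℝ] ℝ :=
  ((NormedSpace.fromTangentSpace (f x)).toContinuousLinearMap ∘L
    mfderiv 𝓘(ℝ, E) 𝓘(ℝ, ℝ) f x).toLinearMap

variable (E F A) in
/-- A Lie algebroid structure on `A`: a vector bundle map `ρ : A → TM` and a Lie bracket on `Γ(A)`
with `[X, fY] = f[X, Y] + (ρ(X) f) Y`. -/
structure LieAlgebroid where
  anchor : ∀ x, A x →ₗ[ℝ] TangentSpace 𝓘(ℝ, E) x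
  contMDiff_anchor : ContMDiff (𝓘(ℝ, E).prod 𝓘(ℝ, F)) 𝓘(ℝ, E).tangent ∞
    (fun v : TotalSpace F A => (⟨v.1, anchor v.1 v.2⟩ : TangentBundle 𝓘(ℝ, E) M))
  bracket : Sec E F A →ₗ[ℝ] Sec E F A →ₗ[ℝ] Sec E F A
  bracket_self : ∀ X, bracket X X = 0
  jacobi : ∀ X Y Z, bracket X (bracket Y Z) = bracket (bracket X Y) Z + bracket Y (bracket X Z)
  leibniz : ∀ X (f : Fn E M) Y x, bracket X (f • Y) x =
    f x • bracket X Y x + tderiv E f x (anchor x (X x)) • Y x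

namespace LieAlgebroid

variable (g : LieAlgebroid E F A)

/-- The function `ρ(X) f`. -/
def deriv (X : Sec E F A) (f : Fn E M) : Fn E M :=
  ⟨fun x => tderiv E f x (g.anchor x (X x)), by
    have h1 : ContMDiff 𝓘(ℝ, E).tangent 𝓘(ℝ, ℝ).tangent ∞ (tangentMap 𝓘(ℝ, E) 𝓘(ℝ, ℝ) f) :=
      f.contMDiff.contMDiff_tangentMap (by simp)
    exact (contMDiff_snd_tangentBundle_modelSpace ℝ 𝓘(ℝ, ℝ)).comp
      (h1.comp (g.contMDiff_anchor.comp X.contMDiff))⟩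

/-- The Lie–Rinehart algebra `(C^∞(M), Γ(A))` of a Lie algebroid. -/
def toLieRinehart : LieRinehart (Fn E M) (Sec E F A) where
  bracket := g.bracket
  anchor :=
    { toFun X := Derivation.mk'
        { toFun := g.deriv X
          map_add' f h := by
            ext x
            change mfderiv 𝓘(ℝ, E) 𝓘(ℝ, ℝ) (f + h : M → ℝ) x _ = _
            rw [mfderiv_add (f.contMDiff.mdifferentiable (by simp) x)
              (h.contMDiff.mdifferentiable (by simp) x)]
            rfl
          map_smul' c f := by
            ext x
            change mfderiv 𝓘(ℝ, E) 𝓘(ℝ, ℝ) (c • f : M → ℝ) x _ = _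
            rw [const_smul_mfderiv (f.contMDiff.mdifferentiable (by simp) x)]
            rfl }
        (by
          intro f h
          ext x
          change mfderiv 𝓘(ℝ, E) 𝓘(ℝ, ℝ) (f * h : M → ℝ) x _ = _
          rw [((f.contMDiff.mdifferentiable (by simp) x).hasMFDerivAt.mul
            (h.contMDiff.mdifferentiable (by simp) x).hasMFDerivAt).mfderiv]
          rfl)
      map_add' X Y := by
        ext f x
        change tderiv E f x (g.anchor x (X x + Y x)) = _
        rw [map_add, map_add]; rfl
      map_smul' f X := by
        ext h x
        change tderiv E h x (g.anchor x (f x • X x)) = _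
        rw [map_smul, map_smul]; rfl }
  bracket_self := g.bracket_self
  jacobi := g.jacobi
  leibniz X f Y := by ext x; exact g.leibniz X f Y x

end LieAlgebroid

end Sections

section Bialgebroids

variable {E : Type*} [NormedAddCommGroup E] [NormedSpace ℝ E] [FiniteDimensional ℝ E]
  {M : Type*} [TopologicalSpace M] [ChartedSpace E M] [IsManifold 𝓘(ℝ, E) ∞ M] [T2Space M]
  {F : Type*} [NormedAddCommGroup F] [NormedSpace ℝ F] [FiniteDimensional ℝ F]
  {A : M → Type*} [TopologicalSpace (TotalSpace F A)] [∀ x, TopologicalSpace (A x)]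
  [∀ x, AddCommGroup (A x)] [∀ x, Module ℝ (A x)] [FiberBundle F A] [VectorBundle ℝ F A]
  [ContMDiffVectorBundle ∞ F A 𝓘(ℝ, E)]
  {E' : Type*} [NormedAddCommGroup E'] [NormedSpace ℝ E'] [FiniteDimensional ℝ E']
  {N : Type*} [TopologicalSpace N] [ChartedSpace E' N] [IsManifold 𝓘(ℝ, E') ∞ N] [T2Space N]
  {F' : Type*} [NormedAddCommGroup F'] [NormedSpace ℝ F'] [FiniteDimensional ℝ F']
  {B : N → Type*} [TopologicalSpace (TotalSpace F' B)] [∀ x, TopologicalSpace (B x)]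
  [∀ x, AddCommGroup (B x)] [∀ x, Module ℝ (B x)] [FiberBundle F' B] [VectorBundle ℝ F' B]
  [ContMDiffVectorBundle ∞ F' B 𝓘(ℝ, E')]

/-! ### Forms and Jacobi algebroid morphisms -/

variable (E F A) in
/-- Smooth `k`-forms, i.e. sections of `⋀^k A*`. -/
structure MForm (k : ℕ) where
  toFun : ∀ x, A x [⋀^Fin k]→ₗ[ℝ] ℝ
  contMDiff : ∀ X : Fin k → Sec E F A,
    ContMDiff 𝓘(ℝ, E) 𝓘(ℝ, ℝ) ∞ (fun x => toFun x (fun i => X i x))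

/-- The value at `x` of `(d^φ η)(X₀, …, X_k)`, where `d^φ η = dη + φ ∧ η`:
`∑ i, (-1)^i (ρ(X_i) + φ(X_i)) η(…, X̂_i, …)
  + ∑_{i<j} (-1)^(i+j) η([X_i, X_j], …, X̂_i, …, X̂_j, …)`.
In the last sum the bracket is written in the `i`-th slot, which turns the sign into `(-1)^j`. -/
def LieAlgebroid.dForm (g : LieAlgebroid E F A) (φ : DualSec E F A) {k : ℕ}
    (η : ∀ x, A x [⋀^Fin k]→ₗ[ℝ] ℝ) (X : Fin (k + 1) → Sec E F A) (x : M) : ℝ :=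
  ∑ i : Fin (k + 1), (-1 : ℝ) ^ (i : ℕ) *
      (tderiv E (fun z => η z (fun l => X (i.succAbove l) z)) x (g.anchor x (X i x))
        + dualAt φ x (X i x) * η x (fun l => X (i.succAbove l) x))
    + ∑ i : Fin (k + 1), ∑ j : Fin (k + 1), if i < j then
        (-1 : ℝ) ^ (j : ℕ) *
          η x (fun l => Function.update X i (g.bracket (X i) (X j)) (j.succAbove l) x)
      else 0

variable (E F A E' F' B) in
/-- A smooth vector bundle map `A → B` over a smooth map `M → N`. -/
structure VBMap where
  base : M → N
  contMDiff_base : ContMDiff 𝓘(ℝ, E) 𝓘(ℝ, E') ∞ base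
  map : ∀ x, A x →ₗ[ℝ] B (base x)
  contMDiff_map : ContMDiff (𝓘(ℝ, E).prod 𝓘(ℝ, F)) (𝓘(ℝ, E').prod 𝓘(ℝ, F')) ∞
    (fun v : TotalSpace F A => (⟨base v.1, map v.1 v.2⟩ : TotalSpace F' B))

theorem VBMap.contMDiff_pullback (Ψ : VBMap E F A E' F' B) (α : DualSec E' F' B)
    (X : Sec E F A) : ContMDiff 𝓘(ℝ, E) 𝓘(ℝ, ℝ) ∞
      (fun x => dualAt α (Ψ.base x) (Ψ.map x (X x))) := by
  have h2 : ContMDiff 𝓘(ℝ, E) (𝓘(ℝ, E').prod 𝓘(ℝ, F')) ∞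
      (fun x => (⟨Ψ.base x, Ψ.map x (X x)⟩ : TotalSpace F' B)) :=
    Ψ.contMDiff_map.comp X.contMDiff
  have h1 := contMDiff_dualAt α
  generalize hG : (fun v : TotalSpace F' B => dualAt α v.1 v.2) = G at h1
  have h3 : (fun x => dualAt α (Ψ.base x) (Ψ.map x (X x))) =
      G ∘ (fun x => (⟨Ψ.base x, Ψ.map x (X x)⟩ : TotalSpace F' B)) := by
    rw [← hG]; rfl
  rw [h3]
  exact h1.comp h2

/-- The pull-back `Ψ* : Γ(B*) → Γ(A*)`, `(Ψ*α)(X)(x) = ⟨α(ψ x), Ψ_x (X x)⟩`. -/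
def VBMap.pullback (Ψ : VBMap E F A E' F' B) (α : DualSec E' F' B) : DualSec E F A where
  toFun X := ⟨fun x => dualAt α (Ψ.base x) (Ψ.map x (X x)), Ψ.contMDiff_pullback α X⟩
  map_add' X Y := by
    ext x
    change dualAt α (Ψ.base x) (Ψ.map x (X x + Y x)) = _
    rw [map_add, map_add]; rfl
  map_smul' f X := by
    ext x
    change dualAt α (Ψ.base x) (Ψ.map x (f x • X x)) = _
    rw [map_smul, map_smul]; rfl

/-- `Ψ` is a Jacobi algebroid morphism `(A, φ_A) → (B, φ_B)`: `Ψ* ∘ d^{φ_B} = d^{φ_A} ∘ Ψ*` on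
forms of every degree. Both sides are evaluated on vectors `X_i(x)`, and `Y_i` are sections of `B`
through the image vectors `Ψ (X_i(x))`. -/
def VBMap.IsJacobiMorphism (Ψ : VBMap E F A E' F' B) (gA : LieAlgebroid E F A)
    (φA : DualSec E F A) (gB : LieAlgebroid E' F' B) (φB : DualSec E' F' B) : Prop :=
  ∀ (k : ℕ) (η : MForm E' F' B k) (X : Fin (k + 1) → Sec E F A) (Y : Fin (k + 1) → Sec E' F' B)
    (x : M), (∀ i, Ψ.map x (X i x) = Y i (Ψ.base x)) →
    gB.dForm φB η.toFun Y (Ψ.base x) =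
      gA.dForm φA (fun z => (η.toFun (Ψ.base z)).compLinearMap (Ψ.map z)) X x

/-! ### Quasi-Jacobi bialgebroids and their doubles -/

variable (E F A) in
/-- A quasi-Jacobi bialgebroid `(A, φ, d̃_*, X_A)`. Multisections of `A` are the elements of the
exterior algebra of the `C^∞(M)`-module `Γ(A)`. -/
structure QuasiJacobiBialgebroid where
  alg : LieAlgebroid E F A
  str : QuasiJacobiStructure alg.toLieRinehart

variable (E) in
/-- The `i`-th coordinate function of the preferred chart at `x`, cut off away from `x`. -/
def coordFn (x : M) (i : Fin (finrank ℝ E)) : Fn E M :=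
  let χ : SmoothBumpFunction 𝓘(ℝ, E) x := Classical.choice inferInstance
  ⟨fun y => χ y • (finBasis ℝ E).coord i (extChartAt 𝓘(ℝ, E) x y),
    χ.contMDiff_smul (((finBasis ℝ E).coord i).toContinuousLinearMap.contMDiff.comp_contMDiffOn
      (contMDiffOn_extChartAt (I := 𝓘(ℝ, E)) (x := x)))⟩

namespace QuasiJacobiBialgebroid

variable (Q : QuasiJacobiBialgebroid E F A)

/-- The anchor `ρ_{A*} : A* → TM`, determined by `ρ_{A*}(ξ) f = ξ (d_* f)`: the tangent vector whose
components in the preferred chart at `x` are the numbers `ξ (d_* xⁱ)`. -/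
def anchorStar (x : M) : Dual ℝ (A x) →ₗ[ℝ] TangentSpace 𝓘(ℝ, E) x :=
  ∑ i, (Dual.eval ℝ (A x) (Q.str.dStarFun (coordFn E x i) x)).smulRight
    (show TangentSpace 𝓘(ℝ, E) x from finBasis ℝ E i)

/-- The anchor `ρ = ρ_A^φ + ρ_{A*}^W : A ⊕ A* → TM ⊕ ℝ` of the double. -/
def anchor (x : M) : A x × Dual ℝ (A x) →ₗ[ℝ] TangentSpace 𝓘(ℝ, E) x × ℝ :=
  ((Q.alg.anchor x).prod (dualAt Q.str.φ x)).coprod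
    ((Q.anchorStar x).prod (Dual.eval ℝ (A x) (Q.str.W x)))

/-- The bracket on sections of the double `A ⊕ A*`. -/
def bracket (e e' : Sec E F A × DualSec E F A) : Sec E F A × DualSec E F A :=
  Q.str.doubleBracket e e'

end QuasiJacobiBialgebroid

/-- A quasi-Jacobi bialgebroid morphism. -/
structure IsQuasiJacobiMorphism (P : QuasiJacobiBialgebroid E F A)
    (Q : QuasiJacobiBialgebroid E' F' B) (Ψ : VBMap E F A E' F' B) : Prop where
  jacobi : Ψ.IsJacobiMorphism P.alg P.str.φ Q.alg Q.str.φ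
  bracket : ∀ α β, P.str.bracketStar (Ψ.pullback α) (Ψ.pullback β) =
    Ψ.pullback (Q.str.bracketStar α β)
  anchor : ∀ (α : DualSec E' F' B) (x : M),
    mfderiv 𝓘(ℝ, E) 𝓘(ℝ, E') Ψ.base x (P.anchorStar x (dualAt (Ψ.pullback α) x)) =
      Q.anchorStar (Ψ.base x) (dualAt α (Ψ.base x))
  /-- `Ψ X_A = X_B ∘ ψ`, tested on sections of `B*`. -/
  trisection : ∀ (α β γ : DualSec E' F' B) (x : M),
    QuasiJacobiStructure.eval₃ P.str.χ (Ψ.pullback α) (Ψ.pullback β) (Ψ.pullback γ) x =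
      QuasiJacobiStructure.eval₃ Q.str.χ α β γ (Ψ.base x)
  section_W : ∀ x, Ψ.map x (P.str.W x) = Q.str.W (Ψ.base x)

/-! ### The product of two doubles -/

/-- The pairing `⟨X + α, Y + β⟩ = ½ (α(Y) + β(X))` on `V ⊕ V*`. -/
def dpairing (V : Type*) [AddCommGroup V] [Module ℝ V] :
    V × Dual ℝ V →ₗ[ℝ] V × Dual ℝ V →ₗ[ℝ] ℝ :=
  LinearMap.mk₂ ℝ (fun e e' => (1 / 2) * (e.2 e'.1 + e'.2 e.1))
    (by intros; simp; ring) (by intros; simp; ring) (by intros; simp; ring)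
    (by intros; simp; ring)

/-- The element `Z` of `V ⊕ V*` with `⟨Z, c⟩ = l(c)` for all `c`. -/
def dsharp (V : Type*) [AddCommGroup V] [Module ℝ V] [FiniteDimensional ℝ V]
    (l : Dual ℝ (V × Dual ℝ V)) : V × Dual ℝ V :=
  ((evalEquiv ℝ V).symm ((2 : ℝ) • (l ∘ₗ LinearMap.inr ℝ V (Dual ℝ V))),
    (2 : ℝ) • (l ∘ₗ LinearMap.inl ℝ V (Dual ℝ V)))

theorem dpairing_dsharp (V : Type*) [AddCommGroup V] [Module ℝ V] [FiniteDimensional ℝ V]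
    (l : Dual ℝ (V × Dual ℝ V)) (c : V × Dual ℝ V) : dpairing V (dsharp V l) c = l c := by
  have h : c.2 ((evalEquiv ℝ V).symm ((2 : ℝ) • (l ∘ₗ LinearMap.inr ℝ V (Dual ℝ V)))) =
      2 * l (0, c.2) := by
    rw [apply_evalEquiv_symm_apply]; simp
  have h2 : l c = l (c.1, 0) + l (0, c.2) := by rw [← map_add]; simp
  rw [h2]
  simp [dpairing, dsharp]
  ring

variable (E) in
/-- The derivative `v ↦ ∂_v u` at `x` of a function `u` with values in a finite-dimensional vector
space. -/
def vderiv {V : Type*} [AddCommGroup V] [Module ℝ V] [FiniteDimensional ℝ V] (u : M → V) (x : M) :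
    TangentSpace 𝓘(ℝ, E) x →ₗ[ℝ] V :=
  ∑ i, (tderiv E (fun z => (finBasis ℝ V).coord i (u z)) x).smulRight (finBasis ℝ V i)

variable (A B) in
/-- The fibre of `(A ⊕ A*) × (B ⊕ B*)` over a point of `M × N`. -/
abbrev ProdFibre (p : M × N) : Type _ :=
  (A p.1 × Dual ℝ (A p.1)) × (B p.2 × Dual ℝ (B p.2))

variable (E F A E' F' B) in
/-- Smooth sections of `(A ⊕ A*) × (B ⊕ B*)` over `M × N`. A family of linear forms is smooth when
it is a smooth function of the base point and of the vector to which it is applied. -/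
structure ProdSec where
  val : ∀ p : M × N, ProdFibre A B p
  contMDiff_a : ContMDiff (𝓘(ℝ, E).prod 𝓘(ℝ, E')) (𝓘(ℝ, E).prod 𝓘(ℝ, F)) ∞
    (fun p : M × N => (⟨p.1, (val p).1.1⟩ : TotalSpace F A))
  contMDiff_α : ContMDiff ((𝓘(ℝ, E).prod 𝓘(ℝ, F)).prod 𝓘(ℝ, E')) 𝓘(ℝ, ℝ) ∞
    (fun q : TotalSpace F A × N => (val (q.1.1, q.2)).1.2 q.1.2)
  contMDiff_b : ContMDiff (𝓘(ℝ, E).prod 𝓘(ℝ, E')) (𝓘(ℝ, E').prod 𝓘(ℝ, F')) ∞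
    (fun p : M × N => (⟨p.2, (val p).2.1⟩ : TotalSpace F' B))
  contMDiff_β : ContMDiff (𝓘(ℝ, E).prod (𝓘(ℝ, E').prod 𝓘(ℝ, F'))) 𝓘(ℝ, ℝ) ∞
    (fun q : M × TotalSpace F' B => (val (q.1, q.2.1)).2.2 q.2.2)

namespace ProdSec

/-- The section `x ↦ e₁(x, y)` of `A ⊕ A*`, for fixed `y`. -/
def slice₁ (e : ProdSec E F A E' F' B) (y : N) : Sec E F A × DualSec E F A :=
  (⟨fun x => (e.val (x, y)).1.1, e.contMDiff_a.comp (contMDiff_id.prodMk contMDiff_const)⟩,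
    { toFun X := ⟨fun x => (e.val (x, y)).1.2 (X x),
        e.contMDiff_α.comp (X.contMDiff.prodMk contMDiff_const)⟩
      map_add' X Y := by
        ext x
        change (e.val (x, y)).1.2 (X x + Y x) = _
        rw [map_add]; rfl
      map_smul' f X := by
        ext x
        change (e.val (x, y)).1.2 (f x • X x) = _
        rw [map_smul]; rfl })

/-- The section `y ↦ e₂(x, y)` of `B ⊕ B*`, for fixed `x`. -/
def slice₂ (e : ProdSec E F A E' F' B) (x : M) : Sec E' F' B × DualSec E' F' B :=
  (⟨fun y => (e.val (x, y)).2.1, e.contMDiff_b.comp (contMDiff_const.prodMk contMDiff_id)⟩,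
    { toFun X := ⟨fun y => (e.val (x, y)).2.2 (X y),
        e.contMDiff_β.comp (contMDiff_const.prodMk X.contMDiff)⟩
      map_add' X Y := by
        ext y
        change (e.val (x, y)).2.2 (X y + Y y) = _
        rw [map_add]; rfl
      map_smul' f X := by
        ext y
        change (e.val (x, y)).2.2 (f y • X y) = _
        rw [map_smul]; rfl })

end ProdSec

/-- The value at `x` of a section of `A ⊕ A*`. -/
def dvalue (e : Sec E F A × DualSec E F A) (x : M) : A x × Dual ℝ (A x) := (e.1 x, dualAt e.2 x)

namespace QuasiJacobiBialgebroid

variable (P : QuasiJacobiBialgebroid E F A) (Q : QuasiJacobiBialgebroid E' F' B)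

/-- The pairing of `E₁ × Ē₂` for the doubles `E₁ = A ⊕ A*` and `E₂ = B ⊕ B*`: the pairing of `E₁`
minus the pairing of `E₂`. -/
def prodPairing (A : M → Type*) (B : N → Type*) [∀ x, AddCommGroup (A x)] [∀ x, Module ℝ (A x)]
    [∀ x, AddCommGroup (B x)] [∀ x, Module ℝ (B x)] (p : M × N) :
    ProdFibre A B p →ₗ[ℝ] ProdFibre A B p →ₗ[ℝ] ℝ :=
  (dpairing (A p.1)).compl₁₂ (LinearMap.fst ℝ _ _) (LinearMap.fst ℝ _ _)
    - (dpairing (B p.2)).compl₁₂ (LinearMap.snd ℝ _ _) (LinearMap.snd ℝ _ _)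

/-- The anchor of `E₁ × Ē₂`, with values in `T(M × N) ⊕ ℝ`. -/
def prodAnchor (p : M × N) :
    ProdFibre A B p →ₗ[ℝ] TangentSpace (𝓘(ℝ, E).prod 𝓘(ℝ, E')) p × ℝ where
  toFun e := (((P.anchor p.1 e.1).1, (Q.anchor p.2 e.2).1),
    (P.anchor p.1 e.1).2 + (Q.anchor p.2 e.2).2)
  map_add' e e' := by
    refine Prod.ext (Prod.ext ?_ ?_) ?_
    · simp; rfl
    · simp; rfl
    · simp only [Prod.fst_add, Prod.snd_add, map_add]; ring
  map_smul' c e := by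
    refine Prod.ext (Prod.ext ?_ ?_) ?_
    · simp; rfl
    · simp; rfl
    · simp [mul_add]

/-- The product bracket on `E₁ × Ē₂`, at the point `(x, y)`. On sections pulled back from the two
factors it is the bracket of each factor, and it is extended to all sections by the Leibniz rules
`e ∘ (f e') = f (e ∘ e') + (ρ(e) f) e'` and
`(f e) ∘ e' = f (e ∘ e') - (ρ(e') f) e + ⟨e, e'⟩ Df`, where `⟨c, Df⟩ = ρ(c) f`
and `ρ` is the `T(M × N)`-part of the anchor. Explicitly, with `e = (e₁, e₂)`, `e' = (e₁', e₂')`,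
the first component is
`e₁(·, y) ∘ e₁'(·, y) + ∂_{ρ(e₂)} e₁'(x, ·) - ∂_{ρ(e₂')} e₁(x, ·) + Z`, where
`⟨Z, c⟩ = - ⟨∂_{ρ(c)} e₂(·, y), e₂'⟩` for `c ∈ A_x ⊕ A_x*`, and symmetrically for the second. -/
def prodBracket (e e' : ProdSec E F A E' F' B) (x : M) (y : N) : ProdFibre A B (x, y) :=
  haveI : FiniteDimensional ℝ (A x) := VectorBundle.finiteDimensional ℝ F A x
  haveI : FiniteDimensional ℝ (B y) := VectorBundle.finiteDimensional ℝ F' B y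
  (dvalue (P.bracket (e.slice₁ y) (e'.slice₁ y)) x
      + vderiv E' (fun z => (e'.val (x, z)).1) y (Q.anchor y (e.val (x, y)).2).1
      - vderiv E' (fun z => (e.val (x, z)).1) y (Q.anchor y (e'.val (x, y)).2).1
      - dsharp (A x) ((dpairing (B y)).flip (e'.val (x, y)).2 ∘ₗ
          vderiv E (fun z => (e.val (z, y)).2) x ∘ₗ LinearMap.fst ℝ _ _ ∘ₗ P.anchor x),
    dvalue (Q.bracket (e.slice₂ x) (e'.slice₂ x)) y
      + vderiv E (fun z => (e'.val (z, y)).2) x (P.anchor x (e.val (x, y)).1).1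
      - vderiv E (fun z => (e.val (z, y)).2) x (P.anchor x (e'.val (x, y)).1).1
      - dsharp (B y) ((dpairing (A x)).flip (e'.val (x, y)).1 ∘ₗ
          vderiv E' (fun z => (e.val (x, z)).1) y ∘ₗ LinearMap.fst ℝ _ _ ∘ₗ Q.anchor y))

/-- The bracket of the double of `A × B`, where `B*` carries minus its bracket and anchor, for the
cocycle `φ_A + φ_B`, the section `W_A - W_B` and the 3-section `X_A + X_B`, carried over to
`E₁ × Ē₂` by `b + b* ↦ b - b*`. It differs from the product bracket by the mixed terms of order
zero that contain `φ` or `W`. -/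
def prodDoubleBracket (e e' : ProdSec E F A E' F' B) (x : M) (y : N) : ProdFibre A B (x, y) :=
  let X := (e.val (x, y)).1.1
  let α := (e.val (x, y)).1.2
  let Y := (e'.val (x, y)).1.1
  let β := (e'.val (x, y)).1.2
  let X' := (e.val (x, y)).2.1
  let α' := (e.val (x, y)).2.2
  let Y' := (e'.val (x, y)).2.1
  let β' := (e'.val (x, y)).2.2
  let φ := dualAt P.str.φ x
  let φ' := dualAt Q.str.φ y
  let W := P.str.W x
  let W' := Q.str.W y
  P.prodBracket Q e e' x y +
    ((α' W' • Y - β' W' • X - β' X' • W, φ' X' • β - φ' Y' • α - α' Y' • φ),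
      (α W • Y' - β W • X' - β X • W', φ X • β' - φ Y • α' - α Y • φ'))

end QuasiJacobiBialgebroid

/-! ### Dirac structures supported on a submanifold -/

/-- The operations of a Courant–Jacobi algebroid with fibres `V q` over the manifold `X`: the smooth
sections `Γ`, the pairing, the anchor to `TX ⊕ ℝ` and the bracket of sections. -/
structure CourantJacobiData {K H : Type*} [NormedAddCommGroup K] [NormedSpace ℝ K]
    [TopologicalSpace H] (I : ModelWithCorners ℝ K H) {X : Type*} [TopologicalSpace X]
    [ChartedSpace H X] (V : X → Type*) [∀ q, AddCommGroup (V q)] [∀ q, Module ℝ (V q)]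
    (Γ : Type*) where
  val : Γ → ∀ q, V q
  pairing : ∀ q, V q →ₗ[ℝ] V q →ₗ[ℝ] ℝ
  anchor : ∀ q, V q →ₗ[ℝ] TangentSpace I q × ℝ
  bracket : Γ → Γ → ∀ q, V q

/-- `G` is a Dirac structure supported on the submanifold that is the image of the embedding
`i : S → X`; `G s` is the fibre over the point `i s`. -/
structure CourantJacobiData.IsDiracOn {K H : Type*} [NormedAddCommGroup K] [NormedSpace ℝ K]
    [TopologicalSpace H] {I : ModelWithCorners ℝ K H} {X : Type*} [TopologicalSpace X]
    [ChartedSpace H X] {V : X → Type*} [∀ q, AddCommGroup (V q)] [∀ q, Module ℝ (V q)]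
    {Γ : Type*} (D : CourantJacobiData I V Γ)
    {K' H' : Type*} [NormedAddCommGroup K'] [NormedSpace ℝ K'] [TopologicalSpace H']
    (J : ModelWithCorners ℝ K' H') {S : Type*} [TopologicalSpace S] [ChartedSpace H' S]
    (i : S → X) (G : ∀ s, Submodule ℝ (V (i s))) : Prop where
  /-- `G` is a smooth vector subbundle: near every point it is framed by smooth sections. -/
  subbundle : ∀ s₀, ∃ (r : ℕ) (e : Fin r → Γ), ∀ᶠ s in nhds s₀,
    LinearIndependent ℝ (fun j => D.val (e j) (i s)) ∧
      Submodule.span ℝ (Set.range fun j => D.val (e j) (i s)) = G s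
  isotropic : ∀ s, ∀ u ∈ G s, ∀ v ∈ G s, D.pairing (i s) u v = 0
  maximal : ∀ s (L : Submodule ℝ (V (i s))),
    (∀ u ∈ L, ∀ v ∈ L, D.pairing (i s) u v = 0) → G s ≤ L → L = G s
  /-- The anchor maps `G` to `TS × ℝ`. -/
  anchor : ∀ s, ∀ u ∈ G s, (D.anchor (i s) u).1 ∈ LinearMap.range (mfderiv J I i s).toLinearMap
  closed : ∀ e e' : Γ, (∀ s, D.val e (i s) ∈ G s) → (∀ s, D.val e' (i s) ∈ G s) →
    ∀ s, D.bracket e e' (i s) ∈ G s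

/-- `E₁ × Ē₂` with the product bracket. -/
def QuasiJacobiBialgebroid.prodBar (P : QuasiJacobiBialgebroid E F A)
    (Q : QuasiJacobiBialgebroid E' F' B) :
    CourantJacobiData (𝓘(ℝ, E).prod 𝓘(ℝ, E')) (ProdFibre A B) (ProdSec E F A E' F' B) where
  val e := e.val
  pairing := prodPairing A B
  anchor := P.prodAnchor Q
  bracket e e' p := P.prodBracket Q e e' p.1 p.2

/-- `E₁ × Ē₂` with the bracket of the double of `A × B`. -/
def QuasiJacobiBialgebroid.prodBarDouble (P : QuasiJacobiBialgebroid E F A)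
    (Q : QuasiJacobiBialgebroid E' F' B) :
    CourantJacobiData (𝓘(ℝ, E).prod 𝓘(ℝ, E')) (ProdFibre A B) (ProdSec E F A E' F' B) where
  val e := e.val
  pairing := prodPairing A B
  anchor := P.prodAnchor Q
  bracket e e' p := P.prodDoubleBracket Q e e' p.1 p.2

/-- The map `(a, b*) ↦ (a + Φ* b*, Φ a + b*)` at the point `x`. -/
def VBMap.graphMap (Φ : VBMap E F A E' F' B) (x : M) :
    A x × Dual ℝ (B (Φ.base x)) →ₗ[ℝ] ProdFibre A B (x, Φ.base x) where
  toFun c := ((c.1, c.2 ∘ₗ Φ.map x), (Φ.map x c.1, c.2))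
  map_add' c c' := by ext <;> simp
  map_smul' r c := by ext <;> simp

/-- The fibre over `(x, φ x)` of `F = {(a + Φ* b*, Φ a + b*)}`. -/
def VBMap.graphDirac (Φ : VBMap E F A E' F' B) (x : M) :
    Submodule ℝ (ProdFibre A B (x, Φ.base x)) :=
  LinearMap.range (Φ.graphMap x)

end Bialgebroids

end JacobiGeometry
end

/-! The fibre `F_x` equals its own orthogonal complement: pairing with `Φ.graphMap x (0, d)` detects
the defect `Φ a - b`, pairing with `Φ.graphMap x (c, 0)` the defect of the two forms. This gives
maximality, and it reduces closedness under the bracket to one scalar identity: `⟨e ∘ e', k⟩ = 0`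
for `k ∈ F_x` and sections `e`, `e'` that lie in `F` along the graph
(`prodPairing_prodBracket_eq_zero`).

To prove the identity, `k` is extended by sections `Z`, `γ` and everything is expanded. The terms of
order zero (those with `φ`, `W` and the 3-sections) agree on both sides, because `Φ` relates these
objects. Brackets on `A*` are compared by the field `bracket`, brackets on `A` by the degree-one
case of `d^φ`, which, once `Φ* φ_B = φ_A` is known, is the untwisted formula for `dη`
(`dForm_form`). What remains are first derivatives.

The difficulty is that `e` lies in `F` only along the graph. The slices `e₁(·, φ x)` and `e₂(x, ·)`
match under `Φ` at the single points `x` and `φ x`, not near them, so each comparison leaves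
derivatives of slices. These cancel against the mixed derivatives in the product bracket:
differentiating the equations of `F` along the graph in a direction `v` relates the derivatives
along `v` in `M` to those along `Tφ v` in `N` (`tderiv_form`, `tderiv_section`, `tderiv_pairing`).
The directions that occur are anchors, and `Φ` intertwines the anchors.

For the second bracket the additional terms of order zero themselves form an element of `F_x`. Since
`ρ_{A*}` is defined by its action on coordinate functions, the argument also needs that a derivation
at a point is a tangent vector, which rests on Hadamard's lemma. -/

noncomputable section
namespace JacobiGeometry

/-! ### Derivations at a point and tangent vectors. -/

section PointDerivations

/-- **Hadamard's lemma**: a smooth function is its value at `a` plus a smooth family of linear forms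
applied to the displacement from `a`. -/
theorem exists_contDiff_eq_add_apply_sub {E : Type*} [NormedAddCommGroup E] [NormedSpace ℝ E]
    {f : E → ℝ} (hf : ContDiff ℝ ∞ f) (a : E) :
    ∃ G : E → E →L[ℝ] ℝ, ContDiff ℝ ∞ G ∧ ∀ y, f y = f a + G y (y - a) := by
  -- The family of forms is `∫₀¹ f'(a + t (y - a)) dt`. Its smoothness in `y` comes from reading it
  -- as the convolution of `c` with `g y` at `0`: the argument of `g y` is then `-t`, hence the sign
  -- in `g`, and `ψ`, equal to `1` on `[-1, 1]`, gives compact support without changing the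
  -- integral.
  let ψ : ContDiffBump (0 : ℝ) := ⟨1, 2, one_pos, one_lt_two⟩
  let g : E → ℝ → E →L[ℝ] ℝ := fun p u => ψ u • fderiv ℝ f (a + (-u) • (p - a))
  let c : ℝ → ℝ := (Set.Icc (0 : ℝ) 1).indicator 1
  have hf' : ContDiff ℝ ∞ (fderiv ℝ f) := hf.fderiv_right (by simp)
  have hg : ContDiff ℝ ∞ (Function.uncurry g) := by
    have h1 : ContDiff ℝ ∞ (fun q : E × ℝ => a + (-q.2) • (q.1 - a)) := by fun_prop
    exact (ψ.contDiff.comp contDiff_snd).smul (hf'.comp h1)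
  have hc : MeasureTheory.LocallyIntegrable c MeasureTheory.volume := by
    apply MeasureTheory.Integrable.locallyIntegrable
    exact (MeasureTheory.integrable_indicator_iff measurableSet_Icc).2
      (continuous_const.integrableOn_Icc)
  have hG := MeasureTheory.contDiffOn_convolution_right_with_param_comp (n := ⊤)
    (ContinuousLinearMap.lsmul ℝ ℝ) (s := (Set.univ : Set E)) (v := fun _ => (0 : ℝ))
    (μ := MeasureTheory.volume) (f := c) (g := g) (k := Metric.closedBall 0 2)
    contDiffOn_const isOpen_univ (isCompact_closedBall _ _)
    (by
      intro p u _ hu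
      have : ψ u = 0 := by
        apply ψ.zero_of_le_dist
        simpa [ψ] using (not_le.1 (by simpa using hu)).le
      simp [g, this]) hc hg.contDiffOn
  refine ⟨_, contDiffOn_univ.1 hG, fun y => ?_⟩
  have hcont : Continuous fun t : ℝ => fderiv ℝ f (a + t • (y - a)) :=
    hf'.continuous.comp (by fun_prop)
  have h1 : MeasureTheory.convolution c (g y) (ContinuousLinearMap.lsmul ℝ ℝ)
      MeasureTheory.volume 0 = ∫ t in (0 : ℝ)..1, fderiv ℝ f (a + t • (y - a)) := by
    rw [MeasureTheory.convolution, intervalIntegral.integral_of_le zero_le_one,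
      ← MeasureTheory.integral_Icc_eq_integral_Ioc, ← MeasureTheory.integral_indicator measurableSet_Icc]
    congr 1
    ext1 t
    by_cases ht : t ∈ Set.Icc (0 : ℝ) 1
    · have : ψ (-t) = 1 := by
        apply ψ.one_of_mem_closedBall
        simpa [ψ, abs_of_nonneg ht.1] using ht.2
      simp [c, g, ht, this]
    · simp [c, ht]
  have hd : ∀ t : ℝ, HasDerivAt (fun t : ℝ => f (a + t • (y - a)))
      (fderiv ℝ f (a + t • (y - a)) (y - a)) t := by
    intro t
    have h2 : HasDerivAt (fun t : ℝ => a + t • (y - a)) (y - a) t := by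
      simpa using ((hasDerivAt_id t).smul_const (y - a)).const_add a
    exact ((hf.differentiable (by simp)) _).hasFDerivAt.comp_hasDerivAt t h2
  have h3 := intervalIntegral.integral_eq_sub_of_hasDerivAt (a := 0) (b := 1) (fun t _ => hd t)
    ((hcont.clm_apply continuous_const).intervalIntegrable _ _)
  rw [h1, ContinuousLinearMap.intervalIntegral_apply (hcont.intervalIntegrable _ _), h3]
  simp

variable {E : Type*} [NormedAddCommGroup E] [NormedSpace ℝ E] [FiniteDimensional ℝ E]
  {M : Type*} [TopologicalSpace M] [ChartedSpace E M] [IsManifold 𝓘(ℝ, E) ∞ M] [T2Space M]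

/-- A linear form on smooth functions satisfying the Leibniz rule at `x` is local. -/
theorem pointDerivation_eq_of_eventuallyEq {x : M} (D : Fn E M →ₗ[ℝ] ℝ)
    (hD : ∀ f h, D (f * h) = f x * D h + h x * D f) {f h : Fn E M}
    (hfh : ∀ᶠ y in nhds x, f y = h y) : D f = D h := by
  obtain ⟨χ, -, hχ⟩ := (SmoothBumpFunction.nhds_basis_tsupport (I := 𝓘(ℝ, E)) x).mem_iff.1 hfh
  let χf : Fn E M := ⟨χ, χ.contMDiff⟩
  -- The factors of this product take the values `1` and `0` at `x`, so the Leibniz rule turns `D 0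
  -- = 0` into `D (f - h) = 0`.
  have h0 : χf * (f - h) = 0 := by
    ext y
    change χ y * (f y - h y) = 0
    by_cases hy : y ∈ tsupport χ
    · have : f y = h y := hχ hy
      rw [this]; simp
    · rw [image_eq_zero_of_notMem_tsupport hy, zero_mul]
  have h1 := hD χf (f - h)
  have h2 : (f - h) x = 0 := by
    change f x - h x = 0
    rw [hfh.self_of_nhds, sub_self]
  have h3 : χf x = 1 := χ.eq_one
  rw [h0, h2, h3, map_zero, map_sub] at h1
  linarith

theorem pointDerivation_algebraMap {x : M} (D : Fn E M →ₗ[ℝ] ℝ)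
    (hD : ∀ f h, D (f * h) = f x * D h + h x * D f) (c : ℝ) : D (algebraMap ℝ _ c) = 0 := by
  have h1 := hD 1 1
  have hx : (1 : Fn E M) x = 1 := rfl
  rw [hx, mul_one] at h1
  rw [Algebra.algebraMap_eq_smul_one, map_smul]
  have : D 1 = 0 := by linarith
  simp [this]

theorem sum_fn_apply {ι : Type*} (s : Finset ι) (f : ι → Fn E M) (x : M) :
    (∑ i ∈ s, f i : Fn E M) x = ∑ i ∈ s, f i x := by
  have := congrFun (map_sum (ContMDiffMap.coeFnRingHom (I := 𝓘(ℝ, E)) (I' := 𝓘(ℝ, ℝ))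
    (N := M) (R := ℝ) (n := ∞)) f s) x
  rw [Finset.sum_apply] at this
  exact this

/-- The derivative of a function at `x` expands every derivation at `x` in terms of its values on
the coordinate functions. -/
theorem exists_pointDerivation_eq_sum (x : M) (f : Fn E M) :
    ∃ c : Fin (finrank ℝ E) → ℝ, ∀ D : Fn E M →ₗ[ℝ] ℝ,
      (∀ f h, D (f * h) = f x * D h + h x * D f) → D f = ∑ i, D (coordFn E x i) * c i := by
  classical
  -- The same choice as in `coordFn`, so that the values of `coordFn` unfold to expressions in this
  -- `χ`.
  let χ : SmoothBumpFunction 𝓘(ℝ, E) x := Classical.choice inferInstance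
  set a : E := extChartAt 𝓘(ℝ, E) x x
  obtain ⟨r, hr, hrs⟩ := Metric.mem_nhds_iff.1 (extChartAt_target_mem_nhds (I := 𝓘(ℝ, E)) x)
  -- The cut-off has support in the closed ball of radius `r / 2`, inside the chart target, so `f`
  -- read in the chart becomes a smooth function on all of `E`.
  let ψ : ContDiffBump a := ⟨r / 4, r / 2, by positivity, by linarith⟩
  let ft : E → ℝ := fun u => ψ u • f ((extChartAt 𝓘(ℝ, E) x).symm u)
  have hft : ContDiff ℝ ∞ ft := by
    rw [← contMDiff_iff_contDiff]
    apply contMDiff_of_tsupport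
    intro u hu
    have hu' : u ∈ tsupport ψ := tsupport_smul_subset_left _ _ hu
    rw [ψ.tsupport_eq] at hu'
    have hu2 : u ∈ (extChartAt 𝓘(ℝ, E) x).target :=
      hrs (Metric.closedBall_subset_ball (by change r / 2 < r; linarith) hu')
    have h1 := (contMDiffOn_extChartAt_symm (I := 𝓘(ℝ, E)) (n := ∞) x).contMDiffAt
      ((isOpen_extChartAt_target (I := 𝓘(ℝ, E)) x).mem_nhds hu2)
    exact ψ.contDiff.contMDiff.contMDiffAt.smul (f.contMDiff.contMDiffAt.comp u h1)
  obtain ⟨G, hG, hGf⟩ := exists_contDiff_eq_add_apply_sub hft a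
  have hgs (i) : ContMDiff 𝓘(ℝ, E) 𝓘(ℝ, ℝ) ∞
      (fun y => χ y • G (extChartAt 𝓘(ℝ, E) x y) (finBasis ℝ E i)) := by
    apply χ.contMDiff_smul
    have h2 : ContMDiff 𝓘(ℝ, E) 𝓘(ℝ, ℝ) ∞ (fun u : E => G u (finBasis ℝ E i)) :=
      (hG.clm_apply contDiff_const).contMDiff
    exact h2.comp_contMDiffOn (contMDiffOn_extChartAt (I := 𝓘(ℝ, E)) (x := x))
  let g (i) : Fn E M := ⟨_, hgs i⟩
  refine ⟨fun i => g i x, fun D hD => ?_⟩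
  -- Hadamard's expansion of `f`, with every ingredient cut off so as to be globally defined. In
  -- each product the first factor vanishes at `x`, so `D` only sees `D (coordFn E x i) * g i x`;
  -- the coefficient `g i x` does not involve `D`.
  let F : Fn E M := algebraMap ℝ _ (ft a) +
    ∑ i, (coordFn E x i - algebraMap ℝ _ ((finBasis ℝ E).coord i a)) * g i
  have hF : ∀ᶠ y in nhds x, f y = F y := by
    have e1 : ∀ᶠ y in nhds x, ψ (extChartAt 𝓘(ℝ, E) x y) = 1 :=
      (continuousAt_extChartAt (I := 𝓘(ℝ, E)) x).eventually ψ.eventuallyEq_one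
    filter_upwards [e1, χ.eventuallyEq_one, extChartAt_source_mem_nhds (I := 𝓘(ℝ, E)) x]
      with y h1 h2 h3
    have h4 : ft (extChartAt 𝓘(ℝ, E) x y) = f y := by
      simp only [ft]
      rw [h1, one_smul, (extChartAt 𝓘(ℝ, E) x).left_inv h3]
    have h5 : F y = ft a + ∑ i, (χ y • (finBasis ℝ E).coord i (extChartAt 𝓘(ℝ, E) x y)
        - (finBasis ℝ E).coord i a) * (χ y • G (extChartAt 𝓘(ℝ, E) x y) (finBasis ℝ E i)) := by
      have := sum_fn_apply Finset.univ (fun i => (coordFn E x i -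
        algebraMap ℝ (Fn E M) ((finBasis ℝ E).coord i a)) * g i) y
      change ft a + _ = _
      rw [this]
      rfl
    rw [h5, ← h4, hGf]
    congr 1
    simp only [h2, Pi.one_apply, one_smul]
    conv_lhs => rw [← (finBasis ℝ E).sum_repr (extChartAt 𝓘(ℝ, E) x y - a)]
    rw [map_sum]
    refine Finset.sum_congr rfl fun i _ => ?_
    simp
  rw [pointDerivation_eq_of_eventuallyEq D hD hF]
  simp only [F, map_add, map_sum, hD, pointDerivation_algebraMap D hD, map_sub, zero_add, sub_zero]
  refine Finset.sum_congr rfl fun i _ => ?_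
  have h0 : (coordFn E x i - algebraMap ℝ (Fn E M) ((finBasis ℝ E).coord i a)) x = 0 := by
    change χ x • (finBasis ℝ E).coord i a - (finBasis ℝ E).coord i a = 0
    rw [χ.eq_one, one_smul, sub_self]
  rw [h0]
  ring

variable (E) in
theorem tderiv_add {f h : M → ℝ} {x : M} (hf : MDifferentiableAt 𝓘(ℝ, E) 𝓘(ℝ, ℝ) f x)
    (hh : MDifferentiableAt 𝓘(ℝ, E) 𝓘(ℝ, ℝ) h x) (v : TangentSpace 𝓘(ℝ, E) x) :
    tderiv E (fun z => f z + h z) x v = tderiv E f x v + tderiv E h x v := by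
  change mfderiv 𝓘(ℝ, E) 𝓘(ℝ, ℝ) (f + h : M → ℝ) x _ = _
  rw [mfderiv_add hf hh]
  rfl

variable (E) in
theorem tderiv_const_mul {f : M → ℝ} {x : M} (hf : MDifferentiableAt 𝓘(ℝ, E) 𝓘(ℝ, ℝ) f x)
    (c : ℝ) (v : TangentSpace 𝓘(ℝ, E) x) :
    tderiv E (fun z => c * f z) x v = c * tderiv E f x v := by
  change mfderiv 𝓘(ℝ, E) 𝓘(ℝ, ℝ) (c • f : M → ℝ) x _ = _
  rw [const_smul_mfderiv hf]
  rfl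

variable (E) in
theorem tderiv_mul {f h : M → ℝ} {x : M} (hf : MDifferentiableAt 𝓘(ℝ, E) 𝓘(ℝ, ℝ) f x)
    (hh : MDifferentiableAt 𝓘(ℝ, E) 𝓘(ℝ, ℝ) h x) (v : TangentSpace 𝓘(ℝ, E) x) :
    tderiv E (fun z => f z * h z) x v = f x * tderiv E h x v + h x * tderiv E f x v := by
  change mfderiv 𝓘(ℝ, E) 𝓘(ℝ, ℝ) (f * h : M → ℝ) x _ = _
  rw [(hf.hasMFDerivAt.mul hh.hasMFDerivAt).mfderiv]
  rfl

theorem Fn.mdifferentiableAt (f : Fn E M) (x : M) : MDifferentiableAt 𝓘(ℝ, E) 𝓘(ℝ, ℝ) f x :=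
  f.contMDiff.mdifferentiable (by simp) x

/-- Near `x` the cut-off is `1`, and the derivative at `x` of the preferred chart at `x` is the
identity of the model space. -/
theorem tderiv_coordFn (x : M) (i : Fin (finrank ℝ E)) (v : TangentSpace 𝓘(ℝ, E) x) :
    tderiv E (coordFn E x i) x v = (finBasis ℝ E).coord i v := by
  let χ : SmoothBumpFunction 𝓘(ℝ, E) x := Classical.choice inferInstance
  let l : E →L[ℝ] ℝ := ((finBasis ℝ E).coord i).toContinuousLinearMap
  have h1 : (coordFn E x i : M → ℝ) =ᶠ[nhds x] l ∘ extChartAt 𝓘(ℝ, E) x := by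
    filter_upwards [χ.eventuallyEq_one] with y hy
    change χ y • (finBasis ℝ E).coord i (extChartAt 𝓘(ℝ, E) x y) = _
    rw [hy]
    simp [l]
  change mfderiv 𝓘(ℝ, E) 𝓘(ℝ, ℝ) (coordFn E x i) x v = _
  rw [h1.mfderiv_eq, mfderiv_comp x l.mdifferentiableAt
    (mdifferentiableAt_extChartAt (by simp)), mfderiv_extChartAt_self,
    ContinuousLinearMap.mfderiv_eq]
  rfl

/-- Every derivation at `x` of the algebra of smooth functions is a tangent vector. -/
theorem pointDerivation_eq_tderiv (x : M) (f : Fn E M) (D : Fn E M →ₗ[ℝ] ℝ)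
    (hD : ∀ f h, D (f * h) = f x * D h + h x * D f) :
    D f = tderiv E f x (∑ i, D (coordFn E x i) •
      (show TangentSpace 𝓘(ℝ, E) x from finBasis ℝ E i)) := by
  obtain ⟨c, hc⟩ := exists_pointDerivation_eq_sum x f
  rw [hc D hD, map_sum]
  refine Finset.sum_congr rfl fun i _ => ?_
  rw [map_smul, smul_eq_mul]
  congr 1
  -- The coefficients `c` serve all derivations at once. Evaluating the expansion on the `i`-th
  -- coordinate derivative, which takes the value `δ_ij` on the `j`-th coordinate function,
  -- identifies `c i`.
  let T : Fn E M →ₗ[ℝ] ℝ :=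
    { toFun h := tderiv E h x (show TangentSpace 𝓘(ℝ, E) x from finBasis ℝ E i)
      map_add' h h' := tderiv_add E (h.mdifferentiableAt x) (h'.mdifferentiableAt x) _
      map_smul' r h := tderiv_const_mul E (h.mdifferentiableAt x) r _ }
  have hT := hc T fun h h' => tderiv_mul E (h.mdifferentiableAt x) (h'.mdifferentiableAt x) _
  change c i = T f
  rw [hT]
  have : ∀ j, T (coordFn E x j) = (finBasis ℝ E).coord j (finBasis ℝ E i) := fun j =>
    tderiv_coordFn x j _
  simp [this, Finsupp.single_apply]

end PointDerivations

/-! ### Contractions of multisections and the bracket of the double in terms of anchors and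
brackets. -/

section Algebra

variable {R L : Type*} [CommRing R] [Algebra ℝ R] [AddCommGroup L] [Module ℝ L] [Module R L]
  [IsScalarTower ℝ R L]

theorem contract_ι (α : Dual R L) (X : L) :
    contract α (ExteriorAlgebra.ι R X) = algebraMap R _ (α X) :=
  CliffordAlgebra.contractLeft_ι (Q := (0 : QuadraticForm R L)) _ _

theorem contract_ι_mul (α : Dual R L) (X : L) (P : ExteriorAlgebra R L) :
    contract α (ExteriorAlgebra.ι R X * P) = α X • P - ExteriorAlgebra.ι R X * contract α P :=
  CliffordAlgebra.contractLeft_ι_mul (Q := (0 : QuadraticForm R L)) _ _ _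

theorem contract_comm (α β : Dual R L) (P : ExteriorAlgebra R L) :
    contract α (contract β P) = -contract β (contract α P) :=
  CliffordAlgebra.contractLeft_comm (Q := (0 : QuadraticForm R L)) _ _ _

theorem contract_add (α : Dual R L) (P Q : ExteriorAlgebra R L) :
    contract α (P + Q) = contract α P + contract α Q := map_add _ _ _

theorem contract_sub (α : Dual R L) (P Q : ExteriorAlgebra R L) :
    contract α (P - Q) = contract α P - contract α Q := map_sub _ _ _

theorem contract_neg (α : Dual R L) (P : ExteriorAlgebra R L) :
    contract α (-P) = -contract α P := map_neg _ _

theorem contract_mem (α : Dual R L) (p : ℕ) {P : ExteriorAlgebra R L} (hP : P ∈ ⋀[R]^(p + 1) L) :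
    contract α P ∈ ⋀[R]^p L := by
  induction p generalizing P with
  | zero =>
    simp only [zero_add, pow_one, LinearMap.mem_range] at hP
    obtain ⟨X, rfl⟩ := hP
    rw [contract_ι]
    simp [Submodule.mem_one]
  | succ p ih =>
    change P ∈ (LinearMap.range (ExteriorAlgebra.ι R : L →ₗ[R] _)) ^ (p + 1 + 1) at hP
    rw [pow_succ'] at hP
    induction hP using Submodule.mul_induction_on' with
    | mem_mul_mem m hm n hn =>
      obtain ⟨X, rfl⟩ := hm
      rw [contract_ι_mul]
      refine sub_mem (Submodule.smul_mem _ _ hn) ?_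
      change _ ∈ (LinearMap.range (ExteriorAlgebra.ι R : L →ₗ[R] _)) ^ (p + 1)
      rw [pow_succ']
      exact Submodule.mul_mem_mul ⟨X, rfl⟩ (ih hn)
    | add x hx y hy h1 h2 => rw [contract_add]; exact add_mem h1 h2

theorem exists_eq_ι {P : ExteriorAlgebra R L} (hP : P ∈ ⋀[R]^1 L) :
    ∃ X, P = ExteriorAlgebra.ι R X := by
  simp only [pow_one, LinearMap.mem_range] at hP
  obtain ⟨X, hX⟩ := hP
  exact ⟨X, hX.symm⟩

/-- The degree matters: `ιInv` is only a left inverse of `ι`, so it can be read off by testing with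
forms on elements `ι X`. -/
theorem apply_ιInv (α : Dual R L) {P : ExteriorAlgebra R L} (hP : P ∈ ⋀[R]^1 L) :
    α (ExteriorAlgebra.ιInv P) = ExteriorAlgebra.algebraMapInv (contract α P) := by
  obtain ⟨X, rfl⟩ := exists_eq_ι hP
  rw [ExteriorAlgebra.ι_leftInverse, contract_ι]
  exact (ExteriorAlgebra.algebraMap_leftInverse L _).symm

namespace QuasiJacobiStructure

/-- With the last slot written as a form applied to a section, the dependence on that slot at a
point is through its value there only. -/
theorem eval₂_eq_apply {P : ExteriorAlgebra R L} (hP : P ∈ ⋀[R]^2 L) (α β : Dual R L) :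
    eval₂ P α β = β (ExteriorAlgebra.ιInv (contract α P)) :=
  (apply_ιInv β (contract_mem α 1 hP)).symm

theorem eval₂_swap (P : ExteriorAlgebra R L) (α β : Dual R L) : eval₂ P α β = -eval₂ P β α := by
  rw [eval₂, contract_comm, map_neg, eval₂]

theorem eval₃_eq_apply {P : ExteriorAlgebra R L} (hP : P ∈ ⋀[R]^3 L) (α β γ : Dual R L) :
    eval₃ P α β γ = γ (ExteriorAlgebra.ιInv (contract β (contract α P))) :=
  (apply_ιInv γ (contract_mem β 1 (contract_mem α 2 hP))).symm

/-- Contractions anticommute and a cyclic permutation of three slots is even. It brings any slot to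
the last position, where `eval₃_eq_apply` applies. -/
theorem eval₃_rotate (P : ExteriorAlgebra R L) (α β γ : Dual R L) :
    eval₃ P α β γ = eval₃ P β γ α := by
  rw [eval₃, eval₃, contract_comm β α P, contract_neg, contract_comm γ α, neg_neg]

variable {g : LieRinehart R L} (S : QuasiJacobiStructure g)

theorem ι_mem (X : L) : ExteriorAlgebra.ι R X ∈ ⋀[R]^1 L := by simp

theorem dStar_ι_mem (X : L) : S.dStar (ExteriorAlgebra.ι R X) ∈ ⋀[R]^2 L := by
  refine sub_mem (S.d_mem 1 _ (ι_mem X)) ?_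
  change _ ∈ (LinearMap.range (ExteriorAlgebra.ι R : L →ₗ[R] _)) ^ 2
  rw [pow_two]
  exact Submodule.mul_mem_mul ⟨_, rfl⟩ ⟨_, rfl⟩

theorem d_algebraMap (f : R) :
    S.d (algebraMap R _ f) = ExteriorAlgebra.ι R (S.dStarFun f + f • S.W) := by
  rw [map_add, ← dStar_algebraMap, dStar, map_smul, Algebra.smul_def, Algebra.commutes,
    sub_add_cancel]

theorem d_ι (X : L) : S.d (ExteriorAlgebra.ι R X) =
    S.dStar (ExteriorAlgebra.ι R X) + ExteriorAlgebra.ι R S.W * ExteriorAlgebra.ι R X := by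
  rw [dStar, sub_add_cancel]

/-- Solving the definition of `bracketStar` for `d_* X` eliminates the operator in favour of the
anchor and the bracket of the dual, the objects that a morphism is assumed to respect. -/
theorem eval₂_dStar (X : L) (α β : Dual R L) : eval₂ (S.dStar (ExteriorAlgebra.ι R X)) α β =
    S.anchorStar α (β X) - S.anchorStar β (α X) - S.bracketStar α β X := by
  change _ = _ - (S.anchorStar α (β X) - S.anchorStar β (α X) - _)
  ring

theorem eval₂_add (P P' : ExteriorAlgebra R L) (α β : Dual R L) :
    eval₂ (P + P') α β = eval₂ P α β + eval₂ P' α β := by simp [eval₂, contract]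

theorem eval₂_ι_mul_ι (X Y : L) (α β : Dual R L) :
    eval₂ (ExteriorAlgebra.ι R X * ExteriorAlgebra.ι R Y) α β = α X * β Y - α Y * β X := by
  have h : contract β (contract α (ExteriorAlgebra.ι R X * ExteriorAlgebra.ι R Y)) =
      algebraMap R _ (α X * β Y - α Y * β X) := by
    rw [contract_ι_mul, contract_ι, ← Algebra.commutes, ← Algebra.smul_def, contract_sub]
    have h1 (c : R) (P : ExteriorAlgebra R L) : contract β (c • P) = c • contract β P :=
      map_smul _ _ _
    rw [h1, h1, contract_ι, contract_ι]
    simp [Algebra.smul_def]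
  rw [eval₂, h]
  exact ExteriorAlgebra.algebraMap_leftInverse L _

/-- The first component of the bracket of the double, paired with a 1-form. -/
theorem apply_doubleBracket_fst (X Y : L) (α β γ : Dual R L) :
    γ (S.doubleBracket (X, α) (Y, β)).1 =
      γ (g.bracket X Y) + S.anchorStar α (γ Y) - S.bracketStar α γ Y + α S.W * γ Y
        - S.anchorStar β (γ X) + S.anchorStar γ (β X) + S.bracketStar β γ X
        - β S.W * γ X + β X * γ S.W + eval₃ S.χ α β γ := by
  have hd (X : L) : S.d (ExteriorAlgebra.ι R X) ∈ ⋀[R]^2 L := S.d_mem 1 _ (ι_mem X)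
  have h1 (X : L) (α : Dual R L) :
      γ (ExteriorAlgebra.ιInv (contract α (S.d (ExteriorAlgebra.ι R X)))) =
        S.anchorStar α (γ X) - S.anchorStar γ (α X) - S.bracketStar α γ X
          + (α S.W * γ X - α X * γ S.W) := by
    rw [← eval₂_eq_apply (hd X), d_ι, eval₂_add, eval₂_dStar, eval₂_ι_mul_ι]
  -- Both terms cancel against the terms of `h1 Y α` that contain `α Y`; their counterparts with `β
  -- X` survive.
  have h2 : γ (ExteriorAlgebra.ιInv (S.d (algebraMap R _ (α Y)))) =
      S.anchorStar γ (α Y) + α Y * γ S.W := by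
    rw [d_algebraMap, ExteriorAlgebra.ι_leftInverse]
    simp [anchorStar]
  simp only [doubleBracket, map_add, map_sub]
  rw [h1, h1, h2, ← eval₃_eq_apply S.χ_mem]
  ring

/-- The second component of the bracket of the double, paired with a section. -/
theorem doubleBracket_snd_apply (X Y Z : L) (α β : Dual R L) :
    (S.doubleBracket (X, α) (Y, β)).2 Z =
      S.bracketStar α β Z + (g.anchor X (β Z) - β (g.bracket X Z) + S.φ X * β Z)
        - (g.anchor Y (α Z) - g.anchor Z (α Y) - α (g.bracket Y Z)
          + S.φ Y * α Z - S.φ Z * α Y) := by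
  -- In `L^φ_X β` the terms `ρ(Z)(β X)` and `φ(Z) β(X)` occur with both signs and drop out; in `i_Y
  -- d^φ α` the analogous terms remain.
  have : (S.doubleBracket (X, α) (Y, β)).2 Z = S.bracketStar α β Z
      + ((g.anchor X (β Z) - g.anchor Z (β X) - β (g.bracket X Z) + S.φ X * β Z - S.φ Z * β X)
        + (g.anchor Z (β X) + β X * S.φ Z))
      - (g.anchor Y (α Z) - g.anchor Z (α Y) - α (g.bracket Y Z)
          + S.φ Y * α Z - S.φ Z * α Y) := rfl
  rw [this]
  ring

end QuasiJacobiStructure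
end Algebra

/-! ### Pointwise dependence of the operations on sections and forms. -/

section Pointwise

variable {E : Type*} [NormedAddCommGroup E] [NormedSpace ℝ E] [FiniteDimensional ℝ E]
  {M : Type*} [TopologicalSpace M] [ChartedSpace E M] [IsManifold 𝓘(ℝ, E) ∞ M] [T2Space M]
  {F : Type*} [NormedAddCommGroup F] [NormedSpace ℝ F] [FiniteDimensional ℝ F]
  {A : M → Type*} [TopologicalSpace (TotalSpace F A)] [∀ x, TopologicalSpace (A x)]
  [∀ x, AddCommGroup (A x)] [∀ x, Module ℝ (A x)] [FiberBundle F A] [VectorBundle ℝ F A]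
  [ContMDiffVectorBundle ∞ F A 𝓘(ℝ, E)]

/-! ### Sections through given vectors and covectors -/

theorem sum_sec_apply {ι : Type*} (s : Finset ι) (X : ι → Sec E F A) (x : M) :
    (∑ i ∈ s, X i : Sec E F A) x = ∑ i ∈ s, X i x := by
  have := congrFun (map_sum (ContMDiffSection.coeAddHom 𝓘(ℝ, E) F ∞ A) X s) x
  rw [Finset.sum_apply] at this
  exact this

theorem frameSec_apply (x y : M) (i : Fin (finrank ℝ F)) : frameSec E F A x i y =
    (bump F A x : SmoothBumpFunction 𝓘(ℝ, E) x) y •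
      (trivializationAt F A x).localFrame (finBasis ℝ F) i y := rfl

theorem exists_sec_apply_eq (x : M) (v : A x) : ∃ X : Sec E F A, X x = v := by
  refine ⟨∑ i, frameCoord F x x i v • frameSec E F A x i, ?_⟩
  rw [sum_sec_apply]
  conv_rhs => rw [← sum_frameCoord x x (FiberBundle.mem_baseSet_trivializationAt F A x) v]
  refine Finset.sum_congr rfl fun i _ => ?_
  change frameCoord F x x i v • frameSec E F A x i x = _
  rw [frameSec_apply, SmoothBumpFunction.eq_one, one_smul]

/-- Every vector of the fibre is the value of a global section; this frees `dualAt` from the frame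
used to define it. -/
theorem dualAt_ext {α : DualSec E F A} {x : M} {ξ : Dual ℝ (A x)}
    (h : ∀ X : Sec E F A, α X x = ξ (X x)) : dualAt α x = ξ := by
  ext v
  obtain ⟨X, rfl⟩ := exists_sec_apply_eq (E := E) (F := F) x v
  rw [dualAt_apply, h]

variable (E F A) in
/-- Global sections of `A*` that form the frame dual to `frameSec` near `x`. -/
def coframeSec (x : M) (i : Fin (finrank ℝ F)) : DualSec E F A where
  toFun X := ⟨fun y => (bump F A x : SmoothBumpFunction 𝓘(ℝ, E) x) y • frameCoord F x y i (X y), by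
    apply contMDiff_of_tsupport
    intro y hy
    have hy' : y ∈ (trivializationAt F A x).baseSet :=
      (exists_bump F A x).choose_spec (tsupport_smul_subset_left _ _ hy)
    have h1 := (contMDiffOn_frameCoord (E := E) (A := A) x i).contMDiffAt
      (x := (⟨y, X y⟩ : TotalSpace F A))
      ((trivializationAt F A x).open_source.mem_nhds (by simpa [Trivialization.mem_source] using hy'))
    exact (bump F A x).contMDiff.contMDiffAt.smul (h1.comp y X.contMDiff.contMDiffAt)⟩
  map_add' X Y := by
    ext y
    change (bump F A x : SmoothBumpFunction 𝓘(ℝ, E) x) y • frameCoord F x y i (X y + Y y) = _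
    rw [map_add, smul_add]; rfl
  map_smul' f X := by
    ext y
    change (bump F A x : SmoothBumpFunction 𝓘(ℝ, E) x) y • frameCoord F x y i (f y • X y) = _
    rw [map_smul, smul_comm]; rfl

theorem dualAt_coframeSec (x y : M) (i : Fin (finrank ℝ F)) :
    dualAt (coframeSec E F A x i) y =
      (bump F A x : SmoothBumpFunction 𝓘(ℝ, E) x) y • frameCoord F x y i :=
  dualAt_ext fun _ => rfl

theorem exists_dualAt_eq (x : M) (ξ : Dual ℝ (A x)) : ∃ α : DualSec E F A, dualAt α x = ξ := by
  refine ⟨∑ i, algebraMap ℝ (Fn E M) (ξ ((trivializationAt F A x).localFrame (finBasis ℝ F) i x)) •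
    coframeSec E F A x i, dualAt_ext fun X => ?_⟩
  rw [LinearMap.sum_apply, sum_fn_apply]
  conv_rhs => rw [← sum_frameCoord x x (FiberBundle.mem_baseSet_trivializationAt F A x) (X x)]
  rw [map_sum]
  refine Finset.sum_congr rfl fun i _ => ?_
  change _ * ((bump F A x : SmoothBumpFunction 𝓘(ℝ, E) x) x • frameCoord F x x i (X x)) = _
  rw [SmoothBumpFunction.eq_one, one_smul, map_smul, smul_eq_mul, mul_comm]
  rfl

theorem DualSec.apply_congr {α β : DualSec E F A} {x : M} (h : dualAt α x = dualAt β x)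
    (X : Sec E F A) : α X x = β X x := by
  rw [← dualAt_apply, h, dualAt_apply]

/-! ### Values at a point -/

open QuasiJacobiStructure

/-- Multisections live in the exterior algebra of the module of sections and have no fibre values by
definition. The last slot is pointwise by `eval₂_eq_apply`, the first by antisymmetry. -/
theorem eval₂_congr {P : ExteriorAlgebra (Fn E M) (Sec E F A)} (hP : P ∈ ⋀[Fn E M]^2 (Sec E F A))
    {α α₀ β β₀ : DualSec E F A} {x : M} (hα : dualAt α x = dualAt α₀ x)
    (hβ : dualAt β x = dualAt β₀ x) : eval₂ P α β x = eval₂ P α₀ β₀ x := by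
  have h1 : eval₂ P α β x = eval₂ P α β₀ x := by
    rw [eval₂_eq_apply hP, eval₂_eq_apply hP]
    exact DualSec.apply_congr hβ _
  have h2 : eval₂ P β₀ α x = eval₂ P β₀ α₀ x := by
    rw [eval₂_eq_apply hP, eval₂_eq_apply hP]
    exact DualSec.apply_congr hα _
  rw [h1, eval₂_swap P α, eval₂_swap P α₀]
  exact congrArg Neg.neg h2

theorem eval₃_congr {P : ExteriorAlgebra (Fn E M) (Sec E F A)} (hP : P ∈ ⋀[Fn E M]^3 (Sec E F A))
    {α α₀ β β₀ : DualSec E F A} {x : M} (hα : dualAt α x = dualAt α₀ x)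
    (hβ : dualAt β x = dualAt β₀ x) (γ : DualSec E F A) :
    eval₃ P α β γ x = eval₃ P α₀ β₀ γ x := by
  have h1 : eval₃ P α β γ x = eval₃ P α₀ β γ x := by
    rw [eval₃_rotate P α, eval₃_rotate P α₀, eval₃_eq_apply hP, eval₃_eq_apply hP]
    exact DualSec.apply_congr hα _
  have h2 : eval₃ P α₀ β γ x = eval₃ P α₀ β₀ γ x := by
    rw [eval₃_rotate P α₀, eval₃_rotate P α₀, eval₃_rotate P β, eval₃_rotate P β₀,
      eval₃_eq_apply hP, eval₃_eq_apply hP]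
    exact DualSec.apply_congr hβ _
  rw [h1, h2]

theorem QuasiJacobiStructure.dStarFun_smul {R L : Type*} [CommRing R] [Algebra ℝ R]
    [AddCommGroup L] [Module ℝ L] [Module R L] [IsScalarTower ℝ R L] {g : LieRinehart R L}
    (S : QuasiJacobiStructure g) (c : ℝ) (f : R) : S.dStarFun (c • f) = c • S.dStarFun f := by
  have h : algebraMap R (ExteriorAlgebra R L) (c • f) = c • algebraMap R _ f := by
    rw [Algebra.algebraMap_eq_smul_one, smul_assoc, ← Algebra.algebraMap_eq_smul_one]
  rw [dStarFun, h, dStar, map_smul, mul_smul_comm, ← smul_sub, ← algebraMap_smul R c, map_smul,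
    algebraMap_smul]
  rfl

namespace QuasiJacobiBialgebroid

variable (P : QuasiJacobiBialgebroid E F A)

/-- The tangent vector `ρ_{A*}(α)` at `x` differentiates functions by `f ↦ α (d_* f)`. -/
theorem anchorStar_apply (α : DualSec E F A) (f : Fn E M) (x : M) :
    P.str.anchorStar α f x = tderiv E f x (P.anchorStar x (dualAt α x)) := by
  -- This is a derivation at `x` by the Leibniz rule for `d_*`. The tangent vector that
  -- `pointDerivation_eq_tderiv` assigns to it has components `D (coordFn E x i)`, as in the
  -- definition of `anchorStar`.
  let D : Fn E M →ₗ[ℝ] ℝ :=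
    { toFun f := dualAt α x (P.str.dStarFun f x)
      map_add' f h := by
        rw [dStarFun_add]
        exact map_add (dualAt α x) _ _
      map_smul' c f := by
        rw [dStarFun_smul]
        exact map_smul (dualAt α x) _ _ }
  have hD : ∀ f h, D (f * h) = f x * D h + h x * D f := by
    intro f h
    change dualAt α x (P.str.dStarFun (f * h) x) = _
    rw [dStarFun_mul]
    change dualAt α x (h x • P.str.dStarFun f x + f x • P.str.dStarFun h x) = _
    rw [map_add, map_smul, map_smul, add_comm]
    rfl
  have h1 : P.str.anchorStar α f x = D f := (dualAt_apply α x _).symm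
  rw [h1, pointDerivation_eq_tderiv x f D hD]
  congr 1
  simp only [anchorStar, LinearMap.sum_apply]
  rfl

theorem anchor_apply (X : Sec E F A) (f : Fn E M) (x : M) :
    P.alg.toLieRinehart.anchor X f x = tderiv E f x (P.alg.anchor x (X x)) := rfl

/-- The bracket of 1-forms at `x` depends on their values and on their first derivatives along
`ρ_{A*}`. -/
theorem bracketStar_congr {α α₀ β β₀ : DualSec E F A} {x : M} (hα : dualAt α x = dualAt α₀ x)
    (hβ : dualAt β x = dualAt β₀ x) (Z : Sec E F A) :
    P.str.bracketStar α β Z x = P.str.bracketStar α₀ β₀ Z x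
      + (tderiv E (β Z) x (P.anchorStar x (dualAt α x))
        - tderiv E (β₀ Z) x (P.anchorStar x (dualAt α x)))
      - (tderiv E (α Z) x (P.anchorStar x (dualAt β x))
        - tderiv E (α₀ Z) x (P.anchorStar x (dualAt β x))) := by
  have h1 (α β : DualSec E F A) : P.str.bracketStar α β Z x =
      P.str.anchorStar α (β Z) x - P.str.anchorStar β (α Z) x
        - eval₂ (P.str.dStar (ExteriorAlgebra.ι (Fn E M) Z)) α β x := rfl
  -- The term `(d_* Z)(α, β)` is tensorial and agrees on both sides; only the two derivative terms
  -- can differ.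
  rw [h1, h1, eval₂_congr (P.str.dStar_ι_mem Z) hα hβ]
  simp only [anchorStar_apply, hα, hβ]
  ring

end QuasiJacobiBialgebroid

/-! ### Derivatives of vector-valued functions -/

theorem mdifferentiableAt_finsetSum {ι : Type*} (s : Finset ι) {f : ι → M → ℝ} {x : M}
    (hf : ∀ i ∈ s, MDifferentiableAt 𝓘(ℝ, E) 𝓘(ℝ, ℝ) (f i) x) :
    MDifferentiableAt 𝓘(ℝ, E) 𝓘(ℝ, ℝ) (fun z => ∑ i ∈ s, f i z) x := by
  classical
  induction s using Finset.induction_on with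
  | empty => simpa using mdifferentiableAt_const
  | insert i s hi ih =>
    simp only [Finset.sum_insert hi]
    exact (hf i (by simp)).add (ih fun j hj => hf j (by simp [hj]))

theorem tderiv_sum {ι : Type*} (s : Finset ι) {f : ι → M → ℝ} {x : M}
    (hf : ∀ i ∈ s, MDifferentiableAt 𝓘(ℝ, E) 𝓘(ℝ, ℝ) (f i) x) (v : TangentSpace 𝓘(ℝ, E) x) :
    tderiv E (fun z => ∑ i ∈ s, f i z) x v = ∑ i ∈ s, tderiv E (f i) x v := by
  classical
  induction s using Finset.induction_on with
  | empty =>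
    simp only [Finset.sum_empty]
    change mfderiv 𝓘(ℝ, E) 𝓘(ℝ, ℝ) (fun _ => (0 : ℝ)) x v = 0
    rw [mfderiv_const]
    rfl
  | insert i s hi ih =>
    simp only [Finset.sum_insert hi]
    rw [tderiv_add E (hf i (by simp))
      (mdifferentiableAt_finsetSum s fun j hj => hf j (by simp [hj])),
      ih fun j hj => hf j (by simp [hj])]

variable (E) in
/-- `u` is differentiable at `x` after composition with every linear form. -/
def WeakDiffAt {V : Type*} [AddCommGroup V] [Module ℝ V] (u : M → V) (x : M) : Prop :=
  ∀ l : Dual ℝ V, MDifferentiableAt 𝓘(ℝ, E) 𝓘(ℝ, ℝ) (fun z => l (u z)) x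

variable {V : Type*} [AddCommGroup V] [Module ℝ V] [FiniteDimensional ℝ V]

/-- Product rule for a bilinear form. -/
theorem tderiv_bilin {W : Type*} [AddCommGroup W] [Module ℝ W] [FiniteDimensional ℝ W]
    (b : V →ₗ[ℝ] W →ₗ[ℝ] ℝ) {u : M → V} {w : M → W} {x : M} (hu : WeakDiffAt E u x)
    (hw : WeakDiffAt E w x) (v : TangentSpace 𝓘(ℝ, E) x) :
    tderiv E (fun z => b (u z) (w z)) x v =
      b (vderiv E u x v) (w x) + b (u x) (vderiv E w x v) := by
  let bV := finBasis ℝ V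
  let bW := finBasis ℝ W
  have h1 : ∀ p q, b p q = ∑ i, ∑ j, b (bV i) (bW j) * (bV.coord i p * bW.coord j q) := by
    intro p q
    conv_lhs => rw [← bV.sum_repr p, ← bW.sum_repr q]
    simp only [map_sum, map_smul, LinearMap.sum_apply, LinearMap.smul_apply, smul_eq_mul,
      Basis.coord_apply, Finset.mul_sum]
    rw [Finset.sum_comm]
    exact Finset.sum_congr rfl fun i _ => Finset.sum_congr rfl fun j _ => by ring
  have hu' i := hu (bV.coord i)
  have hw' j := hw (bW.coord j)
  have hm i j : MDifferentiableAt 𝓘(ℝ, E) 𝓘(ℝ, ℝ)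
      (fun z => bV.coord i (u z) * bW.coord j (w z)) x := (hu' i).mul (hw' j)
  have hc i j : MDifferentiableAt 𝓘(ℝ, E) 𝓘(ℝ, ℝ)
      (fun z => b (bV i) (bW j) * (bV.coord i (u z) * bW.coord j (w z))) x :=
    mdifferentiableAt_const.mul (hm i j)
  have h2 : (fun z => b (u z) (w z)) =
      fun z => ∑ i, ∑ j, b (bV i) (bW j) * (bV.coord i (u z) * bW.coord j (w z)) :=
    funext fun z => h1 _ _
  have h3 i : bV.coord i (vderiv E u x v) = tderiv E (fun z => bV.coord i (u z)) x v := by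
    simp [vderiv, bV, Finsupp.single_apply]
  have h4 j : bW.coord j (vderiv E w x v) = tderiv E (fun z => bW.coord j (w z)) x v := by
    simp [vderiv, bW, Finsupp.single_apply]
  rw [h2, tderiv_sum _ fun i _ => mdifferentiableAt_finsetSum _ fun j _ => hc i j,
    h1 (vderiv E u x v), h1 (u x), ← Finset.sum_add_distrib]
  refine Finset.sum_congr rfl fun i _ => ?_
  rw [tderiv_sum _ fun j _ => hc i j, ← Finset.sum_add_distrib]
  refine Finset.sum_congr rfl fun j _ => ?_
  rw [tderiv_const_mul E (hm i j), tderiv_mul E (hu' i) (hw' j), h3, h4]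
  ring

/-- Makes `vderiv` independent of the basis in its definition and replaces it by derivatives of
scalar functions. -/
theorem apply_vderiv (l : Dual ℝ V) {u : M → V} {x : M} (hu : WeakDiffAt E u x)
    (v : TangentSpace 𝓘(ℝ, E) x) :
    l (vderiv E u x v) = tderiv E (fun z => l (u z)) x v := by
  have h0 (p : V) : l p = ∑ i, l (finBasis ℝ V i) * (finBasis ℝ V).coord i p := by
    conv_lhs => rw [← (finBasis ℝ V).sum_repr p]
    rw [map_sum]
    exact Finset.sum_congr rfl fun i _ => by rw [map_smul, smul_eq_mul, mul_comm]; rfl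
  have hc i : MDifferentiableAt 𝓘(ℝ, E) 𝓘(ℝ, ℝ)
      (fun z => l (finBasis ℝ V i) * (finBasis ℝ V).coord i (u z)) x :=
    mdifferentiableAt_const.mul (hu _)
  have h1 : (fun z => l (u z)) = fun z => ∑ i, l (finBasis ℝ V i) * (finBasis ℝ V).coord i (u z) :=
    funext fun z => h0 _
  rw [h1, tderiv_sum _ fun i _ => hc i]
  simp only [vderiv, LinearMap.sum_apply, map_sum]
  refine Finset.sum_congr rfl fun i _ => ?_
  rw [tderiv_const_mul E (hu _)]
  simp only [LinearMap.smulRight_apply, map_smul, smul_eq_mul]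
  ring

end Pointwise

/-! ### The graph of `Φ`, derivatives along it, and the morphism conditions at a point. -/

section Graph

variable {E : Type*} [NormedAddCommGroup E] [NormedSpace ℝ E] [FiniteDimensional ℝ E]
  {M : Type*} [TopologicalSpace M] [ChartedSpace E M] [IsManifold 𝓘(ℝ, E) ∞ M] [T2Space M]
  {F : Type*} [NormedAddCommGroup F] [NormedSpace ℝ F] [FiniteDimensional ℝ F]
  {A : M → Type*} [TopologicalSpace (TotalSpace F A)] [∀ x, TopologicalSpace (A x)]
  [∀ x, AddCommGroup (A x)] [∀ x, Module ℝ (A x)] [FiberBundle F A] [VectorBundle ℝ F A]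
  [ContMDiffVectorBundle ∞ F A 𝓘(ℝ, E)]
  {E' : Type*} [NormedAddCommGroup E'] [NormedSpace ℝ E'] [FiniteDimensional ℝ E']
  {N : Type*} [TopologicalSpace N] [ChartedSpace E' N] [IsManifold 𝓘(ℝ, E') ∞ N] [T2Space N]
  {F' : Type*} [NormedAddCommGroup F'] [NormedSpace ℝ F'] [FiniteDimensional ℝ F']
  {B : N → Type*} [TopologicalSpace (TotalSpace F' B)] [∀ x, TopologicalSpace (B x)]
  [∀ x, AddCommGroup (B x)] [∀ x, Module ℝ (B x)] [FiberBundle F' B] [VectorBundle ℝ F' B]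
  [ContMDiffVectorBundle ∞ F' B 𝓘(ℝ, E')]

theorem VBMap.mem_graphDirac (Φ : VBMap E F A E' F' B) {x : M}
    {e : ProdFibre A B (x, Φ.base x)} :
    e ∈ Φ.graphDirac x ↔ e.2.1 = Φ.map x e.1.1 ∧ e.1.2 = e.2.2 ∘ₗ Φ.map x := by
  constructor
  · rintro ⟨c, rfl⟩
    exact ⟨rfl, rfl⟩
  · rintro ⟨h1, h2⟩
    exact ⟨(e.1.1, e.2.2), Prod.ext (Prod.ext rfl h2.symm) (Prod.ext h1.symm rfl)⟩

theorem VBMap.dualAt_pullback (Φ : VBMap E F A E' F' B) (α : DualSec E' F' B) (x : M) :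
    dualAt (Φ.pullback α) x = dualAt α (Φ.base x) ∘ₗ Φ.map x :=
  dualAt_ext fun _ => rfl

theorem dualAt_slice₁ (e : ProdSec E F A E' F' B) (x : M) (y : N) :
    dualAt (e.slice₁ y).2 x = (e.val (x, y)).1.2 :=
  dualAt_ext fun _ => rfl

theorem dualAt_slice₂ (e : ProdSec E F A E' F' B) (x : M) (y : N) :
    dualAt (e.slice₂ x).2 y = (e.val (x, y)).2.2 :=
  dualAt_ext fun _ => rfl

/-- In finite dimension every linear form on `V*` is the evaluation at a vector. Hence smoothness of
a family of forms as a function of base point and vector, which is how `ProdSec` states it, is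
enough. -/
theorem weakDiffAt_prod_dual {V : Type*} [AddCommGroup V] [Module ℝ V] [FiniteDimensional ℝ V]
    {u : M → V × Dual ℝ V} {x : M} (h1 : WeakDiffAt E (fun z => (u z).1) x)
    (h2 : ∀ a, MDifferentiableAt 𝓘(ℝ, E) 𝓘(ℝ, ℝ) (fun z => (u z).2 a) x) :
    WeakDiffAt E u x := by
  intro l
  have h : (fun z => l (u z)) = fun z => (l ∘ₗ LinearMap.inl ℝ V (Dual ℝ V)) (u z).1 +
      (u z).2 ((evalEquiv ℝ V).symm (l ∘ₗ LinearMap.inr ℝ V (Dual ℝ V))) := by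
    funext z
    rw [apply_evalEquiv_symm_apply]
    simp [← map_add]
  rw [h]
  exact (h1 _).add (h2 _)

theorem contMDiff_dualAt_comp (α : DualSec E F A) {K H X : Type*} [NormedAddCommGroup K]
    [NormedSpace ℝ K] [TopologicalSpace H] {I : ModelWithCorners ℝ K H} [TopologicalSpace X]
    [ChartedSpace H X] {f : X → TotalSpace F A} (hf : ContMDiff I (𝓘(ℝ, E).prod 𝓘(ℝ, F)) ∞ f) :
    ContMDiff I 𝓘(ℝ, ℝ) ∞ (fun p => dualAt α (f p).1 (f p).2) := by
  have h1 := contMDiff_dualAt α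
  generalize hG : (fun v : TotalSpace F A => dualAt α v.1 v.2) = G at h1
  have h3 : (fun p => dualAt α (f p).1 (f p).2) = G ∘ f := by
    rw [← hG]; rfl
  rw [h3]
  exact h1.comp hf

theorem ProdSec.weakDiffAt₁ (e : ProdSec E F A E' F' B) (x : M) (y : N) :
    WeakDiffAt E' (V := A x × Dual ℝ (A x)) (fun z => (e.val (x, z)).1) y := by
  haveI : FiniteDimensional ℝ (A x) := VectorBundle.finiteDimensional ℝ F A x
  apply weakDiffAt_prod_dual
  · intro l
    -- The component in `A` is smooth as a map into the total space, so `l` is extended to a section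
    -- of `A*`, which is a smooth function there.
    obtain ⟨α, rfl⟩ := exists_dualAt_eq (E := E) (F := F) x l
    have h : ContMDiff 𝓘(ℝ, E') 𝓘(ℝ, ℝ) ∞ (fun z : N => dualAt α x (e.val (x, z)).1.1) :=
      contMDiff_dualAt_comp α (f := fun z : N => ⟨x, (e.val (x, z)).1.1⟩)
        (e.contMDiff_a.comp (contMDiff_const.prodMk contMDiff_id))
    exact h.mdifferentiable (by simp) y
  · intro a
    have h : ContMDiff 𝓘(ℝ, E') 𝓘(ℝ, ℝ) ∞ (fun z : N => (e.val (x, z)).1.2 a) :=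
      e.contMDiff_α.comp
        ((contMDiff_const (c := (⟨x, a⟩ : TotalSpace F A))).prodMk contMDiff_id)
    exact h.mdifferentiable (by simp) y

theorem ProdSec.weakDiffAt₂ (e : ProdSec E F A E' F' B) (x : M) (y : N) :
    WeakDiffAt E (V := B y × Dual ℝ (B y)) (fun z => (e.val (z, y)).2) x := by
  haveI : FiniteDimensional ℝ (B y) := VectorBundle.finiteDimensional ℝ F' B y
  apply weakDiffAt_prod_dual
  · intro l
    obtain ⟨α, rfl⟩ := exists_dualAt_eq (E := E') (F := F') y l
    have h : ContMDiff 𝓘(ℝ, E) 𝓘(ℝ, ℝ) ∞ (fun z : M => dualAt α y (e.val (z, y)).2.1) :=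
      contMDiff_dualAt_comp α (f := fun z : M => ⟨y, (e.val (z, y)).2.1⟩)
        (e.contMDiff_b.comp (contMDiff_id.prodMk contMDiff_const))
    exact h.mdifferentiable (by simp) x
  · intro a
    have h : ContMDiff 𝓘(ℝ, E) 𝓘(ℝ, ℝ) ∞ (fun z : M => (e.val (z, y)).2.2 a) :=
      e.contMDiff_β.comp
        (contMDiff_id.prodMk (contMDiff_const (c := (⟨y, a⟩ : TotalSpace F' B))))
    exact h.mdifferentiable (by simp) x

/-- The derivative of `z ↦ e₁(x, z)` at `y`. -/
def ProdSec.deriv₁ (e : ProdSec E F A E' F' B) (x : M) (y : N) :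
    TangentSpace 𝓘(ℝ, E') y →ₗ[ℝ] A x × Dual ℝ (A x) :=
  haveI : FiniteDimensional ℝ (A x) := VectorBundle.finiteDimensional ℝ F A x
  vderiv E' (fun z => (e.val (x, z)).1) y

/-- The derivative of `z ↦ e₂(z, y)` at `x`. -/
def ProdSec.deriv₂ (e : ProdSec E F A E' F' B) (x : M) (y : N) :
    TangentSpace 𝓘(ℝ, E) x →ₗ[ℝ] B y × Dual ℝ (B y) :=
  haveI : FiniteDimensional ℝ (B y) := VectorBundle.finiteDimensional ℝ F' B y
  vderiv E (fun z => (e.val (z, y)).2) x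

/-- The derivative of a function along the graph of a map. -/
theorem tderiv_graph {h : M × N → ℝ} (hh : ContMDiff (𝓘(ℝ, E).prod 𝓘(ℝ, E')) 𝓘(ℝ, ℝ) ∞ h)
    {φ : M → N} (hφ : ContMDiff 𝓘(ℝ, E) 𝓘(ℝ, E') ∞ φ) (x : M) (v : TangentSpace 𝓘(ℝ, E) x) :
    tderiv E (fun z => h (z, φ z)) x v = tderiv E (fun z => h (z, φ x)) x v
      + tderiv E' (fun z => h (x, z)) (φ x) (mfderiv 𝓘(ℝ, E) 𝓘(ℝ, E') φ x v) := by
  have hid : MDifferentiableAt 𝓘(ℝ, E) 𝓘(ℝ, E) (fun z : M => z) x := mdifferentiableAt_id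
  have hi : mfderiv 𝓘(ℝ, E) 𝓘(ℝ, E) (fun z : M => z) x = ContinuousLinearMap.id ℝ _ := mfderiv_id
  have hφ' := hφ.mdifferentiable (by simp) x
  change mfderiv 𝓘(ℝ, E) 𝓘(ℝ, ℝ) (h ∘ fun z => (z, φ z)) x v = _
  rw [mfderiv_comp x (hh.mdifferentiable (by simp) (x, φ x)) (hid.prodMk hφ'),
    mfderiv_prodMk hid hφ']
  change mfderiv (𝓘(ℝ, E).prod 𝓘(ℝ, E')) 𝓘(ℝ, ℝ) h (x, φ x) _ = _
  rw [mfderiv_prod_eq_add_apply (hh.mdifferentiable (by simp) (x, φ x))]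
  have hv : mfderiv 𝓘(ℝ, E) 𝓘(ℝ, E) (fun z : M => z) x v = v := by rw [hi]; rfl
  change mfderiv 𝓘(ℝ, E) 𝓘(ℝ, ℝ) (fun z => h (z, φ x)) x
    (mfderiv 𝓘(ℝ, E) 𝓘(ℝ, E) (fun z : M => z) x v) + _ = _
  rw [hv]
  rfl

theorem tderiv_comp (f : Fn E' N) {φ : M → N} (hφ : ContMDiff 𝓘(ℝ, E) 𝓘(ℝ, E') ∞ φ) (x : M)
    (v : TangentSpace 𝓘(ℝ, E) x) : tderiv E (fun z => f (φ z)) x v =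
      tderiv E' f (φ x) (mfderiv 𝓘(ℝ, E) 𝓘(ℝ, E') φ x v) := by
  change mfderiv 𝓘(ℝ, E) 𝓘(ℝ, ℝ) (f ∘ φ) x v = _
  rw [mfderiv_comp x (f.mdifferentiableAt _) (hφ.mdifferentiable (by simp) x)]
  rfl

/-- The coordinate functions already separate tangent vectors. It turns the degree-zero part of the
morphism condition into an identity of anchors. -/
theorem tangent_ext {x : M} {v w : TangentSpace 𝓘(ℝ, E) x}
    (h : ∀ f : Fn E M, tderiv E f x v = tderiv E f x w) : v = w := by
  apply (finBasis ℝ E).ext_elem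
  intro i
  have := h (coordFn E x i)
  rwa [tderiv_coordFn, tderiv_coordFn] at this

/-! ### First derivatives of sections along the graph -/

/-- The section `e` takes values in the graph of `Φ` along the graph of the base map. -/
def VBMap.IsTangent (Φ : VBMap E F A E' F' B) (e : ProdSec E F A E' F' B) : Prop :=
  ∀ x, e.val (x, Φ.base x) ∈ Φ.graphDirac x

variable {Φ : VBMap E F A E' F' B} {e e' : ProdSec E F A E' F' B}

section Derivatives

variable {x : M}

/-- The derivative in direction `v` of the equation `α = α' ∘ Φ`, applied to `Z` and restricted to
the graph. On each side the chain rule separates the derivative of a slice from the mixed derivative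
in the other variable. -/
theorem VBMap.IsTangent.tderiv_form (h : Φ.IsTangent e) (Z : Sec E F A)
    (v : TangentSpace 𝓘(ℝ, E) x) :
    tderiv E ((e.slice₁ (Φ.base x)).2 Z) x v
      + (e.deriv₁ x (Φ.base x)
          (mfderiv 𝓘(ℝ, E) 𝓘(ℝ, E') Φ.base x v)).2 (Z x) =
    tderiv E (Φ.pullback (e.slice₂ x).2 Z) x v
      + (e.deriv₂ x (Φ.base x) v).2 (Φ.map x (Z x)) := by
  haveI : FiniteDimensional ℝ (A x) := VectorBundle.finiteDimensional ℝ F A x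
  haveI : FiniteDimensional ℝ (B (Φ.base x)) := VectorBundle.finiteDimensional ℝ F' B (Φ.base x)
  have h1 : ContMDiff (𝓘(ℝ, E).prod 𝓘(ℝ, E')) 𝓘(ℝ, ℝ) ∞
      (fun p : M × N => (e.val p).1.2 (Z p.1)) :=
    e.contMDiff_α.comp ((Z.contMDiff.comp contMDiff_fst).prodMk contMDiff_snd)
  -- The point of `M` enters twice, as the first argument of `e` and through the base map. Doubling
  -- the variable and restricting to the diagonal, the graph of the identity, separates the two
  -- effects.
  have h2 : ContMDiff (𝓘(ℝ, E).prod 𝓘(ℝ, E)) 𝓘(ℝ, ℝ) ∞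
      (fun p : M × M => (e.val (p.1, Φ.base p.2)).2.2 (Φ.map p.2 (Z p.2))) :=
    e.contMDiff_β.comp
      (contMDiff_fst.prodMk ((Φ.contMDiff_map.comp Z.contMDiff).comp contMDiff_snd))
  have h3 := tderiv_graph h1 Φ.contMDiff_base x v
  have h4 := tderiv_graph h2 contMDiff_id x v
  have h5 : (fun z => (e.val (z, Φ.base z)).1.2 (Z z)) =
      fun z => (e.val (z, Φ.base z)).2.2 (Φ.map z (Z z)) := by
    funext z
    rw [((Φ.mem_graphDirac).1 (h z)).2]
    rfl
  have h6 := apply_vderiv (E := E') (LinearMap.applyₗ (Z x) ∘ₗ LinearMap.snd ℝ (A x) (Dual ℝ (A x)))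
    (e.weakDiffAt₁ x (Φ.base x)) (mfderiv 𝓘(ℝ, E) 𝓘(ℝ, E') Φ.base x v)
  have h7 := apply_vderiv (E := E) (LinearMap.applyₗ (Φ.map x (Z x)) ∘ₗ
    LinearMap.snd ℝ (B (Φ.base x)) (Dual ℝ (B (Φ.base x)))) (e.weakDiffAt₂ x (Φ.base x)) v
  have h8 : tderiv E (fun z => (e.val (x, Φ.base z)).2.2 (Φ.map z (Z z))) x =
      tderiv E (Φ.pullback (e.slice₂ x).2 Z) x := by
    congr 1
    funext z
    exact (LinearMap.congr_fun (dualAt_slice₂ e x (Φ.base z)) _).symm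
  rw [mfderiv_id] at h4
  refine (congrArg₂ (· + ·) rfl h6).trans (h3.symm.trans ?_)
  refine (congrArg (fun f => tderiv E f x v) h5).trans (h4.trans ?_)
  rw [add_comm]
  exact congrArg₂ (· + ·) (LinearMap.congr_fun h8 v) h7.symm

/-- The derivative along the graph of the other equation of `F`, `Φ X = X'`, tested on a form `η`.
-/
theorem VBMap.IsTangent.tderiv_section (h : Φ.IsTangent e) (η : DualSec E' F' B)
    (v : TangentSpace 𝓘(ℝ, E) x) :
    tderiv E (Φ.pullback η (e.slice₁ (Φ.base x)).1) x v
      + dualAt η (Φ.base x) (Φ.map x (e.deriv₁ x (Φ.base x)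
          (mfderiv 𝓘(ℝ, E) 𝓘(ℝ, E') Φ.base x v)).1) =
    tderiv E' (η (e.slice₂ x).1) (Φ.base x) (mfderiv 𝓘(ℝ, E) 𝓘(ℝ, E') Φ.base x v)
      + dualAt η (Φ.base x) (e.deriv₂ x (Φ.base x) v).1 := by
  haveI : FiniteDimensional ℝ (A x) := VectorBundle.finiteDimensional ℝ F A x
  haveI : FiniteDimensional ℝ (B (Φ.base x)) := VectorBundle.finiteDimensional ℝ F' B (Φ.base x)
  have h1 : ContMDiff (𝓘(ℝ, E).prod 𝓘(ℝ, E')) 𝓘(ℝ, ℝ) ∞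
      (fun p : M × N => dualAt η (Φ.base p.1) (Φ.map p.1 (e.val p).1.1)) :=
    contMDiff_dualAt_comp η (f := fun p : M × N => ⟨Φ.base p.1, Φ.map p.1 (e.val p).1.1⟩)
      (Φ.contMDiff_map.comp e.contMDiff_a)
  have h2 : ContMDiff (𝓘(ℝ, E).prod 𝓘(ℝ, E')) 𝓘(ℝ, ℝ) ∞
      (fun p : M × N => dualAt η p.2 (e.val p).2.1) :=
    contMDiff_dualAt_comp η (f := fun p : M × N => ⟨p.2, (e.val p).2.1⟩) e.contMDiff_b
  have h3 := tderiv_graph h1 Φ.contMDiff_base x v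
  have h4 := tderiv_graph h2 Φ.contMDiff_base x v
  have h5 : (fun z => dualAt η (Φ.base z) (Φ.map z (e.val (z, Φ.base z)).1.1)) =
      fun z => dualAt η (Φ.base z) (e.val (z, Φ.base z)).2.1 := by
    funext z
    rw [((Φ.mem_graphDirac).1 (h z)).1]
  have h6 := apply_vderiv (E := E') (dualAt η (Φ.base x) ∘ₗ Φ.map x ∘ₗ
    LinearMap.fst ℝ (A x) (Dual ℝ (A x)))
    (e.weakDiffAt₁ x (Φ.base x)) (mfderiv 𝓘(ℝ, E) 𝓘(ℝ, E') Φ.base x v)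
  have h7 := apply_vderiv (E := E) (dualAt η (Φ.base x) ∘ₗ
    LinearMap.fst ℝ (B (Φ.base x)) (Dual ℝ (B (Φ.base x)))) (e.weakDiffAt₂ x (Φ.base x)) v
  have h8 : tderiv E' (fun y => dualAt η y (e.val (x, y)).2.1) (Φ.base x) =
      tderiv E' (η (e.slice₂ x).1) (Φ.base x) := by
    congr 1
    funext y
    exact dualAt_apply η y (e.slice₂ x).1
  refine (congrArg₂ (· + ·) rfl h6).trans (h3.symm.trans ?_)
  refine (congrArg (fun f => tderiv E f x v) h5).trans (h4.trans ?_)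
  rw [add_comm, h8]
  exact congrArg₂ (· + ·) rfl h7.symm

/-- The functions `α(Y)` and `α'(Y')` coincide on the graph, since `α = α' ∘ Φ` and `Y' = Φ Y`; both
are differentiated there with the product rule. -/
theorem VBMap.IsTangent.tderiv_pairing (h : Φ.IsTangent e) (h' : Φ.IsTangent e')
    (v : TangentSpace 𝓘(ℝ, E) x) :
    tderiv E ((e.slice₁ (Φ.base x)).2 (e'.slice₁ (Φ.base x)).1) x v
      + ((e.deriv₁ x (Φ.base x)
          (mfderiv 𝓘(ℝ, E) 𝓘(ℝ, E') Φ.base x v)).2 (e'.val (x, Φ.base x)).1.1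
        + (e.val (x, Φ.base x)).1.2 (e'.deriv₁ x (Φ.base x)
          (mfderiv 𝓘(ℝ, E) 𝓘(ℝ, E') Φ.base x v)).1) =
    tderiv E' ((e.slice₂ x).2 (e'.slice₂ x).1) (Φ.base x) (mfderiv 𝓘(ℝ, E) 𝓘(ℝ, E') Φ.base x v)
      + ((e.deriv₂ x (Φ.base x) v).2 (e'.val (x, Φ.base x)).2.1
        + (e.val (x, Φ.base x)).2.2 (e'.deriv₂ x (Φ.base x) v).1) := by
  haveI : FiniteDimensional ℝ (A x) := VectorBundle.finiteDimensional ℝ F A x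
  haveI : FiniteDimensional ℝ (B (Φ.base x)) := VectorBundle.finiteDimensional ℝ F' B (Φ.base x)
  have h1 : ContMDiff (𝓘(ℝ, E).prod 𝓘(ℝ, E')) 𝓘(ℝ, ℝ) ∞
      (fun p : M × N => (e.val p).1.2 (e'.val p).1.1) :=
    e.contMDiff_α.comp (e'.contMDiff_a.prodMk contMDiff_snd)
  have h2 : ContMDiff (𝓘(ℝ, E).prod 𝓘(ℝ, E')) 𝓘(ℝ, ℝ) ∞
      (fun p : M × N => (e.val p).2.2 (e'.val p).2.1) :=
    e.contMDiff_β.comp (contMDiff_fst.prodMk e'.contMDiff_b)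
  have h3 := tderiv_graph h1 Φ.contMDiff_base x v
  have h4 := tderiv_graph h2 Φ.contMDiff_base x v
  have h5 : (fun z => (e.val (z, Φ.base z)).1.2 (e'.val (z, Φ.base z)).1.1) =
      fun z => (e.val (z, Φ.base z)).2.2 (e'.val (z, Φ.base z)).2.1 := by
    funext z
    rw [((Φ.mem_graphDirac).1 (h z)).2, ((Φ.mem_graphDirac).1 (h' z)).1]
    rfl
  have h6 := tderiv_bilin (E := E') ((LinearMap.applyₗ (R := ℝ)).flip.compl₁₂
      (LinearMap.snd ℝ (A x) (Dual ℝ (A x))) (LinearMap.fst ℝ (A x) (Dual ℝ (A x))))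
    (e.weakDiffAt₁ x (Φ.base x)) (e'.weakDiffAt₁ x (Φ.base x))
    (mfderiv 𝓘(ℝ, E) 𝓘(ℝ, E') Φ.base x v)
  have h7 := tderiv_bilin (E := E) ((LinearMap.applyₗ (R := ℝ)).flip.compl₁₂
      (LinearMap.snd ℝ (B (Φ.base x)) (Dual ℝ (B (Φ.base x))))
      (LinearMap.fst ℝ (B (Φ.base x)) (Dual ℝ (B (Φ.base x)))))
    (e.weakDiffAt₂ x (Φ.base x)) (e'.weakDiffAt₂ x (Φ.base x)) v
  refine (congrArg₂ (· + ·) rfl h6.symm).trans (h3.symm.trans ?_)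
  refine (congrArg (fun f => tderiv E f x v) h5).trans (h4.trans ?_)
  rw [add_comm]
  exact congrArg₂ (· + ·) rfl h7

end Derivatives

/-! ### Consequences of the morphism conditions -/

namespace IsQuasiJacobiMorphism

variable {P : QuasiJacobiBialgebroid E F A} {Q : QuasiJacobiBialgebroid E' F' B}

theorem dForm_function (hΦ : IsQuasiJacobiMorphism P Q Φ) (f : Fn E' N) (x : M) (a : A x) :
    tderiv E' f (Φ.base x) (Q.alg.anchor (Φ.base x) (Φ.map x a))
        + dualAt Q.str.φ (Φ.base x) (Φ.map x a) * f (Φ.base x) =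
      tderiv E (f ∘ Φ.base) x (P.alg.anchor x a) + dualAt P.str.φ x a * f (Φ.base x) := by
  obtain ⟨X, rfl⟩ := exists_sec_apply_eq (E := E) (F := F) x a
  obtain ⟨Y, hY⟩ := exists_sec_apply_eq (E := E') (F := F') (Φ.base x) (Φ.map x (X x))
  let η : MForm E' F' B 0 := ⟨fun y => AlternatingMap.constOfIsEmpty ℝ (B y) (Fin 0) (f y),
    fun _ => f.contMDiff⟩
  have h := hΦ.jacobi 0 η (fun _ => X) (fun _ => Y) x fun _ => hY.symm
  simpa [LieAlgebroid.dForm, η, hY] using! h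

/-- The twisted differential of the constant function `1` is `φ`. -/
theorem cocycle (hΦ : IsQuasiJacobiMorphism P Q Φ) (x : M) (a : A x) :
    dualAt Q.str.φ (Φ.base x) (Φ.map x a) = dualAt P.str.φ x a := by
  have h := hΦ.dForm_function 1 x a
  have h1 : tderiv E' (1 : Fn E' N) (Φ.base x) = 0 := by
    ext v
    change mfderiv 𝓘(ℝ, E') 𝓘(ℝ, ℝ) (fun _ => (1 : ℝ)) _ v = 0
    rw [mfderiv_const]; rfl
  have h2 : tderiv E ((1 : Fn E' N) ∘ Φ.base) x = 0 := by
    ext v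
    change mfderiv 𝓘(ℝ, E) 𝓘(ℝ, ℝ) (fun _ => (1 : ℝ)) _ v = 0
    rw [mfderiv_const]; rfl
  have h3 : (1 : Fn E' N) (Φ.base x) = 1 := rfl
  rw [h1, h2, h3] at h
  simpa using h

/-- By `cocycle` the zero-order terms in degree zero cancel, and what is left is the identity tested
on functions. -/
theorem mfderiv_anchor (hΦ : IsQuasiJacobiMorphism P Q Φ) (x : M) (a : A x) :
    mfderiv 𝓘(ℝ, E) 𝓘(ℝ, E') Φ.base x (P.alg.anchor x a) =
      Q.alg.anchor (Φ.base x) (Φ.map x a) := by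
  apply tangent_ext
  intro f
  have h := hΦ.dForm_function f x a
  rw [hΦ.cocycle] at h
  rw [← tderiv_comp f Φ.contMDiff_base]
  exact (add_right_cancel h).symm

theorem mfderiv_anchorStar (hΦ : IsQuasiJacobiMorphism P Q Φ) (x : M)
    (ξ : Dual ℝ (B (Φ.base x))) :
    mfderiv 𝓘(ℝ, E) 𝓘(ℝ, E') Φ.base x (P.anchorStar x (ξ ∘ₗ Φ.map x)) =
      Q.anchorStar (Φ.base x) ξ := by
  obtain ⟨α, rfl⟩ := exists_dualAt_eq (E := E') (F := F') _ ξ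
  rw [← hΦ.anchor, Φ.dualAt_pullback]

/-- The degree-one morphism condition, freed of its `φ`-terms by `cocycle`. The sections of `B` need
to match the images at one point only; this is what allows a comparison of brackets of slices, which
are not `Φ`-related near the point. -/
theorem dForm_form (hΦ : IsQuasiJacobiMorphism P Q Φ) (η : DualSec E' F' B) (x : M)
    {X Y : Sec E F A} {X' Y' : Sec E' F' B} (hX : Φ.map x (X x) = X' (Φ.base x))
    (hY : Φ.map x (Y x) = Y' (Φ.base x)) :
    tderiv E' (η Y') (Φ.base x) (Q.alg.anchor (Φ.base x) (X' (Φ.base x)))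
        - tderiv E' (η X') (Φ.base x) (Q.alg.anchor (Φ.base x) (Y' (Φ.base x)))
        - η (Q.alg.bracket X' Y') (Φ.base x) =
      tderiv E (Φ.pullback η Y) x (P.alg.anchor x (X x))
        - tderiv E (Φ.pullback η X) x (P.alg.anchor x (Y x))
        - Φ.pullback η (P.alg.bracket X Y) x := by
  let ζ : MForm E' F' B 1 := ⟨fun y => AlternatingMap.ofSubsingleton ℝ (B y) ℝ 0 (dualAt η y),
    fun X => (η (X 0)).contMDiff.congr fun y => by
      simp [dualAt_apply]⟩
  have h := hΦ.jacobi 1 ζ ![X, Y] ![X', Y'] x (by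
    intro i
    fin_cases i
    · exact hX
    · exact hY)
  have c1 := hΦ.cocycle x (X x)
  have c2 := hΦ.cocycle x (Y x)
  rw [hX] at c1
  rw [hY] at c2
  have e1 : dualAt η (Φ.base x) (Φ.map x (X x)) = η X' (Φ.base x) := by rw [hX, dualAt_apply]
  have e2 : dualAt η (Φ.base x) (Φ.map x (Y x)) = η Y' (Φ.base x) := by rw [hY, dualAt_apply]
  simp only [LieAlgebroid.dForm, ζ] at h
  simp [Fin.sum_univ_two, dualAt_apply] at h
  rw [e1, e2] at h
  rw [dualAt_apply, dualAt_apply] at c1 c2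
  change _ = tderiv E (fun z => dualAt η (Φ.base z) (Φ.map z (Y z))) x _
    - tderiv E (fun z => dualAt η (Φ.base z) (Φ.map z (X z))) x _
    - dualAt η (Φ.base x) (Φ.map x (P.alg.bracket X Y x))
  linear_combination h - η Y' (Φ.base x) * c1 + η X' (Φ.base x) * c2

end IsQuasiJacobiMorphism

end Graph

/-! ### Orthogonality of the product bracket to the graph. -/

section Closed

variable {E : Type*} [NormedAddCommGroup E] [NormedSpace ℝ E] [FiniteDimensional ℝ E]
  {M : Type*} [TopologicalSpace M] [ChartedSpace E M] [IsManifold 𝓘(ℝ, E) ∞ M] [T2Space M]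
  {F : Type*} [NormedAddCommGroup F] [NormedSpace ℝ F] [FiniteDimensional ℝ F]
  {A : M → Type*} [TopologicalSpace (TotalSpace F A)] [∀ x, TopologicalSpace (A x)]
  [∀ x, AddCommGroup (A x)] [∀ x, Module ℝ (A x)] [FiberBundle F A] [VectorBundle ℝ F A]
  [ContMDiffVectorBundle ∞ F A 𝓘(ℝ, E)]
  {E' : Type*} [NormedAddCommGroup E'] [NormedSpace ℝ E'] [FiniteDimensional ℝ E']
  {N : Type*} [TopologicalSpace N] [ChartedSpace E' N] [IsManifold 𝓘(ℝ, E') ∞ N] [T2Space N]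
  {F' : Type*} [NormedAddCommGroup F'] [NormedSpace ℝ F'] [FiniteDimensional ℝ F']
  {B : N → Type*} [TopologicalSpace (TotalSpace F' B)] [∀ x, TopologicalSpace (B x)]
  [∀ x, AddCommGroup (B x)] [∀ x, Module ℝ (B x)] [FiberBundle F' B] [VectorBundle ℝ F' B]
  [ContMDiffVectorBundle ∞ F' B 𝓘(ℝ, E')]

open QuasiJacobiStructure

theorem dpairing_apply {V : Type*} [AddCommGroup V] [Module ℝ V] (u w : V × Dual ℝ V) :
    dpairing V u w = (1 / 2) * (u.2 w.1 + w.2 u.1) := rfl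

namespace QuasiJacobiBialgebroid

variable (P : QuasiJacobiBialgebroid E F A) (Q : QuasiJacobiBialgebroid E' F' B)

theorem anchor_fst (x : M) (u : A x × Dual ℝ (A x)) :
    (P.anchor x u).1 = P.alg.anchor x u.1 + P.anchorStar x u.2 := rfl

/-- The bracket of the double paired with a section, at a point. -/
theorem two_mul_dpairing_bracket (e e' : Sec E F A × DualSec E F A) (Z : Sec E F A)
    (γ : DualSec E F A) (x : M) :
    2 * dpairing (A x) (dvalue (P.bracket e e') x) (Z x, dualAt γ x) =
      (γ (P.alg.bracket e.1 e'.1) x + tderiv E (γ e'.1) x (P.anchorStar x (dualAt e.2 x))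
        - P.str.bracketStar e.2 γ e'.1 x + e.2 P.str.W x * γ e'.1 x
        - tderiv E (γ e.1) x (P.anchorStar x (dualAt e'.2 x))
        + tderiv E (e'.2 e.1) x (P.anchorStar x (dualAt γ x)) + P.str.bracketStar e'.2 γ e.1 x
        - e'.2 P.str.W x * γ e.1 x + e'.2 e.1 x * γ P.str.W x + eval₃ P.str.χ e.2 e'.2 γ x)
      + (P.str.bracketStar e.2 e'.2 Z x
        + (tderiv E (e'.2 Z) x (P.alg.anchor x (e.1 x)) - e'.2 (P.alg.bracket e.1 Z) x
          + P.str.φ e.1 x * e'.2 Z x)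
        - (tderiv E (e.2 Z) x (P.alg.anchor x (e'.1 x))
          - tderiv E (e.2 e'.1) x (P.alg.anchor x (Z x)) - e.2 (P.alg.bracket e'.1 Z) x
          + P.str.φ e'.1 x * e.2 Z x - P.str.φ Z x * e.2 e'.1 x)) := by
  obtain ⟨X, α⟩ := e
  obtain ⟨Y, β⟩ := e'
  have h1 := congrArg (fun f : Fn E M => f x) (P.str.apply_doubleBracket_fst X Y α β γ)
  have h2 := congrArg (fun f : Fn E M => f x) (P.str.doubleBracket_snd_apply X Y Z α β)
  simp only [ContMDiffMap.coe_add, ContMDiffMap.coe_sub, ContMDiffMap.coe_mul, Pi.add_apply,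
    Pi.sub_apply, Pi.mul_apply, anchorStar_apply, anchor_apply] at h1 h2
  have h3 : 2 * dpairing (A x) (dvalue (P.bracket (X, α) (Y, β)) x) (Z x, dualAt γ x) =
      γ (P.str.doubleBracket (X, α) (Y, β)).1 x + (P.str.doubleBracket (X, α) (Y, β)).2 Z x := by
    rw [dpairing_apply, ← dualAt_apply γ, ← dualAt_apply (P.str.doubleBracket (X, α) (Y, β)).2]
    change 2 * (1 / 2 * (dualAt (P.str.doubleBracket (X, α) (Y, β)).2 x (Z x)
      + dualAt γ x ((P.str.doubleBracket (X, α) (Y, β)).1 x))) = _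
    ring
  rw [h3, h1, h2]
  rfl

/-- The product bracket paired with an element of the fibre. -/
theorem prodPairing_prodBracket (e e' : ProdSec E F A E' F' B) (x : M) (y : N)
    (k₁ : A x × Dual ℝ (A x)) (k₂ : B y × Dual ℝ (B y)) :
    prodPairing A B (x, y) (P.prodBracket Q e e' x y) (k₁, k₂) =
      (dpairing (A x) (dvalue (P.bracket (e.slice₁ y) (e'.slice₁ y)) x) k₁
        + dpairing (A x) (e'.deriv₁ x y (Q.anchor y (e.val (x, y)).2).1) k₁
        - dpairing (A x) (e.deriv₁ x y (Q.anchor y (e'.val (x, y)).2).1) k₁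
        - dpairing (B y) (e.deriv₂ x y (P.anchor x k₁).1) (e'.val (x, y)).2)
      - (dpairing (B y) (dvalue (Q.bracket (e.slice₂ x) (e'.slice₂ x)) y) k₂
        + dpairing (B y) (e'.deriv₂ x y (P.anchor x (e.val (x, y)).1).1) k₂
        - dpairing (B y) (e.deriv₂ x y (P.anchor x (e'.val (x, y)).1).1) k₂
        - dpairing (A x) (e.deriv₁ x y (Q.anchor y k₂).1) (e'.val (x, y)).1) := by
  haveI : FiniteDimensional ℝ (A x) := VectorBundle.finiteDimensional ℝ F A x
  haveI : FiniteDimensional ℝ (B y) := VectorBundle.finiteDimensional ℝ F' B y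
  -- The term `Z` of the product bracket enters only through its defining pairing.
  have h1 := dpairing_dsharp (A x) ((dpairing (B y)).flip (e'.val (x, y)).2 ∘ₗ
    e.deriv₂ x y ∘ₗ LinearMap.fst ℝ _ _ ∘ₗ P.anchor x) k₁
  have h2 := dpairing_dsharp (B y) ((dpairing (A x)).flip (e'.val (x, y)).1 ∘ₗ
    e.deriv₁ x y ∘ₗ LinearMap.fst ℝ _ _ ∘ₗ Q.anchor y) k₂
  change dpairing (A x) (_ + _ - _ - dsharp (A x) ((dpairing (B y)).flip (e'.val (x, y)).2 ∘ₗ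
    e.deriv₂ x y ∘ₗ LinearMap.fst ℝ _ _ ∘ₗ P.anchor x)) k₁ - dpairing (B y) (_ + _ - _ -
      dsharp (B y) ((dpairing (A x)).flip (e'.val (x, y)).1 ∘ₗ
    e.deriv₁ x y ∘ₗ LinearMap.fst ℝ _ _ ∘ₗ Q.anchor y)) k₂ = _
  rw [map_sub, map_sub, map_add, map_sub, map_sub, map_add]
  simp only [LinearMap.sub_apply, LinearMap.add_apply]
  rw [h1, h2]
  rfl

end QuasiJacobiBialgebroid

variable {P : QuasiJacobiBialgebroid E F A} {Q : QuasiJacobiBialgebroid E' F' B}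
  {Φ : VBMap E F A E' F' B} {e e' : ProdSec E F A E' F' B}

open QuasiJacobiBialgebroid

/-- The core of the proof. After tensorial terms and brackets have been matched, only first
derivatives in the six directions `vX`, `vY`, `vZ`, `vα`, `vβ`, `vγ` remain, and these cancel by the
derivatives of the equations of `F` along the graph. -/
theorem IsQuasiJacobiMorphism.prodPairing_prodBracket_eq_zero (hΦ : IsQuasiJacobiMorphism P Q Φ)
    (h : Φ.IsTangent e) (h' : Φ.IsTangent e') (x : M)
    (c : A x) (d : Dual ℝ (B (Φ.base x))) :
    prodPairing A B (x, Φ.base x) (P.prodBracket Q e e' x (Φ.base x)) (Φ.graphMap x (c, d)) = 0 := by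
  obtain ⟨Z, rfl⟩ := exists_sec_apply_eq (E := E) (F := F) x c
  -- `Z'` agrees with `Φ Z` at `Φ.base x` and is otherwise arbitrary, whereas the form over `A` is
  -- chosen below as `Φ.pullback γ'` globally, so that it contributes no correction in `s2` and
  -- `s3`.
  obtain ⟨Z', hZ⟩ := exists_sec_apply_eq (E := E') (F := F') (Φ.base x) (Φ.map x (Z x))
  obtain ⟨γ', rfl⟩ := exists_dualAt_eq (E := E') (F := F') _ d
  obtain ⟨hX, hα⟩ := Φ.mem_graphDirac.1 (h x)
  obtain ⟨hY, hβ⟩ := Φ.mem_graphDirac.1 (h' x)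
  have hk : Φ.graphMap x (Z x, dualAt γ' (Φ.base x)) =
      ((Z x, dualAt (Φ.pullback γ') x), (Z' (Φ.base x), dualAt γ' (Φ.base x))) := by
    rw [Φ.dualAt_pullback, hZ]; rfl
  rw [hk, prodPairing_prodBracket]
  have b1 := P.two_mul_dpairing_bracket (e.slice₁ (Φ.base x)) (e'.slice₁ (Φ.base x)) Z
    (Φ.pullback γ') x
  have b2 := Q.two_mul_dpairing_bracket (e.slice₂ x) (e'.slice₂ x) Z' γ' (Φ.base x)
  -- Equality at `x` only: away from `x` the slice leaves the graph. It suffices for the tensorial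
  -- terms and produces corrections in the brackets.
  have pα : dualAt (e.slice₁ (Φ.base x)).2 x = dualAt (Φ.pullback (e.slice₂ x).2) x := by
    rw [dualAt_slice₁, Φ.dualAt_pullback, dualAt_slice₂, hα]
  have pβ : dualAt (e'.slice₁ (Φ.base x)).2 x = dualAt (Φ.pullback (e'.slice₂ x).2) x := by
    rw [dualAt_slice₁, Φ.dualAt_pullback, dualAt_slice₂, hβ]
  have mX : Φ.map x ((e.slice₁ (Φ.base x)).1 x) = (e.slice₂ x).1 (Φ.base x) := hX.symm
  have mY : Φ.map x ((e'.slice₁ (Φ.base x)).1 x) = (e'.slice₂ x).1 (Φ.base x) := hY.symm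
  have mW := hΦ.section_W x
  have pull {U : Sec E F A} {U' : Sec E' F' B} (hU : Φ.map x (U x) = U' (Φ.base x))
      (η : DualSec E' F' B) : Φ.pullback η U x = η U' (Φ.base x) := by
    rw [← dualAt_apply η, ← hU]; rfl
  have pullα {U : Sec E F A} {U' : Sec E' F' B} (hU : Φ.map x (U x) = U' (Φ.base x)) :
      (e.slice₁ (Φ.base x)).2 U x = (e.slice₂ x).2 U' (Φ.base x) := by
    rw [DualSec.apply_congr pα, pull hU]
  have pullβ {U : Sec E F A} {U' : Sec E' F' B} (hU : Φ.map x (U x) = U' (Φ.base x)) :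
      (e'.slice₁ (Φ.base x)).2 U x = (e'.slice₂ x).2 U' (Φ.base x) := by
    rw [DualSec.apply_congr pβ, pull hU]
  have pullφ {U : Sec E F A} {U' : Sec E' F' B} (hU : Φ.map x (U x) = U' (Φ.base x)) :
      P.str.φ U x = Q.str.φ U' (Φ.base x) := by
    rw [← dualAt_apply, ← dualAt_apply, ← hU, hΦ.cocycle]
  have hχ : eval₃ P.str.χ (e.slice₁ (Φ.base x)).2 (e'.slice₁ (Φ.base x)).2 (Φ.pullback γ') x =
      eval₃ Q.str.χ (e.slice₂ x).2 (e'.slice₂ x).2 γ' (Φ.base x) := by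
    rw [eval₃_congr P.str.χ_mem pα pβ, hΦ.trisection]
  rw [pullα mW, pullα hZ.symm, pullα mY, pullβ mW, pullβ hZ.symm, pullβ mX, pull mX, pull mY,
    pull mW, pullφ mX, pullφ mY, pullφ hZ.symm, hχ, DualSec.apply_congr pα, DualSec.apply_congr pβ]
    at b1
  -- The brackets of slice forms become brackets of pullbacks, to which the morphism property
  -- applies; the price is a difference of derivatives for each slice form.
  have s1 := P.bracketStar_congr pα pβ Z
  have s2 := P.bracketStar_congr (β := Φ.pullback γ') pα rfl (e'.slice₁ (Φ.base x)).1
  have s3 := P.bracketStar_congr (β := Φ.pullback γ') pβ rfl (e.slice₁ (Φ.base x)).1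
  rw [hΦ.bracket, pull hZ.symm] at s1
  rw [hΦ.bracket, pull mY] at s2
  rw [hΦ.bracket, pull mX] at s3
  -- The three forms go with the brackets on `A` in the expansion: `γ` is applied to `[X, Y]`, `β`
  -- to `[X, Z]` and `α` to `[Y, Z]`.
  have d1 := hΦ.dForm_form γ' x mX mY
  have d2 := hΦ.dForm_form (e'.slice₂ x).2 x mX hZ.symm
  have d3 := hΦ.dForm_form (e.slice₂ x).2 x mY hZ.symm
  have tX := hΦ.mfderiv_anchor x ((e.slice₁ (Φ.base x)).1 x)
  have tY := hΦ.mfderiv_anchor x ((e'.slice₁ (Φ.base x)).1 x)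
  have tZ := hΦ.mfderiv_anchor x (Z x)
  have tα : mfderiv 𝓘(ℝ, E) 𝓘(ℝ, E') Φ.base x
      (P.anchorStar x (dualAt (e.slice₁ (Φ.base x)).2 x)) =
        Q.anchorStar (Φ.base x) (dualAt (e.slice₂ x).2 (Φ.base x)) := by
    rw [pα, hΦ.anchor]
  have tβ : mfderiv 𝓘(ℝ, E) 𝓘(ℝ, E') Φ.base x
      (P.anchorStar x (dualAt (e'.slice₁ (Φ.base x)).2 x)) =
        Q.anchorStar (Φ.base x) (dualAt (e'.slice₂ x).2 (Φ.base x)) := by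
    rw [pβ, hΦ.anchor]
  have tγ := hΦ.anchor γ' x
  rw [mX] at tX
  rw [mY] at tY
  rw [← hZ] at tZ
  have a1 : (Q.anchor (Φ.base x) (e.val (x, Φ.base x)).2).1 =
      Q.alg.anchor (Φ.base x) ((e.slice₂ x).1 (Φ.base x))
        + Q.anchorStar (Φ.base x) (dualAt (e.slice₂ x).2 (Φ.base x)) := by
    rw [dualAt_slice₂]; rfl
  have a2 : (Q.anchor (Φ.base x) (e'.val (x, Φ.base x)).2).1 =
      Q.alg.anchor (Φ.base x) ((e'.slice₂ x).1 (Φ.base x))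
        + Q.anchorStar (Φ.base x) (dualAt (e'.slice₂ x).2 (Φ.base x)) := by
    rw [dualAt_slice₂]; rfl
  have a3 : (P.anchor x (e.val (x, Φ.base x)).1).1 =
      P.alg.anchor x ((e.slice₁ (Φ.base x)).1 x)
        + P.anchorStar x (dualAt (e.slice₁ (Φ.base x)).2 x) := by
    rw [dualAt_slice₁]; rfl
  have a4 : (P.anchor x (e'.val (x, Φ.base x)).1).1 =
      P.alg.anchor x ((e'.slice₁ (Φ.base x)).1 x)
        + P.anchorStar x (dualAt (e'.slice₁ (Φ.base x)).2 x) := by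
    rw [dualAt_slice₁]; rfl
  rw [a1, a2, a3, a4, anchor_fst, anchor_fst]
  set vX := P.alg.anchor x ((e.slice₁ (Φ.base x)).1 x)
  set vY := P.alg.anchor x ((e'.slice₁ (Φ.base x)).1 x)
  set vZ := P.alg.anchor x (Z x)
  set vα := P.anchorStar x (dualAt (e.slice₁ (Φ.base x)).2 x)
  set vβ := P.anchorStar x (dualAt (e'.slice₁ (Φ.base x)).2 x)
  set vγ := P.anchorStar x (dualAt (Φ.pullback γ') x)
  -- Every direction of differentiation in `N` is now `Tφ` of a direction in `M`, the form in which
  -- the relations along the graph are stated.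
  rw [← tX, ← tY, ← tZ, ← tα, ← tβ, ← tγ] at b2
  rw [← tX, ← tY] at d1
  rw [← tX, ← tZ] at d2
  rw [← tY, ← tZ] at d3
  rw [← tX, ← tY, ← tZ, ← tα, ← tβ, ← tγ]
  have i1 := h.tderiv_form Z (x := x)
  have i2 := h'.tderiv_form Z (x := x)
  have i3 := h.tderiv_form (e'.slice₁ (Φ.base x)).1 (x := x)
  have j1 := h.tderiv_section γ' (x := x)
  have j2 := h'.tderiv_section γ' (x := x)
  have j3 := h.tderiv_section (e'.slice₂ x).2 (x := x)
  have j4 := h'.tderiv_section (e.slice₂ x).2 (x := x)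
  have k1 := h.tderiv_pairing h' (x := x)
  have sY : (e'.slice₁ (Φ.base x)).1 x = (e'.val (x, Φ.base x)).1.1 := rfl
  simp only [sY, dualAt_slice₂] at i3 j3 j4
  simp only [hα, hY, LinearMap.comp_apply] at k1
  simp only [dpairing_apply, map_add, LinearMap.add_apply, hβ, hY, hZ, Φ.dualAt_pullback,
    LinearMap.comp_apply] at b1 b2 ⊢
  -- The factors `1 / 2` are those of the pairing, and the signs of the `s` and `d` relations are
  -- those of the corresponding brackets in `b1`. The relations along `vγ` absorb the derivatives
  -- left by `s2` and `s3`, those along `vα` and `vβ` include the corrections in `s1`, and `k1 vZ`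
  -- accounts for the derivative of `α(Y)` along `Z`.
  linear_combination (1 / 2) * b1 - (1 / 2) * b2 + (1 / 2) * s1 - (1 / 2) * s2 + (1 / 2) * s3
    + (1 / 2) * d1 - (1 / 2) * d2 + (1 / 2) * d3 + (1 / 2) * j2 vX - (1 / 2) * j1 vY
    + (1 / 2) * j2 vα - (1 / 2) * j1 vβ + (1 / 2) * i2 vX - (1 / 2) * i1 vY + (1 / 2) * j3 vZ
    - (1 / 2) * j4 vZ + (1 / 2) * k1 vZ + (1 / 2) * i2 vα - (1 / 2) * i1 vβ + (1 / 2) * j3 vγ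
    + (1 / 2) * i3 vγ

end Closed

/-! ### Maximal isotropy, local frames, the anchor and both brackets. -/

section Dirac

variable {E : Type*} [NormedAddCommGroup E] [NormedSpace ℝ E] [FiniteDimensional ℝ E]
  {M : Type*} [TopologicalSpace M] [ChartedSpace E M] [IsManifold 𝓘(ℝ, E) ∞ M] [T2Space M]
  {F : Type*} [NormedAddCommGroup F] [NormedSpace ℝ F] [FiniteDimensional ℝ F]
  {A : M → Type*} [TopologicalSpace (TotalSpace F A)] [∀ x, TopologicalSpace (A x)]
  [∀ x, AddCommGroup (A x)] [∀ x, Module ℝ (A x)] [FiberBundle F A] [VectorBundle ℝ F A]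
  [ContMDiffVectorBundle ∞ F A 𝓘(ℝ, E)]
  {E' : Type*} [NormedAddCommGroup E'] [NormedSpace ℝ E'] [FiniteDimensional ℝ E']
  {N : Type*} [TopologicalSpace N] [ChartedSpace E' N] [IsManifold 𝓘(ℝ, E') ∞ N] [T2Space N]
  {F' : Type*} [NormedAddCommGroup F'] [NormedSpace ℝ F'] [FiniteDimensional ℝ F']
  {B : N → Type*} [TopologicalSpace (TotalSpace F' B)] [∀ x, TopologicalSpace (B x)]
  [∀ x, AddCommGroup (B x)] [∀ x, Module ℝ (B x)] [FiberBundle F' B] [VectorBundle ℝ F' B]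
  [ContMDiffVectorBundle ∞ F' B 𝓘(ℝ, E')]

open QuasiJacobiBialgebroid

theorem VBMap.prodPairing_graphMap (Φ : VBMap E F A E' F' B) (x : M)
    (u : ProdFibre A B (x, Φ.base x)) (c : A x) (d : Dual ℝ (B (Φ.base x))) :
    prodPairing A B (x, Φ.base x) u (Φ.graphMap x (c, d)) =
      (1 / 2) * (u.1.2 c + d (Φ.map x u.1.1)) - (1 / 2) * (u.2.2 (Φ.map x c) + d u.2.1) := rfl

/-- The fibres of the graph contain their orthogonal complement. -/
theorem VBMap.mem_graphDirac_of_orthogonal (Φ : VBMap E F A E' F' B) {x : M}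
    {u : ProdFibre A B (x, Φ.base x)}
    (h : ∀ c d, prodPairing A B (x, Φ.base x) u (Φ.graphMap x (c, d)) = 0) :
    u ∈ Φ.graphDirac x := by
  rw [Φ.mem_graphDirac]
  constructor
  · rw [← sub_eq_zero, ← Module.forall_dual_apply_eq_zero_iff ℝ]
    -- Test vectors `(0, d)` isolate the vector equation of the graph, and `(c, 0)` below the
    -- equation of forms.
    intro d
    have := h 0 d
    rw [Φ.prodPairing_graphMap, map_zero, map_zero, map_zero] at this
    rw [map_sub]
    linarith
  · ext c
    have := h c 0
    rw [Φ.prodPairing_graphMap, LinearMap.zero_apply, LinearMap.zero_apply] at this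
    rw [LinearMap.comp_apply]
    linarith

theorem VBMap.graphDirac_isotropic (Φ : VBMap E F A E' F' B) (x : M) :
    ∀ u ∈ Φ.graphDirac x, ∀ v ∈ Φ.graphDirac x, prodPairing A B (x, Φ.base x) u v = 0 := by
  rintro u hu _ ⟨⟨c, d⟩, rfl⟩
  obtain ⟨h1, h2⟩ := Φ.mem_graphDirac.1 hu
  rw [Φ.prodPairing_graphMap, h1, h2, LinearMap.comp_apply]
  ring

/-- An isotropic subspace containing the fibre is orthogonal to it, hence contained in it. -/
theorem VBMap.graphDirac_maximal (Φ : VBMap E F A E' F' B) (x : M)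
    (L : Submodule ℝ (ProdFibre A B (x, Φ.base x)))
    (hL : ∀ u ∈ L, ∀ v ∈ L, prodPairing A B (x, Φ.base x) u v = 0) (h : Φ.graphDirac x ≤ L) :
    L = Φ.graphDirac x :=
  le_antisymm (fun u hu => Φ.mem_graphDirac_of_orthogonal fun c d =>
    hL u hu _ (h ⟨(c, d), rfl⟩)) h

/-! ### Local frames of the graph -/

section Frame

variable (Φ : VBMap E F A E' F' B)

theorem VBMap.exists_bump_preimage (x₀ : M) : ∃ χ : SmoothBumpFunction 𝓘(ℝ, E) x₀,
    tsupport χ ⊆ Φ.base ⁻¹' (trivializationAt F' B (Φ.base x₀)).baseSet := by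
  obtain ⟨χ, -, h⟩ := (SmoothBumpFunction.nhds_basis_tsupport (I := 𝓘(ℝ, E)) x₀).mem_iff.1
    (Φ.contMDiff_base.continuous.continuousAt.preimage_mem_nhds
      ((trivializationAt F' B (Φ.base x₀)).open_baseSet.mem_nhds
        (FiberBundle.mem_baseSet_trivializationAt F' B (Φ.base x₀))))
  exact ⟨χ, h⟩

/-- For `X ∈ Γ(A)`, there is a section that equals `(X, Φ X)` on the graph near `x₀`. -/
theorem VBMap.exists_graphSec (x₀ : M) (X : Sec E F A) : ∃ e : ProdSec E F A E' F' B,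
    ∀ᶠ x in nhds x₀, e.val (x, Φ.base x) = Φ.graphMap x (X x, 0) := by
  obtain ⟨χ, hχ⟩ := Φ.exists_bump_preimage x₀
  set y₀ := Φ.base x₀
  -- `Φ X` is a section of `B` along the base map and need not come from a section of `B`. Its
  -- coefficients in a local frame are functions on `M`, the frame lives on `N`, and their
  -- combination is a section over the product; the cut-offs make both factors global.
  have hc (i) : ContMDiff 𝓘(ℝ, E) 𝓘(ℝ, ℝ) ∞
      (fun x => χ x • frameCoord F' y₀ (Φ.base x) i (Φ.map x (X x))) := by
    apply contMDiff_of_tsupport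
    intro x hx
    have hx' : Φ.base x ∈ (trivializationAt F' B y₀).baseSet :=
      hχ (tsupport_smul_subset_left _ _ hx)
    have h1 := (contMDiffOn_frameCoord (E := E') (A := B) y₀ i).contMDiffAt
      (x := (⟨Φ.base x, Φ.map x (X x)⟩ : TotalSpace F' B))
      ((trivializationAt F' B y₀).open_source.mem_nhds
        (by simpa [Trivialization.mem_source] using hx'))
    exact χ.contMDiff.contMDiffAt.smul
      (h1.comp x (Φ.contMDiff_map.comp X.contMDiff).contMDiffAt)
  let c (i) : Fn E M := ⟨_, hc i⟩
  -- Smoothness is checked in a trivialization of `B`, whose linearity on fibres lets it pass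
  -- through the sum.
  have hb : ContMDiff (𝓘(ℝ, E).prod 𝓘(ℝ, E')) (𝓘(ℝ, E').prod 𝓘(ℝ, F')) ∞ (fun p : M × N =>
      (⟨p.2, ∑ i, c i p.1 • frameSec E' F' B y₀ i p.2⟩ : TotalSpace F' B)) := by
    intro p₀
    rw [contMDiffAt_totalSpace]
    refine ⟨contMDiff_snd.contMDiffAt, ?_⟩
    set τ := trivializationAt F' B p₀.2
    have h1 (i) : ContMDiffAt (𝓘(ℝ, E).prod 𝓘(ℝ, E')) 𝓘(ℝ, F') ∞ (fun p : M × N =>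
        c i p.1 • (τ (⟨p.2, frameSec E' F' B y₀ i p.2⟩ : TotalSpace F' B)).2) p₀ := by
      have h2 := ((contMDiffAt_totalSpace (F := F') (E := B)).1
        ((frameSec E' F' B y₀ i).contMDiff.contMDiffAt (x := p₀.2))).2
      exact ((c i).contMDiff.comp contMDiff_fst).contMDiffAt.smul
        (h2.comp p₀ contMDiff_snd.contMDiffAt)
    have h3 := contMDiffAt_finsetSum (t := Finset.univ) fun i _ => h1 i
    refine h3.congr_of_eventuallyEq ?_
    filter_upwards [continuous_snd.continuousAt.preimage_mem_nhds (τ.open_baseSet.mem_nhds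
      (FiberBundle.mem_baseSet_trivializationAt F' B p₀.2))] with p hp
    have h4 (v : B p.2) : (τ (⟨p.2, v⟩ : TotalSpace F' B)).2 = τ.linearMapAt ℝ p.2 v := by
      rw [τ.linearMapAt_apply, if_pos (show p.2 ∈ τ.baseSet from hp)]
    simp only [h4, map_sum, map_smul]
  refine ⟨⟨fun p => ((X p.1, 0), (∑ i, c i p.1 • frameSec E' F' B y₀ i p.2, 0)),
    X.contMDiff.comp contMDiff_fst, contMDiff_const, hb, contMDiff_const⟩, ?_⟩
  have e1 : ∀ᶠ x in nhds x₀, (bump F' B y₀ : SmoothBumpFunction 𝓘(ℝ, E') y₀) (Φ.base x) = 1 :=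
    Φ.contMDiff_base.continuous.continuousAt.eventually (bump F' B y₀).eventuallyEq_one
  have e2 : ∀ᶠ x in nhds x₀, Φ.base x ∈ (trivializationAt F' B y₀).baseSet :=
    Φ.contMDiff_base.continuous.continuousAt.eventually
      ((trivializationAt F' B y₀).open_baseSet.mem_nhds
        (FiberBundle.mem_baseSet_trivializationAt F' B y₀))
  filter_upwards [χ.eventuallyEq_one, e1, e2] with x h1 h2 h3
  refine Prod.ext (Prod.ext rfl rfl) (Prod.ext ?_ rfl)
  change ∑ i, c i x • frameSec E' F' B y₀ i (Φ.base x) = Φ.map x (X x)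
  conv_rhs => rw [← sum_frameCoord y₀ (Φ.base x) h3 (Φ.map x (X x))]
  refine Finset.sum_congr rfl fun i _ => ?_
  rw [frameSec_apply, h2, one_smul]
  change (χ x • frameCoord F' y₀ (Φ.base x) i (Φ.map x (X x))) • _ = _
  rw [h1, Pi.one_apply, one_smul]

/-- The section `(Φ* β, β)` for `β ∈ Γ(B*)`. -/
def VBMap.graphDualSec (β : DualSec E' F' B) : ProdSec E F A E' F' B where
  val p := ((0, dualAt (Φ.pullback β) p.1), (0, dualAt β p.2))
  contMDiff_a := (0 : Sec E F A).contMDiff.comp contMDiff_fst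
  contMDiff_α := contMDiff_dualAt_comp _ (f := fun q : TotalSpace F A × N => q.1) contMDiff_fst
  contMDiff_b := (0 : Sec E' F' B).contMDiff.comp contMDiff_snd
  contMDiff_β := contMDiff_dualAt_comp _ (f := fun q : M × TotalSpace F' B => q.2) contMDiff_snd

theorem VBMap.graphDualSec_val (β : DualSec E' F' B) (x : M) :
    (Φ.graphDualSec β).val (x, Φ.base x) = Φ.graphMap x (0, dualAt β (Φ.base x)) := by
  refine Prod.ext (Prod.ext rfl (Φ.dualAt_pullback β x)) (Prod.ext ?_ rfl)
  exact (map_zero (Φ.map x)).symm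

/-- The frame of `A` near `x` given by `frameSec`. -/
theorem exists_basis_frameSec (x : M) : ∀ᶠ z in nhds x,
    ∃ b : Basis (Fin (finrank ℝ F)) ℝ (A z), (∀ i, b i = frameSec E F A x i z) ∧
      ∀ i, b.coord i = dualAt (coframeSec E F A x i) z := by
  filter_upwards [(bump F A x : SmoothBumpFunction 𝓘(ℝ, E) x).eventuallyEq_one,
    (trivializationAt F A x).open_baseSet.mem_nhds
      (FiberBundle.mem_baseSet_trivializationAt F A x)] with z h1 h2
  refine ⟨(trivializationAt F A x).basisAt (finBasis ℝ F) h2, fun i => ?_, fun i => ?_⟩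
  · rw [frameSec_apply, h1, Pi.one_apply, one_smul,
      Trivialization.localFrame_apply_of_mem_baseSet _ _ h2]
  · rw [dualAt_coframeSec, h1, Pi.one_apply, one_smul]
    ext v
    simp [frameCoord, Trivialization.basisAt, h2]

theorem VBMap.graphMap_injective (x : M) : Function.Injective (Φ.graphMap x) := fun _ _ h =>
  Prod.ext (congrArg (fun u => u.1.1) h) (congrArg (fun u => u.2.2) h)

/-- `Φ.graphMap` is a fibrewise injective parametrization by `A ⊕ φ*B*`, so a frame of `A` and a
frame of `B*` give one of `F`. -/
theorem VBMap.exists_graphDirac_frame (x₀ : M) :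
    ∃ (r : ℕ) (e : Fin r → ProdSec E F A E' F' B), ∀ᶠ x in nhds x₀,
      LinearIndependent ℝ (fun j => (e j).val (x, Φ.base x)) ∧
        Submodule.span ℝ (Set.range fun j => (e j).val (x, Φ.base x)) = Φ.graphDirac x := by
  choose s hs using fun i => Φ.exists_graphSec x₀ (frameSec E F A x₀ i)
  let t (i) := Φ.graphDualSec (coframeSec E' F' B (Φ.base x₀) i)
  refine ⟨finrank ℝ F + finrank ℝ F', Sum.elim s t ∘ finSumFinEquiv.symm, ?_⟩
  filter_upwards [Filter.eventually_all.2 hs, exists_basis_frameSec (E := E) (F := F) (A := A) x₀,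
    Φ.contMDiff_base.continuous.continuousAt.eventually
      (exists_basis_frameSec (E := E') (F := F') (A := B) (Φ.base x₀))] with x h1 ⟨b, hb, _⟩ ⟨b', _, hb'⟩
  -- Near `x₀` the chosen sections are the images of this basis. Independence then follows from
  -- injectivity, and the span is the range of `Φ.graphMap x`.
  let b₂ := (b.prod b'.dualBasis).reindex finSumFinEquiv
  have h : (fun j => ((Sum.elim s t ∘ finSumFinEquiv.symm) j).val (x, Φ.base x)) =
      Φ.graphMap x ∘ b₂ := by
    funext j
    obtain ⟨k, rfl⟩ := finSumFinEquiv.surjective j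
    simp only [Function.comp_apply, Equiv.symm_apply_apply, b₂, Basis.reindex_apply]
    cases k with
    | inl i =>
      simp [h1, hb]
    | inr i =>
      simp only [Sum.elim_inr, t, Φ.graphDualSec_val, ← hb']
      simp
  rw [h]
  constructor
  · exact b₂.linearIndependent.map' _ (LinearMap.ker_eq_bot.2 (Φ.graphMap_injective x))
  · rw [Set.range_comp, Submodule.span_image, b₂.span_eq, Submodule.map_top]
    rfl

end Frame

variable {P : QuasiJacobiBialgebroid E F A} {Q : QuasiJacobiBialgebroid E' F' B}
  {Φ : VBMap E F A E' F' B}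

/-- Vectors tangent to the graph are the pairs `(v, Tφ v)`; here `v` is the anchor of `a + Φ* b*`,
and `Φ` intertwines both parts of the anchor. -/
theorem IsQuasiJacobiMorphism.prodAnchor_mem (hΦ : IsQuasiJacobiMorphism P Q Φ) (x : M) :
    ∀ u ∈ Φ.graphDirac x, (P.prodAnchor Q (x, Φ.base x) u).1 ∈
      LinearMap.range (mfderiv 𝓘(ℝ, E) (𝓘(ℝ, E).prod 𝓘(ℝ, E'))
        (fun x => (x, Φ.base x)) x).toLinearMap := by
  rintro _ ⟨⟨c, d⟩, rfl⟩
  have hid : MDifferentiableAt 𝓘(ℝ, E) 𝓘(ℝ, E) (fun z : M => z) x := mdifferentiableAt_id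
  have hi : mfderiv 𝓘(ℝ, E) 𝓘(ℝ, E) (fun z : M => z) x = ContinuousLinearMap.id ℝ _ := mfderiv_id
  refine ⟨(P.anchor x (c, d ∘ₗ Φ.map x)).1, ?_⟩
  rw [mfderiv_prodMk hid (Φ.contMDiff_base.mdifferentiable (by simp) x), hi]
  refine Prod.ext rfl ?_
  change mfderiv 𝓘(ℝ, E) 𝓘(ℝ, E') Φ.base x (P.alg.anchor x c + P.anchorStar x (d ∘ₗ Φ.map x)) =
    Q.alg.anchor (Φ.base x) (Φ.map x c) + Q.anchorStar (Φ.base x) d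
  rw [map_add, hΦ.mfderiv_anchor, hΦ.mfderiv_anchorStar]

theorem IsQuasiJacobiMorphism.prodBracket_mem (hΦ : IsQuasiJacobiMorphism P Q Φ)
    {e e' : ProdSec E F A E' F' B} (h : Φ.IsTangent e) (h' : Φ.IsTangent e') (x : M) :
    P.prodBracket Q e e' x (Φ.base x) ∈ Φ.graphDirac x :=
  Φ.mem_graphDirac_of_orthogonal (hΦ.prodPairing_prodBracket_eq_zero h h' x)

/-- The difference of the two brackets lies in the graph: its scalar coefficients agree on both
sides, as in `α(W_A) = α'(W_B)` and `φ_A(X) = φ_B(X')`, and the vectors and forms they multiply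
correspond under `Φ`. -/
theorem IsQuasiJacobiMorphism.prodDoubleBracket_mem (hΦ : IsQuasiJacobiMorphism P Q Φ)
    {e e' : ProdSec E F A E' F' B} (h : Φ.IsTangent e) (h' : Φ.IsTangent e') (x : M) :
    P.prodDoubleBracket Q e e' x (Φ.base x) ∈ Φ.graphDirac x := by
  refine add_mem (hΦ.prodBracket_mem h h' x) (Φ.mem_graphDirac.2 ?_)
  obtain ⟨hX, hα⟩ := Φ.mem_graphDirac.1 (h x)
  obtain ⟨hY, hβ⟩ := Φ.mem_graphDirac.1 (h' x)
  have hW := hΦ.section_W x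
  have hφ := hΦ.cocycle x
  constructor
  · simp only [hX, hα, hY, hβ, LinearMap.comp_apply, map_sub, map_smul, hW]
  · ext c
    simp only [hX, hα, hY, hβ, LinearMap.comp_apply, LinearMap.sub_apply, LinearMap.smul_apply, hφ]

end Dirac

end JacobiGeometry
end

/-! ### The theorem for both brackets. -/

open JacobiGeometry in
theorem mainTheorem2
    {E : Type*} [NormedAddCommGroup E] [NormedSpace ℝ E] [FiniteDimensional ℝ E]
    {M : Type*} [TopologicalSpace M] [ChartedSpace E M] [IsManifold 𝓘(ℝ, E) ∞ M] [T2Space M]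
    [SecondCountableTopology M]
    {F : Type*} [NormedAddCommGroup F] [NormedSpace ℝ F] [FiniteDimensional ℝ F]
    {A : M → Type*} [TopologicalSpace (TotalSpace F A)] [∀ x, TopologicalSpace (A x)]
    [∀ x, AddCommGroup (A x)] [∀ x, Module ℝ (A x)] [FiberBundle F A] [VectorBundle ℝ F A]
    [ContMDiffVectorBundle ∞ F A 𝓘(ℝ, E)]
    {E' : Type*} [NormedAddCommGroup E'] [NormedSpace ℝ E'] [FiniteDimensional ℝ E']
    {N : Type*} [TopologicalSpace N] [ChartedSpace E' N] [IsManifold 𝓘(ℝ, E') ∞ N] [T2Space N]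
    [SecondCountableTopology N]
    {F' : Type*} [NormedAddCommGroup F'] [NormedSpace ℝ F'] [FiniteDimensional ℝ F']
    {B : N → Type*} [TopologicalSpace (TotalSpace F' B)] [∀ y, TopologicalSpace (B y)]
    [∀ y, AddCommGroup (B y)] [∀ y, Module ℝ (B y)] [FiberBundle F' B] [VectorBundle ℝ F' B]
    [ContMDiffVectorBundle ∞ F' B 𝓘(ℝ, E')]
    (P : QuasiJacobiBialgebroid E F A) (Q : QuasiJacobiBialgebroid E' F' B)
    (Φ : VBMap E F A E' F' B) (hΦ : IsQuasiJacobiMorphism P Q Φ) :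
    (P.prodBar Q).IsDiracOn 𝓘(ℝ, E) (fun x => (x, Φ.base x)) Φ.graphDirac ∧
      (P.prodBarDouble Q).IsDiracOn 𝓘(ℝ, E) (fun x => (x, Φ.base x)) Φ.graphDirac := by
  refine ⟨⟨Φ.exists_graphDirac_frame, Φ.graphDirac_isotropic, Φ.graphDirac_maximal,
      hΦ.prodAnchor_mem, fun _ _ h h' => hΦ.prodBracket_mem h h'⟩,
    ⟨Φ.exists_graphDirac_frame, Φ.graphDirac_isotropic, Φ.graphDirac_maximal,
      hΦ.prodAnchor_mem, fun _ _ h h' => hΦ.prodDoubleBracket_mem h h'⟩⟩
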